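/- Let $\mathbb D=\{z\in\mathbb C:|z|<1\}$ and let $\wp\subset\mathbb D$ be a simple loop (the image of the circle under an injective continuous map), at positive distance from $0$, surrounding $0$ (that is, $0$ lies in a bounded connected component of $\mathbb C\setminus\wp$). Put $r_-(\wp)=d(0,\wp)$ and $r_+(\wp)=\max\{|z|:z\in\wp\}$. Let $\operatorname{ED}(\partial\mathbb D,\wp)=\frac1{2\pi}\log\frac1r$ be the extremal distance between $\partial\mathbb D$ and $\wp$, where $r\in(0,1)$ is the unique number such that the annular domain between $\wp$ and $\partial\mathbb D$ (the set of points of $\mathbb D$ lying neither on $\wp$ nor in a bounded component of $\mathbb C\setminus\wp$) is conformally equivalent to $\{r<|w|<1\}$. Let $\operatorname{CR}(0,\mathbb D\setminus\wp)=\phi'(0)^{-1}$ be the conformal radius seen from $0$ of the domain $D_0$ surrounded by $\wp$ (the connected component of $\mathbb D\setminus\wp$ containing $0$), where $\phi:D_0\to\mathbb D$ is the conformal bijection with $\phi(0)=0$ and $\phi'(0)>0$. Then $$e^{-2\pi \operatorname{ED}(\partial\mathbb D,\wp)}\le r_+(\wp)\le 4\,e^{-2\pi \operatorname{ED}(\partial\mathbb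 D,\wp)},$$ and $$e^{-2\pi \operatorname{ED}(\partial\mathbb D,\wp)}\operatorname{CR}(0,\mathbb D\setminus\wp)^{-1}\le\frac{r_+(\wp)}{r_-(\wp)}\le 16\,e^{-2\pi \operatorname{ED}(\partial\mathbb D,\wp)}\operatorname{CR}(0,\mathbb D\setminus\wp)^{-1}.$$ -/

import Mathlib

/-- `φ` restricts to a conformal map (a holomorphic bijection) of `U` onto `V`. -/
def IsConformalOnto (φ : ℂ → ℂ) (U V : Set ℂ) : Prop :=
  DifferentiableOn ℂ φ U ∧ Set.BijOn φ U V

/-- The open annulus `𝔻 \ r 𝔻̄`. -/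
def roundAnnulus (r : ℝ) : Set ℂ := {w : ℂ | r < ‖w‖ ∧ ‖w‖ < 1}

open Classical in
/-- The conformal radius of `D` seen from `z`: it is `φ'(z)⁻¹`, where `φ` is the conformal map of `D`
onto the unit disk with `φ z = 0` and `φ'(z) > 0` (the number `φ'(z)` is unique by the Schwarz
lemma). The value is `0` if there is no such map. -/
noncomputable def confRadius (z : ℂ) (D : Set ℂ) : ℝ :=
  if h : ∃ c : ℝ, 0 < c ∧ ∃ φ : ℂ → ℂ,
      IsConformalOnto φ D (Metric.ball 0 1) ∧ φ z = 0 ∧ HasDerivAt φ (c : ℂ) z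
  then h.choose⁻¹ else 0

open Classical in
/-- The extremal distance between the two boundary components of an annular domain `D`: it is
`(2π)⁻¹ log (1 / r)`, where `r ∈ (0, 1)` is the unique number such that `D` is conformally
equivalent to `𝔻 \ r 𝔻̄`. (Which boundary component goes to which circle does not affect `r`,
because `w ↦ r / w` is an automorphism of that annulus which swaps the two circles.)
The value is `0` if there is no such `r`. -/
noncomputable def annularED (D : Set ℂ) : ℝ :=
  if h : ∃ r : ℝ, 0 < r ∧ r < 1 ∧ ∃ φ : ℂ → ℂ, IsConformalOnto φ D (roundAnnulus r)
  then 1 / (2 * Real.pi) * Real.log (1 / h.choose) else 0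

/-- `C` is a simple loop in the plane: an injective continuous image of the circle. -/
def IsSimpleLoop (C : Set ℂ) : Prop :=
  ∃ γ : Circle → ℂ, Continuous γ ∧ Function.Injective γ ∧ C = Set.range γ

/-- The loop `C` surrounds `z`: `z` lies in a bounded connected component of the complement. -/
def Surrounds (C : Set ℂ) (z : ℂ) : Prop :=
  z ∉ C ∧ Bornology.IsBounded (connectedComponentIn Cᶜ z)

/-- The exterior of `C`: the points that lie neither on `C` nor in a bounded component of its
complement. -/
def loopExterior (C : Set ℂ) : Set ℂ :=
  {z | z ∉ C ∧ ¬ Surrounds C z}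

/-- `ED(∂𝔻, C)` for a loop `C` in the unit disk: the extremal distance between the boundary
components of the annular domain between `C` and `∂𝔻`. -/
noncomputable def diskED (C : Set ℂ) : ℝ :=
  annularED (Metric.ball 0 1 ∩ loopExterior C)

/-- `CR(0, 𝔻 \ C)` for a loop `C` in the unit disk surrounding `0`: the conformal radius seen from
`0` of the domain surrounded by `C`, that is, of the component of `𝔻 \ C` that contains `0`. -/
noncomputable def loopCR (C : Set ℂ) : ℝ :=
  confRadius 0 (connectedComponentIn (Metric.ball 0 1 \ C) 0)

/-- `r₋(C) = d(0, C)`. -/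
noncomputable def rMinus (C : Set ℂ) : ℝ := Metric.infDist 0 C

/-- `r₊(C) = max {|z| : z ∈ C}`. -/
noncomputable def rPlus (C : Set ℂ) : ℝ := sSup ((fun z : ℂ => ‖z‖) '' C)

open Complex Metric Set Filter Topology MeasureTheory

namespace LoopED

/-! ### Holomorphic logarithms, injective holomorphic maps, normal families -/

/-! Let `K` be the loop with everything it encloses, `a` a point of the loop farthest from `0` and
`p` a nearest one, `r` the inner radius of the round model of `𝔻 \ K`, and `c = φ'(0)` for the
Riemann map of the enclosed domain. It suffices to show `r ≤ ‖a‖ ≤ 4r` and `‖p‖ ≤ c⁻¹ ≤ 4‖p‖`: the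
first pair is the first display, and combining the two pairs gives the second, with `16 = 4 · 4`.
The bound `‖p‖ ≤ c⁻¹` is the Schwarz lemma.

The other three are length–area estimates (`lengthArea`). In logarithmic coordinates an annulus is a
vertical strip modulo `2πi`. If a holomorphic `Y` changes by at least `2π` in modulus under that
translation, then `∫ |Y'|²` over a period cell is at least `2π` times the width, and an injective
map of the cell turns this integral into an area in the image. For `r ≤ ‖a‖` the area density is
`|w|⁻²` (`le_of_conformal_roundAnnulus`). For both factors `4` it is `1 / |z (z - a)|`, the extremal
metric off the segment `[0, a]` (`width_le_log`). Its natural coordinate is `log ((1 + q) / (1 -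
q))` with `q² = 1 - a / z`, the logarithm of an inverse Joukowski map, and its mass on `|z| < T` is
at most `2π log (4T / |a|)` (`lintegral_poleDensity_le`). The Grötzsch bound `norm_le_four_mul` uses
it with `a ∈ K`: as `K` is connected and contains `0` and `a`, curves off `K` wind equally about
both, so `q` is single-valued on the annulus. Koebe's bound `inv_deriv_le_four_mul` uses it for the
reciprocal of the inverse Riemann map, with pole `1 / p`.

The definitions take a default value unless conformal maps exist, so these have to be built.
`riemann_mapping` maximises a derivative and needs only holomorphic square roots, which come from
primitives (`exists_primitive`): Cauchy–Pompeiu writes a function as a superposition of kernels `1 /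
(z - ζ)`, and each kernel has a primitive because its pole can be pushed to infinity in small steps
through the complement. For the annulus, `exp⁻¹ (𝔻 \ K)` is mapped to a disk; translation by `2πi`
becomes an automorphism without fixed points, and normalising it yields a half-plane or a strip,
hence a round annulus with `r ≥ 0` (`exists_conformal_roundAnnulus`). The punctured disk, `r = 0`,
is then excluded by `norm_le_four_mul`. -/

theorem differentiableOn_of_exp_comp {U : Set ℂ} (hU : IsOpen U) {L f : ℂ → ℂ}
    (hL : ContinuousOn L U) (hf : DifferentiableOn ℂ f U) (h : ∀ z ∈ U, exp (L z) = f z) :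
    DifferentiableOn ℂ L U := by
  intro z hz
  have hUz := hU.mem_nhds hz
  have hLz := hL.continuousAt hUz
  -- While `L w - L z` has modulus below `1 < π`, the principal logarithm inverts `exp`, so `L` is
  -- locally a translate of a holomorphic logarithm.
  have hev : ∀ᶠ w in 𝓝 z, L w = L z + log (f w / f z) := by
    have : ∀ᶠ w in 𝓝 z, ‖L w - L z‖ < 1 := by
      have := hLz.eventually (Metric.ball_mem_nhds (L z) one_pos)
      simpa [dist_eq_norm] using this
    filter_upwards [this, hUz] with w hw hwU
    have him : |(L w - L z).im| < 1 := (abs_im_le_norm _).trans_lt hw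
    have hpi := Real.pi_gt_three
    rw [← h w hwU, ← h z hz, ← Complex.exp_sub, Complex.log_exp]
    · ring
    · linarith [(abs_lt.1 him).1]
    · linarith [(abs_lt.1 him).2]
  have hfz : f z ≠ 0 := by rw [← h z hz]; exact exp_ne_zero _
  have hd : DifferentiableAt ℂ (fun w => L z + log (f w / f z)) z := by
    refine (DifferentiableAt.clog ((hf.differentiableAt hUz).div_const _) ?_).const_add _
    simp [div_self hfz]
  exact (hd.congr_of_eventuallyEq hev).differentiableWithinAt

theorem exists_log_of_convex {U : Set ℂ} (hU : IsOpen U) (hc : Convex ℝ U) {f : ℂ → ℂ}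
    (hf : DifferentiableOn ℂ f U) (h0 : ∀ z ∈ U, f z ≠ 0) :
    ∃ L : ℂ → ℂ, DifferentiableOn ℂ L U ∧ ∀ z ∈ U, exp (L z) = f z := by
  rcases U.eq_empty_or_nonempty with rfl | hne
  · exact ⟨0, by simp [differentiableOn_empty], by simp⟩
  have hs : IsSimplyConnected U := by
    have : ContractibleSpace U := hc.contractibleSpace hne
    exact SimplyConnectedSpace.ofContractible U
  obtain ⟨L, hL, hL'⟩ := exists_continuousOn_eqOn_exp_comp hs hU hf.continuousOn
    (by rintro ⟨z, hz, h⟩; exact h0 z hz h)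
  exact ⟨L, differentiableOn_of_exp_comp hU hL hf hL', hL'⟩

theorem image_mem_nhds_of_injOn {U : Set ℂ} (hU : IsOpen U) {f : ℂ → ℂ}
    (hf : DifferentiableOn ℂ f U) (hi : InjOn f U) {z : ℂ} (hz : z ∈ U) {W : Set ℂ}
    (hW : W ∈ 𝓝 z) : f '' W ∈ 𝓝 (f z) := by
  rcases (hf.analyticAt (hU.mem_nhds hz)).eventually_constant_or_nhds_le_map_nhds with h | h
  · exfalso
    have h2 : ∀ᶠ w in 𝓝[≠] z, w = z := by
      have h3 := h.and (hU.mem_nhds hz)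
      exact (h3.filter_mono nhdsWithin_le_nhds).mono fun w hw => hi hw.2 hz hw.1
    obtain ⟨w, hw, hw'⟩ := (h2.and self_mem_nhdsWithin).exists
    exact hw' hw
  · exact h (image_mem_map hW)

theorem isOpen_image_of_injOn {U : Set ℂ} (hU : IsOpen U) {f : ℂ → ℂ}
    (hf : DifferentiableOn ℂ f U) (hi : InjOn f U) : IsOpen (f '' U) := by
  rw [isOpen_iff_mem_nhds]
  rintro _ ⟨z, hz, rfl⟩
  exact image_mem_nhds_of_injOn hU hf hi hz (hU.mem_nhds hz)

/-- The inverse of an injective holomorphic map is holomorphic. -/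
theorem differentiableOn_invFunOn {U : Set ℂ} (hU : IsOpen U) {f : ℂ → ℂ}
    (hf : DifferentiableOn ℂ f U) (hi : InjOn f U) :
    DifferentiableOn ℂ (Function.invFunOn f U) (f '' U) := by
  set g := Function.invFunOn f U with hg
  have hgf : ∀ z ∈ U, g (f z) = z := fun z hz => hi.leftInvOn_invFunOn hz
  have hV := isOpen_image_of_injOn hU hf hi
  have hgc : ∀ z ∈ U, ContinuousAt g (f z) := by
    intro z hz
    rw [ContinuousAt, hgf z hz]
    intro W hW
    have := image_mem_nhds_of_injOn hU hf hi hz (inter_mem hW (hU.mem_nhds hz))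
    rw [mem_map]
    refine mem_of_superset this ?_
    rintro _ ⟨w, hw, rfl⟩
    simpa [hgf w hw.2] using hw.1
  have hgd : ∀ z ∈ U, deriv f z ≠ 0 → DifferentiableAt ℂ g (f z) := by
    intro z hz hd
    have h1 : HasDerivAt f (deriv f z) (g (f z)) := by
      rw [hgf z hz]; exact (hf.differentiableAt (hU.mem_nhds hz)).hasDerivAt
    refine (HasDerivAt.of_local_left_inverse (hgc z hz) h1 hd ?_).differentiableAt
    filter_upwards [hV.mem_nhds (mem_image_of_mem f hz)] with w hw
    obtain ⟨y, hy, rfl⟩ := hw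
    rw [hgf y hy]
  rintro _ ⟨z, hz, rfl⟩
  have han := (hf.analyticAt (hU.mem_nhds hz)).deriv
  -- Zeros of `f'` are isolated, since otherwise `f` would be locally constant. The inverse is
  -- continuous at `f z` and differentiable nearby, so the singularity at `f z` is removable.
  rcases han.eventually_eq_zero_or_eventually_ne_zero with h | h
  · exfalso
    obtain ⟨ε, hε, hb⟩ := Metric.mem_nhds_iff.1 (inter_mem h (hU.mem_nhds hz))
    have hfin : ∀ᶠ w in 𝓝[≠] z, w = z := by
      filter_upwards [nhdsWithin_le_nhds (ball_mem_nhds z hε)] with w hw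
      refine hi (hb hw).2 hz ?_
      exact isOpen_ball.is_const_of_deriv_eq_zero (convex_ball z ε).isPreconnected
        (hf.mono fun y hy => (hb hy).2) (fun y hy => (hb hy).1) hw (mem_ball_self hε)
    obtain ⟨w, hw, hw'⟩ := (hfin.and self_mem_nhdsWithin).exists
    exact hw' hw
  · have h2 : {w | w ≠ z → deriv f w ≠ 0} ∈ 𝓝 z := by
      have := eventually_nhdsWithin_iff.1 h
      exact this
    have h3 := image_mem_nhds_of_injOn hU hf hi hz (inter_mem h2 (hU.mem_nhds hz))
    refine DifferentiableWithinAt.mono_of_mem_nhdsWithin (t := univ) ?_ univ_mem |>.mono (subset_univ _)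
    rw [differentiableWithinAt_univ]
    refine ((differentiableOn_compl_singleton_and_continuousAt_iff h3).1 ⟨?_, hgc z hz⟩).differentiableAt h3
    rintro _ ⟨⟨w, hw, rfl⟩, hne⟩
    refine (hgd w hw.2 (hw.1 ?_)).differentiableWithinAt
    rintro rfl; exact hne rfl

theorem exists_holomorphic_inverse {U V : Set ℂ} (hU : IsOpen U) {f : ℂ → ℂ}
    (hf : IsConformalOnto f U V) :
    ∃ g : ℂ → ℂ, IsConformalOnto g V U ∧ (∀ z ∈ U, g (f z) = z) ∧ ∀ w ∈ V, f (g w) = w := by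
  obtain ⟨hd, hb⟩ := hf
  have hl : ∀ z ∈ U, Function.invFunOn f U (f z) = z := fun z hz => hb.injOn.leftInvOn_invFunOn hz
  have hr : ∀ w ∈ V, f (Function.invFunOn f U w) = w := by
    intro w hw
    obtain ⟨z, hz, rfl⟩ := hb.surjOn hw
    rw [hl z hz]
  refine ⟨Function.invFunOn f U, ⟨?_, ?_⟩, hl, hr⟩
  · rw [← hb.image_eq]; exact differentiableOn_invFunOn hU hd hb.injOn
  · exact (InvOn.bijOn ⟨hr, hl⟩ (hb.surjOn.mapsTo_invFunOn) hb.mapsTo)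

theorem deriv_ne_zero_of_injOn {U : Set ℂ} (hU : IsOpen U) {f : ℂ → ℂ}
    (hf : DifferentiableOn ℂ f U) (hi : InjOn f U) {z : ℂ} (hz : z ∈ U) : deriv f z ≠ 0 := by
  have hg := (differentiableOn_invFunOn hU hf hi).differentiableAt
    ((isOpen_image_of_injOn hU hf hi).mem_nhds (mem_image_of_mem f hz))
  have h1 := hg.hasDerivAt.comp z (hf.differentiableAt (hU.mem_nhds hz)).hasDerivAt
  have h2 : HasDerivAt (Function.invFunOn f U ∘ f) 1 z := by
    refine (hasDerivAt_id z).congr_of_eventuallyEq ?_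
    filter_upwards [hU.mem_nhds hz] with w hw using hi.leftInvOn_invFunOn hw
  intro h0
  have := h1.unique h2
  simp [h0] at this

/-- Hurwitz's theorem without counting zeros: if `|f - f z| ≥ ε` on the circle, a uniformly close `F
i` stays at distance `ε / 2` from `F i z` there, so by the quantitative open mapping theorem its
image covers the disk of radius `ε / 4` about `F i z`, which contains `f z`. -/
theorem eventually_mem_image_closedBall {ι : Type*} {φ : Filter ι} {U : Set ℂ}
    {F : ι → ℂ → ℂ} {f : ℂ → ℂ} (hF : ∀ i, DifferentiableOn ℂ (F i) U)
    (hi : ∀ i, InjOn (F i) U) (hc : ContinuousOn f U) (h : TendstoLocallyUniformlyOn F f φ U) (hU : IsOpen U)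
    {z : ℂ} {r : ℝ} (hr : 0 < r) (hzr : closedBall z r ⊆ U)
    (hs : ∀ w ∈ sphere z r, f w ≠ f z) : ∀ᶠ i in φ, f z ∈ F i '' closedBall z r := by
  obtain ⟨ε, hε, hεs⟩ : ∃ ε > 0, ∀ w ∈ sphere z r, ε ≤ ‖f w - f z‖ := by
    have hne : (sphere z r).Nonempty := NormedSpace.sphere_nonempty.2 hr.le
    obtain ⟨w, hw, hmin⟩ := (isCompact_sphere z r).exists_isMinOn hne
      (f := fun w => ‖f w - f z‖)
      (((hc.mono (sphere_subset_closedBall.trans hzr)).sub continuousOn_const).norm)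
    exact ⟨‖f w - f z‖, norm_pos_iff.2 (sub_ne_zero.2 (hs w hw)), fun y hy => hmin hy⟩
  have hu := (tendstoLocallyUniformlyOn_iff_forall_isCompact hU).1 h _ hzr (isCompact_closedBall z r)
  rw [Metric.tendstoUniformlyOn_iff] at hu
  filter_upwards [hu (ε / 8) (by positivity)] with i hi'
  have hz : z ∈ closedBall z r := mem_closedBall_self hr.le
  have hdc : DiffContOnCl ℂ (F i) (ball z r) :=
    ((hF i).mono (by rw [closure_ball z hr.ne']; exact hzr)).diffContOnCl
  have hz0 := hi' z hz
  rw [dist_eq_norm] at hz0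
  have hsub := hdc.ball_subset_image_closedBall (ε := ε / 2) hr ?_ ?_
  · apply hsub
    rw [mem_ball, dist_eq_norm]; linarith
  · intro w hw
    have h1 := hi' w (sphere_subset_closedBall hw)
    rw [dist_eq_norm] at h1
    have h2 := hεs w hw
    have h3 : ‖f w - f z‖ ≤ ‖f w - F i w‖ + ‖F i w - F i z‖ + ‖f z - F i z‖ := by
      have : f w - f z = (f w - F i w) + (F i w - F i z) - (f z - F i z) := by ring
      rw [this]
      exact (norm_sub_le _ _).trans (add_le_add_left (norm_add_le _ _) _)
    linarith
  · have : ∀ᶠ w in 𝓝[≠] z, F i w ≠ F i z := by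
      filter_upwards [self_mem_nhdsWithin, nhdsWithin_le_nhds (hU.mem_nhds (hzr hz))] with w hw hwU h
      exact hw (hi i hwU (hzr hz) h)
    exact this.frequently.filter_mono nhdsWithin_le_nhds

/-- Hurwitz: a nonconstant locally uniform limit of injective holomorphic maps is injective. -/
theorem injOn_of_tendstoLocallyUniformlyOn {ι : Type*} {φ : Filter ι} [φ.NeBot] {U : Set ℂ}
    (hU : IsOpen U) (hUc : IsPreconnected U) {F : ι → ℂ → ℂ} {f : ℂ → ℂ}
    (hF : ∀ i, DifferentiableOn ℂ (F i) U) (hi : ∀ i, InjOn (F i) U)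
    (h : TendstoLocallyUniformlyOn F f φ U) {z₀ : ℂ} (hz₀ : z₀ ∈ U) (hd : deriv f z₀ ≠ 0) :
    InjOn f U := by
  have hfd : DifferentiableOn ℂ f U := h.differentiableOn (Eventually.of_forall hF) hU
  have han : AnalyticOnNhd ℂ f U := hfd.analyticOnNhd hU
  intro z hz w hw hzw
  by_contra hne
  -- Radii below half the distance make the two disks disjoint, so an `F i` that takes the common
  -- value `f z = f w` in both is not injective.
  have key : ∀ y ∈ U, ∃ r > 0, r < dist z w / 2 ∧ closedBall y r ⊆ U ∧
      ∀ x ∈ sphere y r, f x ≠ f y := by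
    intro y hy
    have hnc : ∀ᶠ x in 𝓝[≠] y, f x ≠ f y := by
      rcases (han y hy).eventually_eq_or_eventually_ne analyticAt_const (g := fun _ => f y) with h1 | h1
      · exfalso
        have h2 := han.eqOn_of_preconnected_of_eventuallyEq analyticOnNhd_const hUc hy h1
        apply hd
        have : f =ᶠ[𝓝 z₀] fun _ => f y := by
          filter_upwards [hU.mem_nhds hz₀] with x hx using h2 hx
        rw [this.deriv_eq]; simp
      · exact h1
    obtain ⟨ε, hε, hb⟩ := Metric.mem_nhds_iff.1
      (inter_mem (eventually_nhdsWithin_iff.1 hnc) (hU.mem_nhds hy))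
    have hdp : 0 < dist z w := dist_pos.2 hne
    refine ⟨min (ε / 2) (dist z w / 4), by positivity, ?_, ?_, ?_⟩
    · exact (min_le_right _ _).trans_lt (by linarith)
    · intro x hx
      exact (hb (closedBall_subset_ball ((min_le_left _ _).trans_lt (by linarith)) hx)).2
    · intro x hx
      have hr : 0 < min (ε / 2) (dist z w / 4) := by positivity
      refine (hb (closedBall_subset_ball ((min_le_left _ _).trans_lt (by linarith))
        (sphere_subset_closedBall hx))).1 ?_
      rintro rfl
      simp [hr.ne] at hx
  obtain ⟨r₁, hr₁, hl₁, hs₁, hn₁⟩ := key z hz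
  obtain ⟨r₂, hr₂, hl₂, hs₂, hn₂⟩ := key w hw
  have e₁ := eventually_mem_image_closedBall hF hi hfd.continuousOn h hU hr₁ hs₁ hn₁
  have e₂ := eventually_mem_image_closedBall hF hi hfd.continuousOn h hU hr₂ hs₂ hn₂
  obtain ⟨i, ⟨x, hx, hx'⟩, ⟨y, hy, hy'⟩⟩ := (e₁.and e₂).exists
  have hxy : x = y := hi i (hs₁ hx) (hs₂ hy) (by rw [hx', hy', hzw])
  subst hxy
  rw [mem_closedBall] at hx hy
  have := dist_triangle_left z w x
  linarith

/-- Montel: a uniformly bounded family of holomorphic functions converges locally uniformly along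
every ultrafilter. -/
theorem exists_tendstoLocallyUniformlyOn_ultrafilter {ι : Type*} (φ : Ultrafilter ι) {U : Set ℂ}
    (hU : IsOpen U) {F : ι → ℂ → ℂ} (hF : ∀ i, DifferentiableOn ℂ (F i) U)
    (hb : ∀ i, ∀ z ∈ U, ‖F i z‖ ≤ 1) : ∃ f : ℂ → ℂ, TendstoLocallyUniformlyOn F f φ U := by
  have hpt : ∀ z, ∃ y, z ∈ U → Tendsto (fun i => F i z) φ (𝓝 y) := by
    intro z
    by_cases hz : z ∈ U
    · obtain ⟨y, -, hy⟩ := (isCompact_closedBall (0 : ℂ) 1).ultrafilter_le_nhds'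
        (φ.map fun i => F i z) (by
          rw [Ultrafilter.mem_map]
          exact univ_mem' fun i => by simpa using hb i z hz)
      exact ⟨y, fun _ => hy⟩
    · exact ⟨0, fun h => absurd h hz⟩
  choose f hf using hpt
  refine ⟨f, ?_⟩
  rw [Metric.tendstoLocallyUniformlyOn_iff]
  intro ε hε z hz
  obtain ⟨r, hr, hrU⟩ := Metric.isOpen_iff.1 hU z hz
  -- The Schwarz lemma gives a Lipschitz bound uniform in `i`, which upgrades the pointwise limits
  -- to locally uniform ones. The `2` bounds the difference of two values in the unit disk.
  have hlip : ∀ i, ∀ w ∈ ball z r, ‖F i w - F i z‖ ≤ 2 / r * ‖w - z‖ := by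
    intro i w hw
    have := dist_le_div_mul_dist_of_mapsTo_ball (R₂ := 2) ((hF i).mono hrU) (fun y hy => by
      rw [mem_closedBall, dist_eq_norm]
      linarith [norm_sub_le (F i y) (F i z), hb i y (hrU hy), hb i z hz]) hw
    simpa [dist_eq_norm] using this
  have hlip' : ∀ w ∈ ball z r, ‖f w - f z‖ ≤ 2 / r * ‖w - z‖ := by
    intro w hw
    exact le_of_tendsto ((hf w (hrU hw)).sub (hf z hz)).norm (Eventually.of_forall fun i => hlip i w hw)
  refine ⟨ball z (min r (r * ε / 8)), nhdsWithin_le_nhds (ball_mem_nhds _ (by positivity)), ?_⟩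
  have hz' := Metric.tendsto_nhds.1 (hf z hz) (ε / 3) (by positivity)
  filter_upwards [hz'] with i hi w hw
  have hw1 : w ∈ ball z r := ball_subset_ball (min_le_left _ _) hw
  have hw2 : ‖w - z‖ < r * ε / 8 := by
    rw [← dist_eq_norm]; exact (mem_ball.1 hw).trans_le (min_le_right _ _)
  have hsm : 2 / r * ‖w - z‖ ≤ ε / 4 := by
    calc 2 / r * ‖w - z‖ ≤ 2 / r * (r * ε / 8) := by gcongr
      _ = ε / 4 := by field_simp; ring
  have h1 := hlip i w hw1
  have h2 := hlip' w hw1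
  rw [dist_eq_norm] at hi ⊢
  have : f w - F i w = (f w - f z) - (F i w - F i z) - (F i z - f z) := by ring
  rw [this]
  have h3 := norm_sub_le ((f w - f z) - (F i w - F i z)) (F i z - f z)
  have h4 := norm_sub_le (f w - f z) (F i w - F i z)
  linarith

/-! ### The Riemann mapping theorem for domains with holomorphic square roots -/

/-- The Blaschke factor vanishing at `b`. -/
noncomputable def blaschke (b w : ℂ) : ℂ := (w - b) / (1 - (starRingEnd ℂ) b * w)

theorem blaschke_denom_ne_zero {b w : ℂ} (hb : ‖b‖ < 1) (hw : ‖w‖ < 1) :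
    1 - (starRingEnd ℂ) b * w ≠ 0 := by
  intro h
  have h1 : (starRingEnd ℂ) b * w = 1 := (sub_eq_zero.1 h).symm
  have h2 : ‖b‖ * ‖w‖ = 1 := by rw [← RCLike.norm_conj b, ← norm_mul, h1, norm_one]
  nlinarith [norm_nonneg b, norm_nonneg w]

theorem normSq_blaschke_aux (b w : ℂ) :
    ‖1 - (starRingEnd ℂ) b * w‖ ^ 2 - ‖w - b‖ ^ 2 = (1 - ‖b‖ ^ 2) * (1 - ‖w‖ ^ 2) := by
  simp only [← Complex.normSq_eq_norm_sq, Complex.normSq_apply]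
  simp
  ring

theorem norm_blaschke_lt_one {b w : ℂ} (hb : ‖b‖ < 1) (hw : ‖w‖ < 1) : ‖blaschke b w‖ < 1 := by
  rw [blaschke, norm_div, div_lt_one (norm_pos_iff.2 (blaschke_denom_ne_zero hb hw))]
  have h := normSq_blaschke_aux b w
  have h1 : 0 < (1 - ‖b‖ ^ 2) * (1 - ‖w‖ ^ 2) := by
    apply mul_pos <;> nlinarith [norm_nonneg b, norm_nonneg w]
  exact lt_of_pow_lt_pow_left₀ 2 (norm_nonneg _) (by linarith)

theorem blaschke_self (b : ℂ) : blaschke b b = 0 := by simp [blaschke]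

theorem blaschke_eq_zero_iff {b w : ℂ} (hb : ‖b‖ < 1) (hw : ‖w‖ < 1) :
    blaschke b w = 0 ↔ w = b := by
  rw [blaschke, div_eq_zero_iff, sub_eq_zero, or_iff_left (blaschke_denom_ne_zero hb hw)]

theorem blaschke_neg_blaschke {b w : ℂ} (hb : ‖b‖ < 1) (hw : ‖w‖ < 1) :
    blaschke (-b) (blaschke b w) = w := by
  have h1 := blaschke_denom_ne_zero hb hw
  have h2 : 1 - (starRingEnd ℂ) b * b ≠ 0 := blaschke_denom_ne_zero hb hb
  have h3 := blaschke_denom_ne_zero (b := -b) (by simpa using hb) (norm_blaschke_lt_one hb hw)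
  rw [blaschke, div_eq_iff h3]
  simp only [blaschke, map_neg]
  set d := 1 - (starRingEnd ℂ) b * w with hd
  have h4 : (starRingEnd ℂ) b * w = 1 - d := by rw [hd]; ring
  field_simp
  linear_combination (b - w) * h4

theorem hasDerivAt_blaschke {b w : ℂ} (hb : ‖b‖ < 1) (hw : ‖w‖ < 1) :
    HasDerivAt (blaschke b) ((1 - (‖b‖ : ℂ) ^ 2) / (1 - (starRingEnd ℂ) b * w) ^ 2) w := by
  have h1 := blaschke_denom_ne_zero hb hw
  have := ((hasDerivAt_id w).sub_const b).div
    (((hasDerivAt_id w).const_mul ((starRingEnd ℂ) b)).const_sub 1) h1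
  refine this.congr_deriv ?_
  rw [← Complex.conj_mul']
  simp only [id]
  congr 1
  ring

theorem blaschke_injOn {b : ℂ} (hb : ‖b‖ < 1) : InjOn (blaschke b) (ball 0 1) := by
  intro w hw v hv h
  rw [mem_ball_zero_iff] at hw hv
  rw [← blaschke_neg_blaschke hb hw, h, blaschke_neg_blaschke hb hv]

theorem differentiableOn_blaschke {b : ℂ} (hb : ‖b‖ < 1) :
    DifferentiableOn ℂ (blaschke b) (ball 0 1) := fun _ hw =>
  (hasDerivAt_blaschke hb (mem_ball_zero_iff.1 hw)).differentiableAt.differentiableWithinAt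

/-- The injective holomorphic maps of `Ω` into the unit disk that vanish at `z₀`. -/
def diskEmbeddings (Ω : Set ℂ) (z₀ : ℂ) : Set (ℂ → ℂ) :=
  {f | DifferentiableOn ℂ f Ω ∧ InjOn f Ω ∧ MapsTo f Ω (ball 0 1) ∧ f z₀ = 0}

theorem blaschke_comp_mem_diskEmbeddings {Ω : Set ℂ} {z₀ : ℂ} (hz₀ : z₀ ∈ Ω) {j : ℂ → ℂ}
    (hj : DifferentiableOn ℂ j Ω) (hi : InjOn j Ω) (hm : MapsTo j Ω (ball 0 1)) :
    blaschke (j z₀) ∘ j ∈ diskEmbeddings Ω z₀ := by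
  have hb : ‖j z₀‖ < 1 := mem_ball_zero_iff.1 (hm hz₀)
  refine ⟨(differentiableOn_blaschke hb).comp hj hm, (blaschke_injOn hb).comp hi hm, ?_,
    blaschke_self _⟩
  intro z hz
  exact mem_ball_zero_iff.2 (norm_blaschke_lt_one hb (mem_ball_zero_iff.1 (hm hz)))

/-- A maximising sequence converges along an ultrafilter. The limit's derivative dominates that of a
given embedding, hence is nonzero, so Hurwitz makes the limit injective; being open, its image lies
in the open disk and not merely in the closed one. -/
theorem exists_max_deriv_diskEmbeddings {Ω : Set ℂ} (hΩ : IsOpen Ω) (hc : IsPreconnected Ω)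
    {z₀ : ℂ} (hz₀ : z₀ ∈ Ω) (hne : (diskEmbeddings Ω z₀).Nonempty) :
    ∃ f ∈ diskEmbeddings Ω z₀, ∀ g ∈ diskEmbeddings Ω z₀, ‖deriv g z₀‖ ≤ ‖deriv f z₀‖ := by
  set S := (fun f : ℂ → ℂ => ‖deriv f z₀‖) '' diskEmbeddings Ω z₀ with hS
  have hSne : S.Nonempty := hne.image _
  obtain ⟨r, hr, hrΩ⟩ := Metric.isOpen_iff.1 hΩ z₀ hz₀
  have hbdd : BddAbove S := by
    refine ⟨1 / r, ?_⟩
    rintro _ ⟨f, ⟨hd, -, hm, h0⟩, rfl⟩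
    refine norm_deriv_le_div_of_mapsTo_ball (hd.mono hrΩ) ?_ hr
    intro z hz
    rw [h0]
    exact ball_subset_closedBall (hm (hrΩ hz))
  obtain ⟨u, -, hu, huS⟩ := exists_seq_tendsto_sSup hSne hbdd
  choose F hF hFu using huS
  have hD := fun n => (hF n).1
  obtain ⟨f, hf⟩ := exists_tendstoLocallyUniformlyOn_ultrafilter (hyperfilter ℕ) hΩ hD
    fun n z hz => (mem_ball_zero_iff.1 ((hF n).2.2.1 hz)).le
  have hfd : DifferentiableOn ℂ f Ω := hf.differentiableOn (Eventually.of_forall hD) hΩ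
  have hderiv : ‖deriv f z₀‖ = sSup S := by
    have h1 := ((hf.deriv (Eventually.of_forall hD) hΩ).tendsto_at hz₀).norm
    have h2 : Tendsto u (hyperfilter ℕ) (𝓝 (sSup S)) :=
      hu.mono_left (Nat.cofinite_eq_atTop ▸ hyperfilter_le_cofinite)
    refine tendsto_nhds_unique (h1.congr fun n => ?_) h2
    exact hFu n
  have hpos : deriv f z₀ ≠ 0 := by
    obtain ⟨g, hg⟩ := hne
    have h1 : 0 < ‖deriv g z₀‖ := norm_pos_iff.2 (deriv_ne_zero_of_injOn hΩ hg.1 hg.2.1 hz₀)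
    have h2 := le_csSup hbdd (mem_image_of_mem _ hg)
    rw [← norm_pos_iff, hderiv]
    exact h1.trans_le h2
  have hinj := injOn_of_tendstoLocallyUniformlyOn hΩ hc hD (fun n => (hF n).2.1) hf hz₀ hpos
  refine ⟨f, ⟨hfd, hinj, ?_, ?_⟩, fun g hg => hderiv ▸ le_csSup hbdd (mem_image_of_mem _ hg)⟩
  · have h1 : f '' Ω ⊆ closedBall 0 1 := by
      rintro _ ⟨z, hz, rfl⟩
      rw [mem_closedBall_zero_iff]
      exact le_of_tendsto (hf.tendsto_at hz).norm
        (Eventually.of_forall fun n => (mem_ball_zero_iff.1 ((hF n).2.2.1 hz)).le)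
    have h2 := interior_maximal h1 (isOpen_image_of_injOn hΩ hfd hinj)
    rw [interior_closedBall _ one_ne_zero] at h2
    exact fun z hz => h2 (mem_image_of_mem f hz)
  · refine tendsto_nhds_unique (hf.tendsto_at hz₀) ?_
    simp [(hF _).2.2.2]

/-- Koebe's square-root trick: move the omitted value `b` to `0`, take a square root `g`, recentre.
With `s = ‖g z₀‖`, so that `‖b‖ = s²`, the derivative grows by the factor `(1 + s²) / (2s) > 1`. -/
theorem exists_larger_deriv_diskEmbeddings {Ω : Set ℂ} (hΩ : IsOpen Ω)
    (hsq : ∀ f : ℂ → ℂ, DifferentiableOn ℂ f Ω → (∀ z ∈ Ω, f z ≠ 0) →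
      ∃ g : ℂ → ℂ, DifferentiableOn ℂ g Ω ∧ ∀ z ∈ Ω, g z ^ 2 = f z)
    {z₀ : ℂ} (hz₀ : z₀ ∈ Ω) {f : ℂ → ℂ} (hf : f ∈ diskEmbeddings Ω z₀) {b : ℂ} (hb : ‖b‖ < 1)
    (hbf : b ∉ f '' Ω) : ∃ g ∈ diskEmbeddings Ω z₀, ‖deriv f z₀‖ < ‖deriv g z₀‖ := by
  obtain ⟨hd, hi, hm, h0⟩ := hf
  have hm' : ∀ z ∈ Ω, ‖f z‖ < 1 := fun z hz => mem_ball_zero_iff.1 (hm hz)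
  have hhd : DifferentiableOn ℂ (blaschke b ∘ f) Ω := (differentiableOn_blaschke hb).comp hd hm
  obtain ⟨g, hgd, hg⟩ := hsq _ hhd (by
    intro z hz h
    rw [Function.comp_apply, blaschke_eq_zero_iff hb (hm' z hz)] at h
    exact hbf ⟨z, hz, h⟩)
  have hgm : MapsTo g Ω (ball 0 1) := by
    intro z hz
    have h1 := norm_blaschke_lt_one hb (hm' z hz)
    have h2 : ‖g z‖ ^ 2 < 1 := by rw [← norm_pow, hg z hz]; exact h1
    rw [mem_ball_zero_iff]
    nlinarith [norm_nonneg (g z)]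
  have hgi : InjOn g Ω := by
    intro z hz w hw h
    refine hi hz hw (blaschke_injOn hb (hm hz) (hm hw) ?_)
    have h1 := hg z hz
    have h2 := hg w hw
    simp only [Function.comp_apply] at h1 h2
    rw [← h1, ← h2, h]
  refine ⟨_, blaschke_comp_mem_diskEmbeddings hz₀ hgd hgi hgm, ?_⟩
  have hs1 : ‖g z₀‖ < 1 := mem_ball_zero_iff.1 (hgm hz₀)
  have hgz := hg z₀ hz₀
  have hsb : g z₀ ^ 2 = -b := by rw [hgz]; simp [blaschke, h0]
  have hb0 : b ≠ 0 := fun h => hbf ⟨z₀, hz₀, by rw [h0, h]⟩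
  have hs0 : g z₀ ≠ 0 := by
    intro h; rw [h] at hsb; apply hb0; simpa using hsb.symm
  have hn := hΩ.mem_nhds hz₀
  have dg := (hgd.differentiableAt hn).hasDerivAt
  have df := (hd.differentiableAt hn).hasDerivAt
  have dG : HasDerivAt (blaschke (g z₀) ∘ g) _ z₀ := (hasDerivAt_blaschke hs1 hs1).comp z₀ dg
  have dh : HasDerivAt (blaschke b ∘ f) _ z₀ := (hasDerivAt_blaschke hb (hm' z₀ hz₀)).comp z₀ df
  have dh2 : HasDerivAt (blaschke b ∘ f) (2 * g z₀ * deriv g z₀) z₀ := by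
    refine ((dg.pow 2).congr_of_eventuallyEq ?_).congr_deriv (by simp)
    filter_upwards [hn] with z hz
    exact (hg z hz).symm
  have heq := dh.unique dh2
  rw [dG.deriv]
  have hbs : ‖b‖ = ‖g z₀‖ ^ 2 := by rw [← norm_pow, hsb, norm_neg]
  rw [h0, mul_zero, sub_zero, one_pow, div_one] at heq
  have e1 : (1 - ‖b‖ ^ 2) * ‖deriv f z₀‖ = 2 * ‖g z₀‖ * ‖deriv g z₀‖ := by
    have := congrArg norm heq
    rw [norm_mul, norm_mul, norm_mul, Complex.norm_ofNat] at this
    rw [← this]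
    congr 1
    have : (1 - (‖b‖ : ℂ) ^ 2) = ((1 - ‖b‖ ^ 2 : ℝ) : ℂ) := by push_cast; ring
    rw [this, Complex.norm_real, Real.norm_of_nonneg]
    nlinarith [norm_nonneg b]
  have e2 : ‖(1 - (‖g z₀‖ : ℂ) ^ 2) / (1 - (starRingEnd ℂ) (g z₀) * g z₀) ^ 2‖
      = 1 / (1 - ‖g z₀‖ ^ 2) := by
    have hh : (1 - ‖g z₀‖ ^ 2) ≠ 0 := by nlinarith [norm_nonneg (g z₀)]
    have h2 : (1 - (‖g z₀‖ : ℂ) ^ 2) = ((1 - ‖g z₀‖ ^ 2 : ℝ) : ℂ) := by push_cast; ring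
    rw [Complex.conj_mul', h2, ← Complex.ofReal_pow, ← Complex.ofReal_div, Complex.norm_real,
      Real.norm_of_nonneg]
    · field_simp
    · exact div_nonneg (by nlinarith [norm_nonneg (g z₀)]) (sq_nonneg _)
  rw [norm_mul, e2]
  set s := ‖g z₀‖
  have hspos : 0 < s := norm_pos_iff.2 hs0
  have hfpos : 0 < ‖deriv f z₀‖ := norm_pos_iff.2 (deriv_ne_zero_of_injOn hΩ hd hi hz₀)
  rw [hbs] at e1
  have hs2 : 0 < 1 - s ^ 2 := by nlinarith
  rw [one_div, ← div_eq_inv_mul, lt_div_iff₀ hs2]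
  have h3 : (1 - s) ^ 2 > 0 := by have : 0 < 1 - s := by linarith
                                  positivity
  have h4 : ‖deriv f z₀‖ * (1 - s ^ 2) * (2 * s) < ‖deriv f z₀‖ * (1 - s ^ 2) * (1 + s ^ 2) := by
    apply mul_lt_mul_of_pos_left _ (by positivity)
    nlinarith
  nlinarith

theorem riemann_mapping {Ω : Set ℂ} (hΩ : IsOpen Ω) (hc : IsPreconnected Ω)
    (hsq : ∀ f : ℂ → ℂ, DifferentiableOn ℂ f Ω → (∀ z ∈ Ω, f z ≠ 0) →
      ∃ g : ℂ → ℂ, DifferentiableOn ℂ g Ω ∧ ∀ z ∈ Ω, g z ^ 2 = f z)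
    {z₀ : ℂ} (hz₀ : z₀ ∈ Ω) {j : ℂ → ℂ} (hj : DifferentiableOn ℂ j Ω) (hi : InjOn j Ω)
    (hm : MapsTo j Ω (ball 0 1)) : ∃ f : ℂ → ℂ, IsConformalOnto f Ω (ball 0 1) ∧ f z₀ = 0 := by
  obtain ⟨f, hf, hmax⟩ := exists_max_deriv_diskEmbeddings hΩ hc hz₀
    ⟨_, blaschke_comp_mem_diskEmbeddings hz₀ hj hi hm⟩
  refine ⟨f, ⟨hf.1, hf.2.2.1, hf.2.1, ?_⟩, hf.2.2.2⟩
  intro b hb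
  by_contra hbf
  obtain ⟨g, hg, hlt⟩ := exists_larger_deriv_diskEmbeddings hΩ hsq hz₀ hf (mem_ball_zero_iff.1 hb) hbf
  exact absurd (hmax g hg) (not_le.2 hlt)

/-! ### The Cauchy–Pompeiu formula -/

/-- Each side of a centred square contributes a quarter of `∮ dζ / ζ = 2πi`. -/
theorem integral_inv_add_mul_I {R : ℝ} (hR : 0 < R) :
    ∫ y : ℝ in -R..R, ((R : ℂ) + y * I)⁻¹ = Real.pi / 2 := by
  have hslit : ∀ y : ℝ, (R : ℂ) + y * I ∈ slitPlane := fun y => Or.inl (by simpa using hR)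
  have hderiv : ∀ y ∈ uIcc (-R) R,
      HasDerivAt (fun y : ℝ => -I * log ((R : ℂ) + y * I)) (((R : ℂ) + y * I)⁻¹) y := by
    intro y _
    have h1 : HasDerivAt (fun y : ℝ => (R : ℂ) + y * I) I y := by
      simpa using ((Complex.ofRealCLM.hasDerivAt (x := y)).mul_const I).const_add (R : ℂ)
    have h2 := (h1.clog_real (hslit y)).const_mul (-I)
    refine h2.congr_deriv ?_
    rw [mul_div_assoc', neg_mul, I_mul_I, neg_neg, one_div]
  have hcont : Continuous fun y : ℝ => ((R : ℂ) + y * I)⁻¹ :=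
    Continuous.inv₀ (by fun_prop) fun y => slitPlane_ne_zero (hslit y)
  rw [intervalIntegral.integral_eq_sub_of_hasDerivAt hderiv (hcont.intervalIntegrable _ _)]
  have harg : arg ((R : ℂ) + R * I) = Real.pi / 4 := by
    have := Complex.arg_mul_cos_add_sin_mul_I (r := R * √2) (by positivity) (θ := Real.pi / 4)
      ⟨by linarith [Real.pi_pos], by linarith [Real.pi_pos]⟩
    rw [← this, ← Complex.ofReal_cos, ← Complex.ofReal_sin, Real.cos_pi_div_four,
      Real.sin_pi_div_four]
    congr 1
    have h2 : ((√2 : ℝ) : ℂ) * (√2 : ℝ) = 2 := by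
      rw [← Complex.ofReal_mul, Real.mul_self_sqrt (by norm_num)]; norm_num
    push_cast
    linear_combination (-(R : ℂ) / 2 * (1 + I)) * h2
  have hconj : (R : ℂ) + ((-R : ℝ) : ℂ) * I = (starRingEnd ℂ) ((R : ℂ) + R * I) := by
    simp
  rw [hconj, Complex.log_conj _ (by rw [harg]; linarith [Real.pi_pos])]
  have : log ((R : ℂ) + R * I) - (starRingEnd ℂ) (log ((R : ℂ) + R * I))
      = (2 * (Real.pi / 4 : ℝ) : ℝ) * I := by
    rw [Complex.sub_conj, Complex.log_im, harg]
  rw [← mul_sub, this]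
  push_cast
  linear_combination (-(Real.pi : ℂ) / 2) * I_mul_I

/-- `2 i ∂h/∂z̄`. -/
noncomputable def dbar (h : ℂ → ℂ) (ζ : ℂ) : ℂ := I * fderiv ℝ h ζ 1 - fderiv ℝ h ζ I

theorem dbar_eq_zero {h : ℂ → ℂ} {ζ : ℂ} (hd : DifferentiableAt ℂ h ζ) : dbar h ζ = 0 := by
  rw [dbar, hd.fderiv_restrictScalars ℝ]
  have : fderiv ℂ h ζ I = I * fderiv ℂ h ζ 1 := by
    rw [← smul_eq_mul, ← map_smul, smul_eq_mul, mul_one]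
  simp [this]

theorem continuous_dbar {h : ℂ → ℂ} (hh : ContDiff ℝ 1 h) : Continuous (dbar h) := by
  have h1 := hh.continuous_fderiv one_ne_zero
  unfold dbar
  fun_prop

theorem continuous_dbar_div {h : ℂ → ℂ} (hh : ContDiff ℝ 1 h) {z₀ : ℂ}
    (h0 : ∀ᶠ z in 𝓝 z₀, DifferentiableAt ℂ h z) : Continuous fun ζ => dbar h ζ / (ζ - z₀) := by
  rw [continuous_iff_continuousAt]
  intro ζ
  rcases eq_or_ne ζ z₀ with rfl | hne
  · have : (fun z => dbar h z / (z - ζ)) =ᶠ[𝓝 ζ] fun _ => 0 := by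
      filter_upwards [h0] with z hz
      rw [dbar_eq_zero hz, zero_div]
    exact continuousAt_const.congr this.symm
  · exact (continuous_dbar hh).continuousAt.div (by fun_prop) (sub_ne_zero.2 hne)

theorem integral_eq_intervalIntegral_of_support {G : ℂ → ℂ} (hG : Continuous G) {R : ℝ}
    (hsupp : ∀ ζ : ℂ, R ≤ ‖ζ‖ → G ζ = 0) :
    ∫ ζ, G ζ = ∫ x : ℝ in -R..R, ∫ y : ℝ in -R..R, G (x + y * I) := by
  have hcs : HasCompactSupport G := HasCompactSupport.of_support_subset_isCompact
    (isCompact_closedBall (0 : ℂ) R) (by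
      intro ζ hζ
      rw [mem_closedBall_zero_iff]
      by_contra hcon
      exact hζ (hsupp ζ (not_le.1 hcon).le))
  have hint : Integrable G := hG.integrable_of_hasCompactSupport hcs
  have hmp := Complex.volume_preserving_equiv_real_prod.symm
  have h1 : ∫ ζ, G ζ = ∫ p : ℝ × ℝ, G (measurableEquivRealProd.symm p) :=
    (hmp.integral_comp (MeasurableEquiv.measurableEmbedding _) G).symm
  have hint2 : Integrable (fun p : ℝ × ℝ => G (measurableEquivRealProd.symm p)) :=
    (hmp.integrable_comp_emb (MeasurableEquiv.measurableEmbedding _)).2 hint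
  have hbound : ∀ x y : ℝ, (x, y) ∉ Ioc (-R) R ×ˢ Ioc (-R) R → G (x + y * I) = 0 := by
    intro x y hxy
    apply hsupp
    by_contra hlt
    push Not at hlt
    have hx := (abs_re_le_norm ((x : ℂ) + y * I)).trans_lt hlt
    have hy := (abs_im_le_norm ((x : ℂ) + y * I)).trans_lt hlt
    simp only [add_re, ofReal_re, mul_re, I_re, mul_zero, ofReal_im, I_im, mul_one, sub_self,
      add_zero, add_im, mul_im, zero_add] at hx hy
    rw [abs_lt] at hx hy
    exact hxy ⟨⟨hx.1, hx.2.le⟩, ⟨hy.1, hy.2.le⟩⟩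
  rw [h1, show (volume : Measure (ℝ × ℝ)) = (volume : Measure ℝ).prod volume from rfl,
    integral_prod _ hint2]
  simp only [Complex.measurableEquivRealProd_symm_apply]
  have hmk : ∀ x y : ℝ, (⟨x, y⟩ : ℂ) = x + y * I := fun x y => mk_eq_add_mul_I x y
  simp only [hmk]
  rw [intervalIntegral.integral_eq_integral_of_support_subset]
  · congr 1
    ext x
    rw [intervalIntegral.integral_eq_integral_of_support_subset]
    intro y hy
    by_contra hcon
    exact hy (hbound x y fun h => hcon h.2)
  · intro x hx
    by_contra hcon
    refine hx ?_
    have : ∀ y : ℝ, G (x + y * I) = 0 := fun y => hbound x y fun h => hcon h.1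
    simp [this]

/-- Green's formula on a square around the support, applied to `(h ζ - h 0) / ζ`. Subtracting `h 0`
makes the quotient continuous at `0`, does not change its `∂̄` elsewhere, and leaves `-h 0 / ζ` on
the boundary. -/
theorem pompeiu_zero {h : ℂ → ℂ} (hh : ContDiff ℝ 1 h) (hc : HasCompactSupport h)
    (h0 : ∀ᶠ z in 𝓝 0, DifferentiableAt ℂ h z) :
    ∫ ζ, dbar h ζ / ζ = -(2 * Real.pi * I * h 0) := by
  obtain ⟨R, hR, hsupp⟩ : ∃ R : ℝ, 0 < R ∧ ∀ ζ : ℂ, R ≤ ‖ζ‖ → ζ ∉ tsupport h := by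
    obtain ⟨R, hR⟩ := hc.isCompact.isBounded.subset_closedBall 0
    refine ⟨max R 0 + 1, by positivity, fun ζ hζ hm => ?_⟩
    have := mem_closedBall_zero_iff.1 (hR hm)
    linarith [le_max_left R 0]
  have hsupp0 : ∀ ζ : ℂ, R ≤ ‖ζ‖ → h ζ = 0 := fun ζ hζ => image_eq_zero_of_notMem_tsupport (hsupp ζ hζ)
  have hsuppd : ∀ ζ : ℂ, R ≤ ‖ζ‖ → dbar h ζ = 0 := by
    intro ζ hζ
    have : h =ᶠ[𝓝 ζ] fun _ => 0 := notMem_tsupport_iff_eventuallyEq.1 (hsupp ζ hζ)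
    rw [dbar, this.fderiv_eq]
    simp
  set f : ℂ → ℂ := dslope h 0 with hf
  set f' : ℂ → ℂ →L[ℝ] ℂ := fun ζ => ζ⁻¹ • fderiv ℝ h ζ
    + (h ζ - h 0) • ((-(ζ ^ 2)⁻¹) • (ContinuousLinearMap.id ℝ ℂ)) with hf'
  have hval : ∀ ζ : ℂ, ζ ≠ 0 → f ζ = (h ζ - h 0) * ζ⁻¹ := by
    intro ζ hζ
    rw [hf, dslope_of_ne _ hζ, slope_def_field, sub_zero, div_eq_mul_inv]
  have hderiv : ∀ ζ : ℂ, ζ ≠ 0 → HasFDerivAt f (f' ζ) ζ := by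
    intro ζ hζ
    have h1 : HasFDerivAt (fun z => h z - h 0) (fderiv ℝ h ζ) ζ :=
      ((hh.differentiable one_ne_zero) ζ).hasFDerivAt.sub_const _
    have h2 : HasFDerivAt (fun z : ℂ => z⁻¹) ((-(ζ ^ 2)⁻¹) • (ContinuousLinearMap.id ℝ ℂ)) ζ := by
      have := (hasDerivAt_inv hζ).hasFDerivAt.restrictScalars ℝ
      refine this.congr_fderiv ?_
      ext v; simp [mul_comm]
    refine ((h1.mul h2).congr_of_eventuallyEq ?_).congr_fderiv ?_
    · filter_upwards [isOpen_ne.mem_nhds hζ] with z hz using hval z hz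
    · rw [hf', add_comm]
  have hd0 : DifferentiableAt ℂ h 0 := h0.self_of_nhds
  have hfc : Continuous f := by
    rw [continuous_iff_continuousAt]
    intro ζ
    rcases eq_or_ne ζ 0 with rfl | hne
    · exact continuousAt_dslope_same.2 hd0
    · exact (hderiv ζ hne).continuousAt
  have hG : Continuous fun ζ => dbar h ζ / ζ := by
    simpa using continuous_dbar_div hh h0
  have hD : ∀ ζ : ℂ, ζ ≠ 0 → I • f' ζ 1 - f' ζ I = dbar h ζ / ζ := by
    intro ζ hζ
    simp only [hf', dbar, add_apply, smul_apply,
      ContinuousLinearMap.coe_id', id, smul_eq_mul]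
    ring
  -- With `0⁻¹ = 0` both sides vanish at the exceptional point.
  have hD0 : I • f' 0 1 - f' 0 I = dbar h 0 / 0 := by simp [hf']
  have hDall : (fun ζ => I • f' ζ 1 - f' ζ I) = fun ζ => dbar h ζ / ζ := by
    ext ζ
    rcases eq_or_ne ζ 0 with rfl | hne
    · exact hD0
    · exact hD ζ hne
  have key := integral_boundary_rect_of_hasFDerivAt_real_off_countable f f'
    (⟨-R, -R⟩ : ℂ) (⟨R, R⟩ : ℂ) {0} (countable_singleton 0) hfc.continuousOn
    (fun x hx => hderiv x (by simpa using hx.2))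
    (by
      rw [hDall]
      refine hG.continuousOn.integrableOn_compact ?_
      exact isCompact_uIcc.reProdIm isCompact_uIcc)
  have hrhs : (∫ x : ℝ in -R..R, ∫ y : ℝ in -R..R,
      I • f' (x + y * I) 1 - f' (x + y * I) I) = ∫ ζ, dbar h ζ / ζ := by
    rw [integral_eq_intervalIntegral_of_support hG (R := R)
      fun ζ hζ => by rw [hsuppd ζ hζ, zero_div]]
    congr 1; ext x; congr 1; ext y
    exact congrFun hDall (x + y * I)
  simp only at key
  rw [hrhs] at key
  rw [← key]
  have hbd : ∀ ζ : ℂ, R ≤ ‖ζ‖ → f ζ = -h 0 * ζ⁻¹ := by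
    intro ζ hζ
    rw [hval ζ (norm_pos_iff.1 (hR.trans_le hζ)), hsupp0 ζ hζ, zero_sub]
  have hA := integral_inv_add_mul_I hR
  have hle1 : ∀ x : ℝ, R ≤ ‖(x : ℂ) + (-R : ℝ) * I‖ := fun x =>
    le_trans (by simp [abs_of_pos hR]) (abs_im_le_norm _)
  have hle2 : ∀ x : ℝ, R ≤ ‖(x : ℂ) + (R : ℝ) * I‖ := fun x =>
    le_trans (by simp [abs_of_pos hR]) (abs_im_le_norm _)
  have hle3 : ∀ x : ℝ, R ≤ ‖((R : ℝ) : ℂ) + x * I‖ := fun x =>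
    le_trans (by simp [abs_of_pos hR]) (abs_re_le_norm _)
  have hle4 : ∀ x : ℝ, R ≤ ‖((-R : ℝ) : ℂ) + x * I‖ := fun x =>
    le_trans (by simp [abs_of_pos hR]) (abs_re_le_norm _)
  have e1 : ∫ x : ℝ in -R..R, f (x + (-R : ℝ) * I) = -h 0 * I * (Real.pi / 2) := by
    rw [← hA, ← intervalIntegral.integral_const_mul]
    congr 1; ext x
    rw [hbd _ (hle1 x), mul_assoc]
    congr 1
    rw [← div_eq_mul_inv, eq_div_iff (norm_pos_iff.1 (hR.trans_le (hle3 x))),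
      inv_mul_eq_div, div_eq_iff (norm_pos_iff.1 (hR.trans_le (hle1 x)))]
    push_cast
    linear_combination (R : ℂ) * I_mul_I
  have e2 : ∫ x : ℝ in -R..R, f (x + (R : ℝ) * I) = h 0 * I * (Real.pi / 2) := by
    have h2 := intervalIntegral.integral_comp_neg (a := -R) (b := R)
      (fun x : ℝ => ((R : ℂ) + x * I)⁻¹)
    rw [neg_neg] at h2
    rw [← hA, ← h2, ← intervalIntegral.integral_const_mul]
    congr 1; ext x
    rw [hbd _ (hle2 x), neg_mul, ← mul_neg, mul_assoc]
    congr 1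
    rw [← div_eq_mul_inv, eq_div_iff (norm_pos_iff.1 (hR.trans_le (hle3 (-x)))),
      neg_mul, inv_mul_eq_div, ← neg_div, div_eq_iff (norm_pos_iff.1 (hR.trans_le (hle2 x)))]
    push_cast
    linear_combination (-(R : ℂ)) * I_mul_I
  have e3 : ∫ y : ℝ in -R..R, f ((R : ℝ) + y * I) = -h 0 * (Real.pi / 2) := by
    rw [← hA, ← intervalIntegral.integral_const_mul]
    congr 1; ext x
    rw [hbd _ (hle3 x)]
  have e4 : ∫ y : ℝ in -R..R, f ((-R : ℝ) + y * I) = h 0 * (Real.pi / 2) := by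
    have h2 := intervalIntegral.integral_comp_neg (a := -R) (b := R)
      (fun x : ℝ => ((R : ℂ) + x * I)⁻¹)
    rw [neg_neg] at h2
    rw [← hA, ← h2, ← intervalIntegral.integral_const_mul]
    congr 1; ext x
    rw [hbd _ (hle4 x), neg_mul, ← mul_neg, ← inv_neg]
    congr 2
    push_cast
    ring
  rw [e1, e2, e3, e4]
  simp only [smul_eq_mul]
  ring

theorem pompeiu {h : ℂ → ℂ} (hh : ContDiff ℝ 1 h) (hc : HasCompactSupport h) {z₀ : ℂ}
    (h0 : ∀ᶠ z in 𝓝 z₀, DifferentiableAt ℂ h z) :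
    h z₀ = ∫ ζ, ((2 * Real.pi * I)⁻¹ * dbar h ζ) / (z₀ - ζ) := by
  have h1 := pompeiu_zero (h := fun z => h (z + z₀)) (hh.comp (by fun_prop))
    (hc.comp_homeomorph (Homeomorph.addRight z₀)) (by
      have : Tendsto (fun z : ℂ => z + z₀) (𝓝 0) (𝓝 z₀) := by
        exact (by fun_prop : Continuous fun z : ℂ => z + z₀).tendsto' 0 z₀ (zero_add _)
      filter_upwards [this.eventually h0] with z hz
      exact differentiableAt_comp_add_const.2 hz)
  have h2 : ∀ ζ, dbar (fun z => h (z + z₀)) ζ = dbar h (ζ + z₀) := by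
    intro ζ; simp only [dbar]; rw [fderiv_comp_add_right]
  simp only [h2, zero_add] at h1
  have h3 := integral_add_right_eq_self (μ := volume) (fun ζ => dbar h ζ / (ζ - z₀)) z₀
  simp only [add_sub_cancel_right] at h3
  rw [h3] at h1
  have h4 : ∀ ζ, ((2 * Real.pi * I)⁻¹ * dbar h ζ) / (z₀ - ζ)
      = -(2 * Real.pi * I)⁻¹ * (dbar h ζ / (ζ - z₀)) := by
    intro ζ
    rw [← neg_sub ζ z₀, div_neg]; ring
  simp only [h4]
  rw [integral_const_mul, h1]
  have : (2 * Real.pi * I : ℂ) ≠ 0 := by simp [Real.pi_ne_zero]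
  field_simp

/-! ### Primitives on domains whose complement chains to infinity -/

/-- A step of length less than `δ` inside `X`. -/
def ChainStep (X : Set ℂ) (δ : ℝ) (x y : ℂ) : Prop := x ∈ X ∧ y ∈ X ∧ dist x y < δ

/-- Every point of `X` is joined to arbitrarily distant points of `X` by chains of arbitrarily small
steps. -/
def ChainsToInfinity (X : Set ℂ) : Prop :=
  ∀ δ > 0, ∀ ζ ∈ X, ∀ M : ℝ, ∃ p, Relation.ReflTransGen (ChainStep X δ) ζ p ∧ M < ‖p‖

theorem chain_of_isPreconnected {X : Set ℂ} (hX : IsPreconnected X) {x y : ℂ} (hx : x ∈ X)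
    (hy : y ∈ X) {δ : ℝ} (hδ : 0 < δ) : Relation.ReflTransGen (ChainStep X δ) x y := by
  have hsymm : ∀ a b, ChainStep X δ a b → ChainStep X δ b a :=
    fun a b h => ⟨h.2.1, h.1, by rw [dist_comm]; exact h.2.2⟩
  refine hX.induction₂ (Relation.ReflTransGen (ChainStep X δ)) ?_ (fun _ _ _ _ _ _ => .trans)
    (fun a b _ _ h => ?_) hx hy
  · intro a ha
    filter_upwards [self_mem_nhdsWithin, nhdsWithin_le_nhds (ball_mem_nhds a hδ)] with b hb hab
    exact .single ⟨ha, hb, by rw [dist_comm]; exact hab⟩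
  · have : Std.Symm (ChainStep X δ) := ⟨hsymm⟩
    exact Std.Symm.symm _ _ h

/-- This is `log ((z - p) / (z - q))`; the principal branch is available because the quotient is
within distance `1` of `1`. -/
theorem hasDerivAt_log_ratio {z p q : ℂ} (hpq : dist p q < ‖z - q‖) :
    HasDerivAt (fun z => log (1 - (p - q) / (z - q))) (1 / (z - p) - 1 / (z - q)) z := by
  have hzq : z - q ≠ 0 := norm_pos_iff.1 (dist_nonneg.trans_lt hpq)
  have hlt : ‖(p - q) / (z - q)‖ < 1 := by
    rw [norm_div, div_lt_one (norm_pos_iff.2 hzq), ← dist_eq_norm]; exact hpq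
  have hslit : 1 - (p - q) / (z - q) ∈ slitPlane := by
    rw [sub_eq_add_neg]
    exact mem_slitPlane_of_norm_lt_one (by rwa [norm_neg])
  have h1 : HasDerivAt (fun z => 1 - (p - q) / (z - q)) ((p - q) / (z - q) ^ 2) z := by
    have := (((hasDerivAt_id z).sub_const q).fun_inv hzq).const_mul (p - q) |>.const_sub 1
    simpa [div_eq_mul_inv] using this
  have hzp : z - p ≠ 0 := by
    intro h
    rw [sub_eq_zero] at h
    subst h
    rw [dist_eq_norm] at hpq
    exact lt_irrefl _ hpq
  refine (h1.clog hslit).congr_deriv ?_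
  have : 1 - (p - q) / (z - q) = (z - p) / (z - q) := by field_simp; ring
  rw [this]
  field_simp
  ring

/-- The pole moves one step at a time. A step shorter than `δ` is shorter than the distance from `z`
to the pole, so it contributes a principal logarithm, and the kernels telescope. -/
theorem exists_primitive_of_chain {V X : Set ℂ} {δ : ℝ} (hV : ∀ z ∈ V, ∀ x ∈ X, δ ≤ ‖z - x‖)
    {p q : ℂ} (h : Relation.ReflTransGen (ChainStep X δ) p q) :
    ∃ L : ℂ → ℂ, ∀ z ∈ V, HasDerivAt L (1 / (z - p) - 1 / (z - q)) z := by
  induction h with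
  | refl => exact ⟨fun _ => 0, fun z _ => by simpa using hasDerivAt_const z (0 : ℂ)⟩
  | tail _ h ih =>
    obtain ⟨L, hL⟩ := ih
    refine ⟨_, fun z hz => ((hL z hz).add
      (hasDerivAt_log_ratio (h.2.2.trans_le (hV z hz _ h.2.1)))).congr_deriv (by ring)⟩

theorem hasDerivAt_log_one_sub_div {z p : ℂ} (h : ‖z‖ < ‖p‖) :
    HasDerivAt (fun z => log (1 - z / p)) (1 / (z - p)) z := by
  have hp : p ≠ 0 := norm_pos_iff.1 ((norm_nonneg z).trans_lt h)
  have hlt : ‖z / p‖ < 1 := by rwa [norm_div, div_lt_one (norm_pos_iff.2 hp)]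
  have hslit : 1 - z / p ∈ slitPlane := by
    rw [sub_eq_add_neg]
    exact mem_slitPlane_of_norm_lt_one (by rwa [norm_neg])
  have h1 : HasDerivAt (fun z => 1 - z / p) (-(1 / p)) z :=
    ((hasDerivAt_id z).div_const p).const_sub 1
  refine (h1.clog hslit).congr_deriv ?_
  have hzp : z - p ≠ 0 := by
    intro h0; rw [sub_eq_zero] at h0; subst h0; exact lt_irrefl _ h
  have hpz : p - z ≠ 0 := by rwa [← neg_sub, neg_ne_zero]
  have : 1 - z / p = (p - z) / p := by field_simp
  rw [this]
  field_simp
  ring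

/-- The points of norm less than `t` at distance more than `1 / t` from the complement of `Ω`. -/
def innerPart (Ω : Set ℂ) (t : ℝ) : Set ℂ := {z | ‖z‖ < t ∧ t⁻¹ < infDist z Ωᶜ}

theorem isOpen_innerPart (Ω : Set ℂ) (t : ℝ) : IsOpen (innerPart Ω t) :=
  (isOpen_lt continuous_norm continuous_const).inter
    (isOpen_lt continuous_const (continuous_infDist_pt _))

theorem lt_norm_sub_of_mem_innerPart {Ω : Set ℂ} {t : ℝ} {z x : ℂ} (hz : z ∈ innerPart Ω t)
    (hx : x ∈ Ωᶜ) : t⁻¹ < ‖z - x‖ := by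
  rw [← dist_eq_norm]
  exact hz.2.trans_le (infDist_le_dist_of_mem hx)

/-- The pole is pushed to infinity: from `ζ` to a nearest point of `Ωᶜ` (unless `‖ζ‖ ≥ t` already),
then along a chain to some `q` with `‖q‖ > s`, where `log (1 - z / q)` serves. The gap between `s`
and `t` makes the first move short enough. -/
theorem exists_primitive_inv_sub {Ω : Set ℂ} (hΩ : IsOpen Ω) (hne : Ωᶜ.Nonempty)
    (hch : ChainsToInfinity Ωᶜ) {s t : ℝ} (hs : 0 < s) (hst : s < t) {ζ : ℂ}
    (hζ : ζ ∉ innerPart Ω t) :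
    ∃ L : ℂ → ℂ, ∀ z ∈ innerPart Ω s, HasDerivAt L (1 / (z - ζ)) z := by
  by_cases h : ‖ζ‖ < t
  · have h2 : infDist ζ Ωᶜ ≤ t⁻¹ := by
      by_contra hcon
      exact hζ ⟨h, not_le.1 hcon⟩
    obtain ⟨p, hp, hdp⟩ := hΩ.isClosed_compl.exists_infDist_eq_dist hne ζ
    obtain ⟨q, hq, hqn⟩ := hch s⁻¹ (inv_pos.2 hs) p hp s
    have hlt : t⁻¹ < s⁻¹ := inv_strictAnti₀ hs hst
    obtain ⟨L, hL⟩ := exists_primitive_of_chain (V := innerPart Ω s)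
      (fun z hz x hx => (lt_norm_sub_of_mem_innerPart hz hx).le) hq
    refine ⟨_, fun z hz => (((hL z hz).add
      (hasDerivAt_log_one_sub_div (hz.1.trans hqn))).add (hasDerivAt_log_ratio (p := ζ) (q := p)
        ?_)).congr_deriv (by ring)⟩
    rw [← hdp]
    exact (h2.trans_lt hlt).trans (lt_norm_sub_of_mem_innerPart hz hp)
  · refine ⟨_, fun z hz => hasDerivAt_log_one_sub_div ?_⟩
    exact hz.1.trans (hst.trans_le (not_lt.1 h))

theorem exists_pos_le_norm_sub {Ω : Set ℂ} {s t : ℝ} (hs : 0 < s) (hst : s < t) :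
    ∃ δ > 0, ∀ z ∈ innerPart Ω s, ∀ ζ, ζ ∉ innerPart Ω t → δ ≤ ‖z - ζ‖ := by
  have hlt : t⁻¹ < s⁻¹ := inv_strictAnti₀ hs hst
  refine ⟨min (t - s) (s⁻¹ - t⁻¹), lt_min (sub_pos.2 hst) (sub_pos.2 hlt), ?_⟩
  intro z hz ζ hζ
  by_cases h : ‖ζ‖ < t
  · have h2 : infDist ζ Ωᶜ ≤ t⁻¹ := by
      by_contra hcon
      exact hζ ⟨h, not_le.1 hcon⟩
    have h3 : infDist z Ωᶜ ≤ infDist ζ Ωᶜ + dist z ζ := infDist_le_infDist_add_dist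
    rw [dist_eq_norm] at h3
    exact (min_le_right _ _).trans (by linarith [hz.2])
  · have h3 := norm_sub_norm_le ζ z
    rw [norm_sub_rev] at h3
    exact (min_le_left _ _).trans (by linarith [hz.1])

theorem eq_of_hasDerivAt_eq {U : Set ℂ} (hU : IsOpen U) (hUc : IsPreconnected U) {F G f : ℂ → ℂ}
    (hF : ∀ z ∈ U, HasDerivAt F (f z) z) (hG : ∀ z ∈ U, HasDerivAt G (f z) z) {z₀ : ℂ}
    (hz₀ : z₀ ∈ U) (h0 : F z₀ = G z₀) {z : ℂ} (hz : z ∈ U) : F z = G z := by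
  have h1 : ∀ w ∈ U, HasDerivAt (fun w => F w - G w) 0 w := fun w hw => by
    simpa using (hF w hw).fun_sub (hG w hw)
  have := hU.is_const_of_deriv_eq_zero hUc
    (fun w hw => (h1 w hw).differentiableAt.differentiableWithinAt) (fun w hw => (h1 w hw).deriv)
    hz hz₀
  rw [h0, sub_self] at this
  exact sub_eq_zero.1 this

/-- A superposition of Cauchy kernels has a primitive as soon as each of them does. -/
theorem exists_primitive_integral {U S : Set ℂ} (hU : IsOpen U) (hUc : IsPreconnected U) {z₀ : ℂ}
    (hz₀ : z₀ ∈ U) (hS : IsCompact S) {δ : ℝ} (hδ : 0 < δ)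
    (hsep : ∀ z ∈ U, ∀ ζ ∈ S, δ ≤ ‖z - ζ‖)
    (hL : ∀ ζ ∈ S, ∃ L : ℂ → ℂ, ∀ z ∈ U, HasDerivAt L (1 / (z - ζ)) z) {ω : ℂ → ℂ}
    (hω : Continuous ω) :
    ∃ F : ℂ → ℂ, ∀ z ∈ U, HasDerivAt F (∫ ζ in S, ω ζ / (z - ζ)) z := by
  have hL' : ∀ ζ, ∃ L : ℂ → ℂ, ζ ∈ S → L z₀ = 0 ∧ ∀ z ∈ U, HasDerivAt L (1 / (z - ζ)) z := by
    intro ζ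
    by_cases hζ : ζ ∈ S
    · obtain ⟨L, h⟩ := hL ζ hζ
      exact ⟨fun z => L z - L z₀, fun _ => ⟨sub_self _, fun z hz => (h z hz).sub_const _⟩⟩
    · exact ⟨0, fun h => absurd h hζ⟩
  choose L hL0 using hL'
  -- Once normalised at `z₀`, primitives for nearby poles differ by principal logarithms. This gives
  -- continuity in `ζ`, and with it measurability and integrability.
  have hcont : ∀ z ∈ U, ContinuousOn (fun ζ => L ζ z) S := by
    intro z hz ζ₀ hζ₀
    have hev : ∀ᶠ ζ in 𝓝[S] ζ₀, L ζ z = L ζ₀ z + (log (1 - (ζ - ζ₀) / (z - ζ₀))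
        - log (1 - (ζ - ζ₀) / (z₀ - ζ₀))) := by
      filter_upwards [self_mem_nhdsWithin, nhdsWithin_le_nhds (ball_mem_nhds ζ₀ hδ)] with ζ hζ hd
      refine eq_of_hasDerivAt_eq hU hUc (hL0 ζ hζ).2 (f := fun w => 1 / (w - ζ))
        (G := fun w => L ζ₀ w + (log (1 - (ζ - ζ₀) / (w - ζ₀)) - log (1 - (ζ - ζ₀) / (z₀ - ζ₀))))
        (fun w hw => ?_) hz₀ ?_ hz
      · refine (((hL0 ζ₀ hζ₀).2 w hw).add
          ((hasDerivAt_log_ratio ?_).sub_const _)).congr_deriv (by ring)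
        exact (mem_ball.1 hd).trans_le (hsep w hw ζ₀ hζ₀)
      · simp [(hL0 ζ hζ).1, (hL0 ζ₀ hζ₀).1]
    have hc : ContinuousAt (fun ζ => L ζ₀ z + (log (1 - (ζ - ζ₀) / (z - ζ₀))
        - log (1 - (ζ - ζ₀) / (z₀ - ζ₀)))) ζ₀ := by
      refine continuousAt_const.add (ContinuousAt.sub ?_ ?_) <;>
        exact ContinuousAt.clog (by fun_prop) (by simp)
    refine (hc.continuousWithinAt.congr_of_eventuallyEq hev ?_)
    simp
  refine ⟨fun z => ∫ ζ in S, ω ζ * L ζ z, fun z hz => ?_⟩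
  obtain ⟨M, hM⟩ := hS.exists_bound_of_continuousOn hω.continuousOn
  have hker : ∀ w ∈ U, ContinuousOn (fun ζ => ω ζ / (w - ζ)) S := fun w hw =>
    hω.continuousOn.div (by fun_prop) fun ζ hζ =>
      norm_pos_iff.1 (hδ.trans_le (hsep w hw ζ hζ))
  refine (hasDerivAt_integral_of_dominated_loc_of_deriv_le (μ := volume.restrict S)
    (bound := fun _ => M / δ) (F := fun z ζ => ω ζ * L ζ z) (F' := fun z ζ => ω ζ / (z - ζ))
    (hU.mem_nhds hz) ?_ ?_ ?_ ?_ ?_ ?_).2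
  · filter_upwards [hU.mem_nhds hz] with w hw
    exact (hω.continuousOn.mul (hcont w hw)).aestronglyMeasurable hS.measurableSet
  · exact (hω.continuousOn.mul (hcont z hz)).integrableOn_compact hS
  · exact (hker z hz).aestronglyMeasurable hS.measurableSet
  · refine ae_restrict_of_forall_mem hS.measurableSet fun ζ hζ w hw => ?_
    rw [norm_div]
    exact div_le_div₀ ((norm_nonneg _).trans (hM ζ hζ)) (hM ζ hζ) hδ (hsep w hw ζ hζ)
  · exact integrableOn_const hS.measure_lt_top.ne
  · refine ae_restrict_of_forall_mem hS.measurableSet fun ζ hζ w hw => ?_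
    simpa [div_eq_mul_inv] using ((hL0 ζ hζ).2 w hw).const_mul (ω ζ)

theorem exists_cutoff {K O : Set ℂ} (hK : IsClosed K) (hO : IsOpen O) (hKO : K ⊆ O) :
    ∃ χ : ℂ → ℝ, ContDiff ℝ 1 χ ∧ (∀ᶠ x in 𝓝ˢ K, χ x = 1) ∧ tsupport χ ⊆ O := by
  obtain ⟨f, h0, h1, -⟩ := exists_contMDiffMap_zero_one_nhds_of_isClosed
    (modelWithCornersSelf ℝ ℂ) (n := 1) hO.isClosed_compl hK
    (disjoint_compl_left_iff_subset.2 hKO)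
  refine ⟨f, f.contMDiff.contDiff, h1, ?_⟩
  intro x hx
  by_contra hxO
  have : ∀ᶠ y in 𝓝 x, f y = 0 := by
    have := Filter.Eventually.filter_mono (nhds_le_nhdsSet (s := Oᶜ) hxO) h0
    exact this
  exact notMem_tsupport_iff_eventuallyEq.2 this hx

/-- Pompeiu's formula is applied to `χ f`, where the cutoff `χ` is `1` near the slightly larger part
at level `t = s + 1`. Its `∂̄` vanishes off a compact set `S` at positive distance from the part at
level `s`, so there `f` is a superposition of kernels with poles in `S`. -/
theorem exists_primitive_on_inner_component {Ω : Set ℂ} (hΩ : IsOpen Ω) (hne : Ωᶜ.Nonempty)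
    (hch : ChainsToInfinity Ωᶜ) {f : ℂ → ℂ} (hf : DifferentiableOn ℂ f Ω) {s : ℝ} (hs : 0 < s)
    {z₀ : ℂ} (hz₀ : z₀ ∈ innerPart Ω s) :
    ∃ F : ℂ → ℂ, ∀ z ∈ connectedComponentIn (innerPart Ω s) z₀, HasDerivAt F (f z) z := by
  set t := s + 1 with ht
  set K : Set ℂ := {z | ‖z‖ ≤ t ∧ t⁻¹ ≤ infDist z Ωᶜ} with hKdef
  set O : Set ℂ := innerPart Ω (t + 1) with hO
  have ht0 : 0 < t := by positivity
  have hOΩ : ∀ u : ℝ, 0 < u → innerPart Ω u ⊆ Ω := by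
    intro u hu z hz
    by_contra hcon
    have := hz.2
    rw [infDist_zero_of_mem (show z ∈ Ωᶜ from hcon)] at this
    exact absurd this (not_lt.2 (inv_pos.2 hu).le)
  have hK : IsClosed K := (isClosed_le continuous_norm continuous_const).inter
    (isClosed_le continuous_const (continuous_infDist_pt _))
  have hKO : K ⊆ O := fun z hz =>
    ⟨hz.1.trans_lt (by linarith), (inv_strictAnti₀ ht0 (by linarith)).trans_le hz.2⟩
  have htK : innerPart Ω t ⊆ K := fun z hz => ⟨hz.1.le, hz.2.le⟩
  obtain ⟨χ, hχ, hχ1, hχO⟩ := exists_cutoff hK (isOpen_innerPart Ω _) hKO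
  have hcs : HasCompactSupport χ := by
    refine HasCompactSupport.of_support_subset_isCompact (isCompact_closedBall (0 : ℂ) (t + 1)) ?_
    intro z hz
    exact mem_closedBall_zero_iff.2 (hχO (subset_tsupport χ hz)).1.le
  set h : ℂ → ℂ := fun z => χ z * f z with hh
  have hsupp : tsupport h ⊆ tsupport χ := by
    refine closure_mono fun z hz => ?_
    intro h0
    exact hz (by simp [hh, h0])
  have hhd : ContDiff ℝ 1 h := by
    rw [contDiff_iff_contDiffAt]
    intro z
    by_cases hz : z ∈ tsupport χ
    · have hzΩ : z ∈ Ω := hOΩ _ (by linarith) (hχO hz)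
      have h1 : ContDiffAt ℂ 1 f z := (hf.contDiffOn hΩ).contDiffAt (hΩ.mem_nhds hzΩ)
      exact (Complex.ofRealCLM.contDiff.comp hχ).contDiffAt.mul (h1.restrict_scalars ℝ)
    · have : h =ᶠ[𝓝 z] fun _ => 0 := notMem_tsupport_iff_eventuallyEq.1 fun h => hz (hsupp h)
      exact contDiffAt_const.congr_of_eventuallyEq this
  have hhf : ∀ z ∈ innerPart Ω t, h =ᶠ[𝓝 z] f := by
    intro z hz
    have := hχ1.filter_mono (nhds_le_nhdsSet (htK hz))
    filter_upwards [this] with w hw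
    simp [hh, hw]
  have hhol : ∀ z ∈ innerPart Ω t, DifferentiableAt ℂ h z := fun z hz =>
    (hf.differentiableAt (hΩ.mem_nhds (hOΩ t ht0 hz))).congr_of_eventuallyEq (hhf z hz)
  have hhcs : HasCompactSupport h := hcs.mono' (by
    exact (subset_tsupport h).trans hsupp)
  have hst : s < t := by linarith
  set S : Set ℂ := tsupport χ \ innerPart Ω t with hS
  have hScomp : IsCompact S := hcs.isCompact.diff (isOpen_innerPart Ω t)
  obtain ⟨δ, hδ, hsep⟩ := exists_pos_le_norm_sub (Ω := Ω) hs hst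
  set U := connectedComponentIn (innerPart Ω s) z₀ with hU
  have hUs : U ⊆ innerPart Ω s := connectedComponentIn_subset _ _
  set ω : ℂ → ℂ := fun ζ => (2 * Real.pi * I)⁻¹ * dbar h ζ with hω
  obtain ⟨F, hF⟩ := exists_primitive_integral (U := U) (S := S)
    (isOpen_innerPart Ω s).connectedComponentIn isPreconnected_connectedComponentIn
    (mem_connectedComponentIn hz₀) hScomp hδ (fun z hz ζ hζ => hsep z (hUs hz) ζ hζ.2)
    (fun ζ hζ => by
      obtain ⟨L, hL⟩ := exists_primitive_inv_sub hΩ hne hch hs hst hζ.2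
      exact ⟨L, fun z hz => hL z (hUs hz)⟩) (ω := ω) (continuous_const.mul (continuous_dbar hhd))
  have hst' : innerPart Ω s ⊆ innerPart Ω t := fun z hz =>
    ⟨hz.1.trans hst, (inv_strictAnti₀ hs hst).trans hz.2⟩
  refine ⟨F, fun z hz => (hF z hz).congr_deriv ?_⟩
  have hzt := hst' (hUs hz)
  rw [← (hhf z hzt).self_of_nhds, pompeiu hhd hhcs
    (((isOpen_innerPart Ω t).mem_nhds hzt |> fun h => (Filter.eventually_of_mem h hhol)))]
  refine setIntegral_eq_integral_of_forall_compl_eq_zero fun ζ hζ => ?_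
  have : dbar h ζ = 0 := by
    by_cases h1 : ζ ∈ innerPart Ω t
    · exact dbar_eq_zero (hhol ζ h1)
    · have h2 : ζ ∉ tsupport h := fun h3 => hζ ⟨hsupp h3, h1⟩
      have h4 : h =ᶠ[𝓝 ζ] fun _ => 0 := notMem_tsupport_iff_eventuallyEq.1 h2
      rw [dbar, h4.fderiv_eq]
      simp
  simp [hω, this]

theorem exists_innerPart_of_isCompact {Ω K : Set ℂ} (hΩ : IsOpen Ω) (hne : Ωᶜ.Nonempty)
    (hK : IsCompact K) (hKΩ : K ⊆ Ω) : ∃ n : ℕ, ∀ m : ℕ, n ≤ m → K ⊆ innerPart Ω (m + 1) := by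
  rcases K.eq_empty_or_nonempty with rfl | hKne
  · exact ⟨0, fun _ _ => empty_subset _⟩
  obtain ⟨z, hz, hmin⟩ := hK.exists_isMinOn hKne (continuous_infDist_pt Ωᶜ).continuousOn
  have hpos : 0 < infDist z Ωᶜ :=
    (hΩ.isClosed_compl.notMem_iff_infDist_pos hne).1 fun h => h (hKΩ hz)
  obtain ⟨M, hM⟩ := hK.isBounded.subset_closedBall 0
  obtain ⟨n, hn⟩ := exists_nat_gt (max M (infDist z Ωᶜ)⁻¹)
  refine ⟨n, fun m hm w hw => ?_⟩
  have hnm : (n : ℝ) ≤ m := Nat.cast_le.2 hm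
  refine ⟨?_, ?_⟩
  · have := mem_closedBall_zero_iff.1 (hM hw)
    linarith [le_max_left M (infDist z Ωᶜ)⁻¹]
  · have h1 : (infDist z Ωᶜ)⁻¹ < m + 1 := by linarith [le_max_right M (infDist z Ωᶜ)⁻¹]
    exact (inv_lt_of_inv_lt₀ hpos h1).trans_le (hmin hw)

theorem exists_primitive {Ω : Set ℂ} (hΩ : IsOpen Ω) (hc : IsPreconnected Ω) (hne : Ωᶜ.Nonempty)
    (hch : ChainsToInfinity Ωᶜ) {f : ℂ → ℂ} (hf : DifferentiableOn ℂ f Ω) :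
    ∃ F : ℂ → ℂ, ∀ z ∈ Ω, HasDerivAt F (f z) z := by
  rcases Ω.eq_empty_or_nonempty with rfl | ⟨z₀, hz₀⟩
  · exact ⟨0, by simp⟩
  obtain ⟨N, hN⟩ := exists_innerPart_of_isCompact hΩ hne (isCompact_singleton (x := z₀))
    (singleton_subset_iff.2 hz₀)
  -- Starting at level `N` puts `z₀` in every `W n`. Primitives normalised at `z₀` agree on the
  -- nested components `U n`, and these cover `Ω` because `Ω` is path connected.
  set W : ℕ → Set ℂ := fun n => innerPart Ω ((n + N : ℕ) + 1) with hW
  have hzW : ∀ n, z₀ ∈ W n := fun n => hN (n + N) (by omega) rfl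
  set U : ℕ → Set ℂ := fun n => connectedComponentIn (W n) z₀ with hU
  have hUo : ∀ n, IsOpen (U n) := fun n => (isOpen_innerPart Ω _).connectedComponentIn
  have hWmono : ∀ m n, m ≤ n → W m ⊆ W n := by
    intro m n hmn z hz
    have h1 : (((m + N : ℕ) : ℝ) + 1) ≤ ((n + N : ℕ) : ℝ) + 1 := by
      have : ((m + N : ℕ) : ℝ) ≤ ((n + N : ℕ) : ℝ) := Nat.cast_le.2 (by omega)
      linarith
    exact ⟨hz.1.trans_le h1, (inv_anti₀ (by positivity) h1).trans_lt hz.2⟩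
  have hUmono : ∀ m n, m ≤ n → U m ⊆ U n := fun m n hmn =>
    connectedComponentIn_mono z₀ (hWmono m n hmn)
  have hcover : ∀ z ∈ Ω, ∃ n, z ∈ U n := by
    intro z hz
    have hpc : IsPathConnected Ω := hΩ.isConnected_iff_isPathConnected.1 ⟨⟨z₀, hz₀⟩, hc⟩
    obtain ⟨γ, hγ⟩ := hpc.joinedIn z₀ hz₀ z hz
    obtain ⟨n, hn⟩ := exists_innerPart_of_isCompact hΩ hne (isCompact_range γ.continuous)
      (range_subset_iff.2 hγ)
    refine ⟨n, ?_⟩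
    exact (isPreconnected_range γ.continuous).subset_connectedComponentIn
      ⟨0, γ.source⟩ (hn (n + N) (by omega)) ⟨1, γ.target⟩
  have hP : ∀ n, ∃ P : ℂ → ℂ, P z₀ = 0 ∧ ∀ z ∈ U n, HasDerivAt P (f z) z := by
    intro n
    obtain ⟨P, hP⟩ := exists_primitive_on_inner_component hΩ hne hch hf (by positivity) (hzW n)
    exact ⟨fun z => P z - P z₀, sub_self _, fun z hz => (hP z hz).sub_const _⟩
  choose P hP0 hPd using hP
  have hagree : ∀ m n, m ≤ n → ∀ z ∈ U m, P m z = P n z := fun m n hmn z hz =>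
    eq_of_hasDerivAt_eq (hUo m) isPreconnected_connectedComponentIn (hPd m)
      (fun w hw => hPd n w (hUmono m n hmn hw)) (mem_connectedComponentIn (hzW m))
      (by rw [hP0, hP0]) hz
  classical
  refine ⟨fun z => if h : ∃ n, z ∈ U n then P (Nat.find h) z else 0, fun z hz => ?_⟩
  obtain ⟨n, hn⟩ := hcover z hz
  refine (hPd n z hn).congr_of_eventuallyEq ?_
  filter_upwards [(hUo n).mem_nhds hn] with w hw
  have h : ∃ n, w ∈ U n := ⟨n, hw⟩
  rw [dif_pos h]
  exact hagree _ _ (Nat.find_min' h hw) w (Nat.find_spec h)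

/-- If `F` is a primitive of `f' / f`, then `f e^{-F}` is constant; a square root of that constant
times `e^{F/2}` works. -/
theorem exists_sqrt {Ω : Set ℂ} (hΩ : IsOpen Ω) (hc : IsPreconnected Ω) (hne : Ωᶜ.Nonempty)
    (hch : ChainsToInfinity Ωᶜ) {f : ℂ → ℂ} (hf : DifferentiableOn ℂ f Ω)
    (h0 : ∀ z ∈ Ω, f z ≠ 0) : ∃ g : ℂ → ℂ, DifferentiableOn ℂ g Ω ∧ ∀ z ∈ Ω, g z ^ 2 = f z := by
  rcases Ω.eq_empty_or_nonempty with rfl | ⟨z₀, hz₀⟩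
  · exact ⟨0, differentiableOn_empty, by simp⟩
  obtain ⟨F, hF⟩ := exists_primitive hΩ hc hne hch ((hf.deriv hΩ).div hf h0)
  have hd : ∀ z ∈ Ω, HasDerivAt (fun z => f z * exp (-F z)) 0 z := by
    intro z hz
    have h1 := (hf.differentiableAt (hΩ.mem_nhds hz)).hasDerivAt
    have h2 := (hF z hz).neg.cexp
    refine (h1.mul h2).congr_deriv ?_
    have := h0 z hz
    simp only [Pi.neg_apply, Pi.div_apply]
    field_simp
    ring
  have hconst : ∀ z ∈ Ω, f z * exp (-F z) = f z₀ * exp (-F z₀) := fun z hz =>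
    hΩ.is_const_of_deriv_eq_zero hc
      (fun w hw => (hd w hw).differentiableAt.differentiableWithinAt) (fun w hw => (hd w hw).deriv)
      hz hz₀
  obtain ⟨c, hcc⟩ := IsAlgClosed.exists_pow_nat_eq (f z₀ * exp (-F z₀)) two_pos
  refine ⟨fun z => c * exp (F z / 2), fun z hz =>
    (((hF z hz).differentiableAt.div_const 2).cexp.const_mul c).differentiableWithinAt, ?_⟩
  intro z hz
  rw [mul_pow, hcc, ← hconst z hz, ← Complex.exp_nat_mul, mul_assoc, ← Complex.exp_add]
  have : -F z + (2 : ℕ) * (F z / 2) = 0 := by push_cast; ring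
  rw [this, Complex.exp_zero, mul_one]

/-! ### The length–area method -/

theorem lintegral_image_eq_lintegral_norm_deriv_sq {s : Set ℂ} (hs : MeasurableSet s)
    {u u' : ℂ → ℂ} (hu : ∀ ζ ∈ s, HasDerivAt u (u' ζ) ζ) (hi : InjOn u s) (g : ℂ → ENNReal) :
    ∫⁻ z in u '' s, g z = ∫⁻ ζ in s, ENNReal.ofReal (‖u' ζ‖ ^ 2) * g (u ζ) := by
  have h1 : ∀ ζ ∈ s, HasFDerivWithinAt u
      ((ContinuousLinearMap.toSpanSingleton ℂ (u' ζ)).restrictScalars ℝ) s ζ :=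
    fun ζ hζ => ((hu ζ hζ).hasFDerivAt.restrictScalars ℝ).hasFDerivWithinAt
  rw [lintegral_image_eq_lintegral_abs_det_fderiv_mul volume hs h1 hi g]
  refine setLIntegral_congr_fun hs fun ζ _ => ?_
  have : ((ContinuousLinearMap.toSpanSingleton ℂ (u' ζ)).restrictScalars ℝ).det = ‖u' ζ‖ ^ 2 := by
    rw [← Complex.normSq_eq_norm_sq, ← Algebra.norm_complex_apply, Algebra.norm_apply]
    rw [ContinuousLinearMap.det]
    congr 1
    ext
    simp [mul_comm]
  rw [this, abs_of_nonneg (sq_nonneg _)]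

/-- The vertical strip `{x₁ < Re ζ < x₂}`. -/
def strip (x₁ x₂ : ℝ) : Set ℂ := {ζ | x₁ < ζ.re ∧ ζ.re < x₂}

/-- A rectangle of height `2π` in a vertical strip. -/
def stripCell (x₁ x₂ : ℝ) : Set ℂ := Ioo x₁ x₂ ×ℂ Ioo 0 (2 * Real.pi)

theorem isOpen_strip (x₁ x₂ : ℝ) : IsOpen (strip x₁ x₂) :=
  (isOpen_lt continuous_const continuous_re).inter (isOpen_lt continuous_re continuous_const)

theorem convex_strip (x₁ x₂ : ℝ) : Convex ℝ (strip x₁ x₂) :=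
  (convex_halfSpace_re_gt x₁).inter (convex_halfSpace_re_lt x₂)

theorem stripCell_subset (x₁ x₂ : ℝ) : stripCell x₁ x₂ ⊆ strip x₁ x₂ := fun _ h => h.1

theorem measurableSet_reProdIm {s t : Set ℝ} (hs : MeasurableSet s) (ht : MeasurableSet t) :
    MeasurableSet (s ×ℂ t) :=
  (measurable_re hs).inter (measurable_im ht)

theorem lintegral_reProdIm {s t : Set ℝ} (hs : MeasurableSet s) (ht : MeasurableSet t)
    {G : ℂ → ENNReal} (hG : Measurable G) :
    ∫⁻ ζ in s ×ℂ t, G ζ = ∫⁻ x in s, ∫⁻ y in t, G (x + y * I) := by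
  have hmp := Complex.volume_preserving_equiv_real_prod.symm
  have hpre : measurableEquivRealProd.symm ⁻¹' (s ×ℂ t) = s ×ˢ t := by
    ext ⟨x, y⟩
    simp [Complex.measurableEquivRealProd_symm_apply, Complex.mem_reProdIm]
  rw [← hmp.setLIntegral_comp_preimage (measurableSet_reProdIm hs ht) hG, hpre,
    show (volume : Measure (ℝ × ℝ)) = (volume : Measure ℝ).prod volume from rfl,
    ← Measure.prod_restrict, lintegral_prod (fun p => G (measurableEquivRealProd.symm p))
      (hG.comp measurableEquivRealProd.symm.measurable).aemeasurable]
  refine lintegral_congr fun x => lintegral_congr fun y => ?_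
  rw [Complex.measurableEquivRealProd_symm_apply]
  congr 1
  exact mk_eq_add_mul_I x y

theorem volume_reProdIm {s t : Set ℝ} (hs : MeasurableSet s) (ht : MeasurableSet t) :
    volume (s ×ℂ t) = volume s * volume t := by
  have := lintegral_reProdIm hs ht (G := fun _ => 1) measurable_const
  simpa [mul_comm] using this

theorem lintegral_vertical_ge {x₁ x₂ : ℝ} {Y : ℂ → ℂ} (hY : DifferentiableOn ℂ Y (strip x₁ x₂))
    (hper : ∀ ζ ∈ strip x₁ x₂, 2 * Real.pi ≤ ‖Y (ζ + 2 * Real.pi * I) - Y ζ‖) {x : ℝ}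
    (hx : x ∈ Ioo x₁ x₂) :
    ENNReal.ofReal (2 * Real.pi)
      ≤ ∫⁻ y in Ioo 0 (2 * Real.pi), ENNReal.ofReal (‖deriv Y (x + y * I)‖ ^ 2) := by
  have hpi := Real.pi_pos
  have hmem : ∀ y : ℝ, (x : ℂ) + y * I ∈ strip x₁ x₂ := fun y => by simpa [strip] using hx
  have hline : Continuous fun y : ℝ => (x : ℂ) + y * I := by fun_prop
  have hdc : Continuous fun y : ℝ => deriv Y (x + y * I) :=
    ((hY.deriv (isOpen_strip _ _)).continuousOn).comp_continuous hline hmem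
  have hder : ∀ y : ℝ, HasDerivAt (fun y : ℝ => Y (x + y * I)) (deriv Y (x + y * I) * I) y := by
    intro y
    have h1 : HasDerivAt (fun y : ℝ => (x : ℂ) + y * I) I y := by
      simpa using ((Complex.ofRealCLM.hasDerivAt (x := y)).mul_const I).const_add (x : ℂ)
    exact ((hY.differentiableAt ((isOpen_strip _ _).mem_nhds (hmem y))).hasDerivAt).comp y h1
  have hint : ∫ y in (0 : ℝ)..(2 * Real.pi), deriv Y (x + y * I) * I
      = Y (x + (2 * Real.pi : ℝ) * I) - Y (x + (0 : ℝ) * I) :=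
    intervalIntegral.integral_eq_sub_of_hasDerivAt (fun y _ => hder y)
      ((hdc.mul continuous_const).intervalIntegrable _ _)
  have hlen : 2 * Real.pi ≤ ∫ y in (0 : ℝ)..(2 * Real.pi), ‖deriv Y (x + y * I)‖ := by
    have h1 := hper (x + (0 : ℝ) * I) (hmem 0)
    have h2 : (x : ℂ) + (0 : ℝ) * I + 2 * Real.pi * I = x + (2 * Real.pi : ℝ) * I := by
      push_cast; ring
    rw [h2, ← hint] at h1
    refine h1.trans ((intervalIntegral.norm_integral_le_integral_norm (by positivity)).trans_eq ?_)
    congr 1; ext y; simp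
  have hsq : 2 * Real.pi ≤ ∫ y in (0 : ℝ)..(2 * Real.pi), ‖deriv Y (x + y * I)‖ ^ 2 := by
    -- The inequality `t² ≥ 2t - 1` stands in for Cauchy–Schwarz; it loses nothing at the extremal
    -- speed `|Y'| = 1`.
    have h1 : ∫ y in (0 : ℝ)..(2 * Real.pi), (2 * ‖deriv Y (x + y * I)‖ - 1)
        ≤ ∫ y in (0 : ℝ)..(2 * Real.pi), ‖deriv Y (x + y * I)‖ ^ 2 := by
      refine intervalIntegral.integral_mono_on (by positivity)
        (Continuous.intervalIntegrable (by fun_prop) _ _)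
        (Continuous.intervalIntegrable (by fun_prop) _ _) fun y _ => ?_
      nlinarith [sq_nonneg (‖deriv Y (x + y * I)‖ - 1)]
    rw [intervalIntegral.integral_sub (Continuous.intervalIntegrable (by fun_prop) _ _)
      (Continuous.intervalIntegrable (by fun_prop) _ _), intervalIntegral.integral_const_mul] at h1
    simp only [intervalIntegral.integral_const, sub_zero, smul_eq_mul, mul_one] at h1
    linarith
  rw [intervalIntegral.integral_of_le (by positivity), integral_Ioc_eq_integral_Ioo] at hsq
  rw [← ofReal_integral_eq_lintegral_ofReal]
  · exact ENNReal.ofReal_le_ofReal hsq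
  · exact (Continuous.integrableOn_Icc (a := 0) (b := 2 * Real.pi) (by fun_prop)).mono_set
      Ioo_subset_Icc_self
  · exact Eventually.of_forall fun y => sq_nonneg _

theorem lintegral_stripCell_ge {x₁ x₂ : ℝ} {Y : ℂ → ℂ}
    (hY : DifferentiableOn ℂ Y (strip x₁ x₂))
    (hper : ∀ ζ ∈ strip x₁ x₂, 2 * Real.pi ≤ ‖Y (ζ + 2 * Real.pi * I) - Y ζ‖) :
    ENNReal.ofReal (2 * Real.pi * (x₂ - x₁))
      ≤ ∫⁻ ζ in stripCell x₁ x₂, ENNReal.ofReal (‖deriv Y ζ‖ ^ 2) := by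
  rw [stripCell, lintegral_reProdIm measurableSet_Ioo measurableSet_Ioo
    (((measurable_deriv Y).norm.pow_const 2).ennreal_ofReal)]
  calc ENNReal.ofReal (2 * Real.pi * (x₂ - x₁))
      = ∫⁻ _ in Ioo x₁ x₂, ENNReal.ofReal (2 * Real.pi) := by
        rw [setLIntegral_const, Real.volume_Ioo, ← ENNReal.ofReal_mul Real.two_pi_pos.le]
    _ ≤ _ := setLIntegral_mono' measurableSet_Ioo fun x hx => lintegral_vertical_ge hY hper hx

/-- `Y` is a coordinate in which vertical period segments are long, `u` embeds the period cell in
`W`, and `ρ` is an area density whose pullback by `u` dominates `|Y'|²`. -/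
theorem lengthArea {x₁ x₂ : ℝ} {Y u : ℂ → ℂ} (hY : DifferentiableOn ℂ Y (strip x₁ x₂))
    (hper : ∀ ζ ∈ strip x₁ x₂, 2 * Real.pi ≤ ‖Y (ζ + 2 * Real.pi * I) - Y ζ‖)
    (hu : DifferentiableOn ℂ u (strip x₁ x₂)) (hi : InjOn u (stripCell x₁ x₂)) {W : Set ℂ}
    (hW : MapsTo u (stripCell x₁ x₂) W) {ρ : ℂ → ℝ}
    (hρ : ∀ ζ ∈ strip x₁ x₂, ‖deriv Y ζ‖ ^ 2 ≤ ‖deriv u ζ‖ ^ 2 * ρ (u ζ)) :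
    ENNReal.ofReal (2 * Real.pi * (x₂ - x₁)) ≤ ∫⁻ z in W, ENNReal.ofReal (ρ z) := by
  have hm : MeasurableSet (stripCell x₁ x₂) :=
    measurableSet_reProdIm measurableSet_Ioo measurableSet_Ioo
  calc ENNReal.ofReal (2 * Real.pi * (x₂ - x₁))
      ≤ ∫⁻ ζ in stripCell x₁ x₂, ENNReal.ofReal (‖deriv Y ζ‖ ^ 2) := lintegral_stripCell_ge hY hper
    _ ≤ ∫⁻ ζ in stripCell x₁ x₂, ENNReal.ofReal (‖deriv u ζ‖ ^ 2) * ENNReal.ofReal (ρ (u ζ)) := by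
        refine setLIntegral_mono' hm fun ζ hζ => ?_
        rw [← ENNReal.ofReal_mul (sq_nonneg _)]
        exact ENNReal.ofReal_le_ofReal (hρ ζ (stripCell_subset _ _ hζ))
    _ = ∫⁻ z in u '' stripCell x₁ x₂, ENNReal.ofReal (ρ z) :=
        (lintegral_image_eq_lintegral_norm_deriv_sq hm (fun ζ hζ => (hu.differentiableAt
          ((isOpen_strip _ _).mem_nhds (stripCell_subset _ _ hζ))).hasDerivAt) hi (fun z => ENNReal.ofReal (ρ z))).symm
    _ ≤ _ := lintegral_mono_set hW.image_subset

/-! ### Areas in the two extremal metrics -/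

theorem lintegral_annulus_inv_sq {r s : ℝ} (hr : 0 < r) (hs : 0 < s) :
    ∫⁻ w in {w : ℂ | r < ‖w‖ ∧ ‖w‖ < s}, ENNReal.ofReal ((‖w‖ ^ 2)⁻¹)
      = ENNReal.ofReal (2 * Real.pi * Real.log (s / r)) := by
  set D : Set ℂ := Ioo (Real.log r) (Real.log s) ×ℂ Ioc (-Real.pi) Real.pi with hD
  have himg : exp '' D = {w : ℂ | r < ‖w‖ ∧ ‖w‖ < s} := by
    ext w
    constructor
    · rintro ⟨ζ, ⟨⟨h1, h2⟩, -⟩, rfl⟩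
      simp only [mem_ofPred_eq, Complex.norm_exp]
      exact ⟨(Real.log_lt_iff_lt_exp hr).1 h1, (Real.lt_log_iff_exp_lt hs).1 h2⟩
    · rintro ⟨h1, h2⟩
      have hw : w ≠ 0 := norm_pos_iff.1 (hr.trans h1)
      refine ⟨log w, ⟨⟨?_, ?_⟩, ?_, ?_⟩, exp_log hw⟩
      · rw [log_re]; exact Real.log_lt_log hr h1
      · rw [log_re]; exact Real.log_lt_log (hr.trans h1) h2
      · exact neg_pi_lt_log_im w
      · exact log_im_le_pi w
  have hi : InjOn exp D := by
    intro ζ hζ ζ' hζ' h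
    rw [← log_exp hζ.2.1 hζ.2.2, h, log_exp hζ'.2.1 hζ'.2.2]
  have hm : MeasurableSet D := measurableSet_reProdIm measurableSet_Ioo measurableSet_Ioc
  rw [← himg, lintegral_image_eq_lintegral_norm_deriv_sq hm (fun ζ _ => hasDerivAt_exp ζ) hi]
  have : ∀ ζ ∈ D, ENNReal.ofReal (‖exp ζ‖ ^ 2) * ENNReal.ofReal ((‖exp ζ‖ ^ 2)⁻¹) = 1 := by
    intro ζ _
    have h0 : 0 < ‖exp ζ‖ ^ 2 := by have := norm_pos_iff.2 (exp_ne_zero ζ); positivity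
    rw [← ENNReal.ofReal_mul h0.le, mul_inv_cancel₀ h0.ne', ENNReal.ofReal_one]
  rw [setLIntegral_congr_fun hm this, setLIntegral_one, hD,
    volume_reProdIm measurableSet_Ioo measurableSet_Ioc, Real.volume_Ioo, Real.volume_Ioc,
    mul_comm, ← ENNReal.ofReal_mul (by linarith [Real.pi_pos]), Real.log_div hs.ne' hr.ne']
  congr 1
  ring

/-- The density `1 / |z (z - a)|` of the quadratic differential with poles at `0` and `a`. -/
noncomputable def poleDensity (a z : ℂ) : ℝ := (‖z‖ * ‖z - a‖)⁻¹

theorem volume_real_line (a : ℂ) : volume {z : ℂ | ∃ t : ℝ, z = t * a} = 0 := by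
  have hne : Submodule.span ℝ {a} ≠ ⊤ := by
    intro h
    have h1 := finrank_span_le_card (R := ℝ) ({a} : Set ℂ)
    rw [h, finrank_top, Complex.finrank_real_complex] at h1
    simp at h1
  refine measure_mono_null ?_ (Measure.addHaar_submodule volume _ hne)
  rintro z ⟨t, rfl⟩
  exact Submodule.mem_span_singleton.2 ⟨t, by simp⟩

/-- With `q² = 1 - a / z` the solution is `ζ = (1 + q) / (1 - q)`, and `-q` gives `ζ⁻¹`. The unit
circle lands on the line `ℝa`, so off that line exactly one of the two is outside the closed disk.
From `|a| (|ζ| - 1)² ≤ 4T |ζ|` comes `|ζ| ≤ 4T / |a| + 2`; the `3` makes the bound strict. -/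
theorem exists_joukowski_preimage {a z : ℂ} (ha : a ≠ 0) {T : ℝ} (hz : ‖z‖ < T)
    (hline : ¬∃ t : ℝ, z = t * a) :
    ∃ ζ : ℂ, (1 < ‖ζ‖ ∧ ‖ζ‖ < 4 * T / ‖a‖ + 3) ∧ a * (ζ + 1) ^ 2 / (4 * ζ) = z := by
  have hz0 : z ≠ 0 := fun h => hline ⟨0, by simp [h]⟩
  obtain ⟨q, hq⟩ := IsAlgClosed.exists_pow_nat_eq (1 - a / z) two_pos
  have haz : a / z ≠ 0 := div_ne_zero ha hz0
  have h1 : 1 - q ≠ 0 := by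
    intro h; apply haz; linear_combination hq + (1 + q) * h
  have h2 : 1 + q ≠ 0 := by
    intro h; apply haz; linear_combination hq + (1 - q) * h
  have key : ∀ ζ : ℂ, ζ ≠ 0 → a * (ζ + 1) ^ 2 / (4 * ζ) = z → ‖ζ‖ ≠ 1 ∧
      (1 < ‖ζ‖ → ‖ζ‖ < 4 * T / ‖a‖ + 3) := by
    intro ζ hζ h
    have hap : 0 < ‖a‖ := norm_pos_iff.2 ha
    refine ⟨fun hn => hline ⟨(1 + ζ.re) / 2, ?_⟩, fun hgt => ?_⟩
    · have hinv : (starRingEnd ℂ) ζ * ζ = 1 := by rw [Complex.conj_mul', hn]; simp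
      have hre : ζ + (starRingEnd ℂ) ζ = (2 * ζ.re : ℝ) := Complex.add_conj ζ
      rw [← h, div_eq_iff (by simpa using hζ)]
      push_cast at hre ⊢
      linear_combination (a * ζ) * hre - a * hinv
    · rw [div_eq_iff (by simpa using hζ)] at h
      have h3 := congrArg norm h
      rw [norm_mul, norm_pow, norm_mul, norm_mul, Complex.norm_ofNat] at h3
      have h4 : ‖ζ‖ - 1 ≤ ‖ζ + 1‖ := by
        simpa using norm_sub_norm_le ζ (-1)
      have h5 : (‖ζ‖ - 1) ^ 2 ≤ ‖ζ + 1‖ ^ 2 := pow_le_pow_left₀ (by linarith) h4 2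
      have h6 : ‖a‖ * (‖ζ‖ - 1) ^ 2 ≤ T * 4 * ‖ζ‖ := by
        calc ‖a‖ * (‖ζ‖ - 1) ^ 2 ≤ ‖a‖ * ‖ζ + 1‖ ^ 2 := by gcongr
          _ = ‖z‖ * (4 * ‖ζ‖) := h3
          _ ≤ T * (4 * ‖ζ‖) := by gcongr
          _ = _ := by ring
      have h7 : ‖a‖ * (‖ζ‖ - 2) * ‖ζ‖ ≤ 4 * T * ‖ζ‖ := by nlinarith
      have h8 : ‖a‖ * (‖ζ‖ - 2) ≤ 4 * T := le_of_mul_le_mul_right h7 (by linarith)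
      have h9 : ‖ζ‖ - 2 ≤ 4 * T / ‖a‖ := by rw [le_div_iff₀ hap]; linarith
      linarith
  have hJ : ∀ q : ℂ, q ^ 2 = 1 - a / z → 1 - q ≠ 0 → 1 + q ≠ 0 →
      a * ((1 + q) / (1 - q) + 1) ^ 2 / (4 * ((1 + q) / (1 - q))) = z := by
    intro q hq h1 h2
    have h3 : a = z * (1 - q ^ 2) := by rw [hq]; field_simp; ring
    have h4 : (1 + q) / (1 - q) + 1 = 2 / (1 - q) := by field_simp; ring
    rw [h4, h3]
    field_simp
    ring
  have hd : ∀ q : ℂ, 1 - q ≠ 0 → 1 + q ≠ 0 → (1 + q) / (1 - q) ≠ 0 := fun q h1 h2 =>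
    div_ne_zero h2 h1
  by_cases hgt : 1 < ‖(1 + q) / (1 - q)‖
  · have := hJ q hq h1 h2
    exact ⟨_, ⟨hgt, (key _ (hd q h1 h2) this).2 hgt⟩, this⟩
  · have hJ' := hJ (-q) (by rw [neg_sq, hq]) (by simpa using h2) (by simpa [sub_eq_add_neg] using h1)
    have h0' := hd (-q) (by simpa using h2) (by simpa [sub_eq_add_neg] using h1)
    have hprod : ‖(1 + -q) / (1 - -q)‖ * ‖(1 + q) / (1 - q)‖ = 1 := by
      rw [← norm_mul, ← norm_one (α := ℂ)]
      congr 1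
      rw [sub_neg_eq_add, ← sub_eq_add_neg]
      field_simp
    have hge : 1 ≤ ‖(1 + -q) / (1 - -q)‖ := by
      by_contra hcon
      push Not at hcon hgt
      nlinarith [norm_nonneg ((1 + q) / (1 - q)), norm_nonneg ((1 + -q) / (1 - -q))]
    have hgt' := lt_of_le_of_ne hge (Ne.symm (key _ h0' hJ').1)
    exact ⟨_, ⟨hgt', (key _ h0' hJ').2 hgt'⟩, hJ'⟩

theorem joukowski_injOn {a : ℂ} (ha : a ≠ 0) :
    InjOn (fun ζ : ℂ => a * (ζ + 1) ^ 2 / (4 * ζ)) {ζ | 1 < ‖ζ‖} := by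
  intro ζ hζ ζ' hζ' h
  simp only [mem_ofPred_eq] at hζ hζ'
  have h0 : ζ ≠ 0 := norm_pos_iff.1 (by linarith)
  have h0' : ζ' ≠ 0 := norm_pos_iff.1 (by linarith)
  simp only at h
  rw [div_eq_div_iff (by simpa using h0) (by simpa using h0')] at h
  have h1 : a * ((ζ - ζ') * (ζ * ζ' - 1)) = 0 := by linear_combination h / 4
  rcases mul_eq_zero.1 h1 with h2 | h2
  · exact absurd h2 ha
  rcases mul_eq_zero.1 h2 with h3 | h3
  · exact sub_eq_zero.1 h3
  · exfalso
    have : ‖ζ‖ * ‖ζ'‖ = 1 := by rw [← norm_mul, sub_eq_zero.1 h3, norm_one]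
    nlinarith

/-- The Joukowski map pulls the density back to `|ζ|⁻²`, so a round annulus bounds the area. The `+
3` is an artefact, removed in `lintegral_poleDensity_le`. -/
theorem lintegral_poleDensity_le_aux {a : ℂ} (ha : a ≠ 0) {T : ℝ} (hT : 0 < T) :
    ∫⁻ z in ball 0 T, ENNReal.ofReal (poleDensity a z)
      ≤ ENNReal.ofReal (2 * Real.pi * Real.log (4 * T / ‖a‖ + 3)) := by
  set s := 4 * T / ‖a‖ + 3 with hs
  have hap : 0 < ‖a‖ := norm_pos_iff.2 ha
  have hs0 : 0 < s := by positivity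
  set A : Set ℂ := {w : ℂ | 1 < ‖w‖ ∧ ‖w‖ < s} with hA
  set J : ℂ → ℂ := fun ζ => a * (ζ + 1) ^ 2 / (4 * ζ) with hJ
  have hAm : MeasurableSet A :=
    ((isOpen_lt continuous_const continuous_norm).inter
      (isOpen_lt continuous_norm continuous_const)).measurableSet
  have hcover : ball (0 : ℂ) T ⊆ J '' A ∪ {z : ℂ | ∃ t : ℝ, z = t * a} := by
    intro z hz
    by_cases hl : ∃ t : ℝ, z = t * a
    · exact Or.inr hl
    · obtain ⟨ζ, h1, h2⟩ := exists_joukowski_preimage ha (mem_ball_zero_iff.1 hz) hl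
      exact Or.inl ⟨ζ, h1, h2⟩
  have hA0 : ∀ ζ ∈ A, ζ ≠ 0 := fun ζ hζ => norm_pos_iff.1 (one_pos.trans hζ.1)
  have hJd : ∀ ζ ∈ A, HasDerivAt J (a * (ζ ^ 2 - 1) / (4 * ζ ^ 2)) ζ := by
    intro ζ hζ
    have h0 := hA0 ζ hζ
    have h1 : HasDerivAt (fun ζ : ℂ => a * (ζ + 1) ^ 2) (a * (2 * (ζ + 1))) ζ := by
      simpa using (((hasDerivAt_id ζ).add_const 1).pow 2).const_mul a
    have h2 : HasDerivAt (fun ζ : ℂ => 4 * ζ) 4 ζ := by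
      simpa using (hasDerivAt_id ζ).const_mul 4
    refine (h1.div h2 (by simpa using h0)).congr_deriv ?_
    field_simp
    ring
  have hden : ∀ ζ ∈ A, ENNReal.ofReal (‖a * (ζ ^ 2 - 1) / (4 * ζ ^ 2)‖ ^ 2)
      * ENNReal.ofReal (poleDensity a (J ζ)) = ENNReal.ofReal ((‖ζ‖ ^ 2)⁻¹) := by
    intro ζ hζ
    have h0 := hA0 ζ hζ
    have hp1 : ζ + 1 ≠ 0 := by
      intro h
      have : ‖ζ‖ = 1 := by rw [eq_neg_of_add_eq_zero_left h, norm_neg, norm_one]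
      linarith [hζ.1]
    have hm1 : ζ - 1 ≠ 0 := by
      intro h
      have : ‖ζ‖ = 1 := by rw [sub_eq_zero.1 h, norm_one]
      linarith [hζ.1]
    rw [← ENNReal.ofReal_mul (sq_nonneg _)]
    congr 1
    have e1 : J ζ - a = a * (ζ - 1) ^ 2 / (4 * ζ) := by
      simp only [hJ]; field_simp; ring
    have e2 : ζ ^ 2 - 1 = (ζ + 1) * (ζ - 1) := by ring
    rw [poleDensity, e1, e2]
    simp only [hJ, norm_div, norm_mul, norm_pow, Complex.norm_ofNat]
    have n0 := norm_pos_iff.2 h0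
    have n1 := norm_pos_iff.2 hp1
    have n2 := norm_pos_iff.2 hm1
    field_simp
  calc ∫⁻ z in ball 0 T, ENNReal.ofReal (poleDensity a z)
      ≤ ∫⁻ z in J '' A ∪ {z : ℂ | ∃ t : ℝ, z = t * a}, ENNReal.ofReal (poleDensity a z) :=
        lintegral_mono_set hcover
    _ ≤ (∫⁻ z in J '' A, ENNReal.ofReal (poleDensity a z))
        + ∫⁻ z in {z : ℂ | ∃ t : ℝ, z = t * a}, ENNReal.ofReal (poleDensity a z) :=
        lintegral_union_le _ _ _
    _ = ∫⁻ z in J '' A, ENNReal.ofReal (poleDensity a z) := by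
        rw [setLIntegral_measure_zero _ _ (volume_real_line a), add_zero]
    _ = ∫⁻ ζ in A, ENNReal.ofReal ((‖ζ‖ ^ 2)⁻¹) := by
        rw [lintegral_image_eq_lintegral_norm_deriv_sq hAm hJd
          ((joukowski_injOn ha).mono fun ζ hζ => hζ.1)]
        exact setLIntegral_congr_fun hAm hden
    _ = _ := by rw [lintegral_annulus_inv_sq one_pos hs0, div_one]

/-! ### Comparison near infinity and the sharp constant -/

theorem exp_injOn_stripCell (x₁ x₂ : ℝ) : InjOn exp (stripCell x₁ x₂) := by
  intro ζ hζ ζ' hζ' h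
  obtain ⟨n, hn⟩ := Complex.exp_eq_exp_iff_exists_int.1 h
  have him := congrArg Complex.im hn
  simp at him
  have h1 := hζ.2.1
  have h2 := hζ.2.2
  have h3 := hζ'.2.1
  have h4 := hζ'.2.2
  have hpi := Real.pi_pos
  have hn1 : (n : ℝ) < 1 := by nlinarith
  have hn2 : (-1 : ℝ) < n := by nlinarith
  have hn0 : n = 0 := by
    have h5 : n < 1 := by exact_mod_cast hn1
    have h6 : -1 < n := by exact_mod_cast hn2
    omega
  simpa [hn0] using hn

/-- The branch of `√(1 - a e^{-η})` close to `1` for large `Re η`. -/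
noncomputable def outerRoot (a η : ℂ) : ℂ := exp (log (1 - a * exp (-η)) / 2)

theorem outerRoot_ne_zero (a η : ℂ) : outerRoot a η ≠ 0 := exp_ne_zero _

theorem one_sub_mem_slitPlane {w : ℂ} (hw : ‖w‖ < 1) : 1 - w ∈ slitPlane := by
  rw [sub_eq_add_neg]
  exact mem_slitPlane_of_norm_lt_one (by rwa [norm_neg])

theorem outerRoot_sq {a η : ℂ} (h : ‖a * exp (-η)‖ < 1) :
    outerRoot a η ^ 2 = 1 - a * exp (-η) := by
  rw [outerRoot, ← Complex.exp_nat_mul]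
  have : ((2 : ℕ) : ℂ) * (log (1 - a * exp (-η)) / 2) = log (1 - a * exp (-η)) := by
    push_cast; ring
  rw [this, exp_log (slitPlane_ne_zero (one_sub_mem_slitPlane h))]

theorem hasDerivAt_outerRoot {a η : ℂ} (h : ‖a * exp (-η)‖ < 1) :
    HasDerivAt (outerRoot a) ((1 - outerRoot a η ^ 2) / (2 * outerRoot a η)) η := by
  have h1 : HasDerivAt (fun η => 1 - a * exp (-η)) (a * exp (-η)) η := by
    have := (((hasDerivAt_id η).neg).cexp.const_mul a).const_sub 1
    simpa using this
  have h2 := ((h1.clog (one_sub_mem_slitPlane h)).div_const 2).cexp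
  refine h2.congr_deriv ?_
  have hq0 := outerRoot_ne_zero a η
  have e1 : a * exp (-η) = 1 - outerRoot a η ^ 2 := by rw [outerRoot_sq h]; ring
  have e2 : (1 - a * exp (-η)) = outerRoot a η ^ 2 := (outerRoot_sq h).symm
  change outerRoot a η * (a * exp (-η) / (1 - a * exp (-η)) / 2) = _
  rw [e2, e1]
  field_simp

theorem outerRoot_re_pos {a η : ℂ} (h : ‖a * exp (-η)‖ < 1) : 0 < (outerRoot a η).re := by
  have h1 : |(log (1 - a * exp (-η)) / 2).im| < Real.pi / 2 := by
    have := Complex.abs_arg_lt_pi_div_two_iff.2 (Or.inl (show 0 < (1 - a * exp (-η)).re by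
      have := (abs_re_le_norm (a * exp (-η))).trans_lt h
      rw [sub_re, one_re]
      linarith [(abs_lt.1 this).2]))
    have h2 : (log (1 - a * exp (-η)) / 2).im = arg (1 - a * exp (-η)) / 2 := by
      rw [← log_im]
      simp
    rw [h2, abs_div, abs_two]
    linarith [abs_nonneg (arg (1 - a * exp (-η)))]
  rw [outerRoot, Complex.exp_re]
  exact mul_pos (Real.exp_pos _) (Real.cos_pos_of_mem_Ioo (abs_lt.1 h1))

theorem outerRoot_periodic (a η : ℂ) : outerRoot a (η + 2 * Real.pi * I) = outerRoot a η := by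
  have : exp (-(η + 2 * Real.pi * I)) = exp (-η) := by
    rw [neg_add, ← sub_eq_add_neg, Complex.exp_periodic.sub_eq]
  simp only [outerRoot, this]

/-- The logarithm of the inverse of `ζ ↦ a (ζ + 1)² / (4 ζ)` in the exponential coordinate. -/
noncomputable def outerLog (a η : ℂ) : ℂ := η + 2 * log (1 + outerRoot a η)

theorem outerLog_periodic (a η : ℂ) :
    outerLog a (η + 2 * Real.pi * I) = outerLog a η + 2 * Real.pi * I := by
  simp only [outerLog, outerRoot_periodic]; ring

theorem one_add_outerRoot_mem_slitPlane {a η : ℂ} (h : ‖a * exp (-η)‖ < 1) :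
    1 + outerRoot a η ∈ slitPlane :=
  Or.inl (by have := outerRoot_re_pos h; simp; linarith)

theorem hasDerivAt_outerLog {a η : ℂ} (h : ‖a * exp (-η)‖ < 1) :
    HasDerivAt (outerLog a) (1 / outerRoot a η) η := by
  have h1 := one_add_outerRoot_mem_slitPlane h
  have h2 := ((hasDerivAt_outerRoot h).const_add 1).clog h1
  refine ((hasDerivAt_id η).add (h2.const_mul 2)).congr_deriv ?_
  have hq0 := outerRoot_ne_zero a η
  have h3 := slitPlane_ne_zero h1
  field_simp
  ring

theorem norm_mul_exp_neg_lt_one {a η : ℂ} {R : ℝ} (hR : ‖a‖ ≤ R) (hR0 : 0 < R)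
    (hη : Real.log R < η.re) : ‖a * exp (-η)‖ < 1 := by
  have h1 : R < Real.exp η.re := (Real.log_lt_iff_lt_exp hR0).1 hη
  rw [norm_mul, Complex.norm_exp, neg_re, Real.exp_neg, ← div_eq_mul_inv,
    div_lt_one (Real.exp_pos _)]
  linarith

/-- Beyond `|z| = T ≥ |a|` the natural coordinate of the density is `outerLog a`, which is `log z`
plus a periodic term. Its period is exactly `2πi`, so length–area with `u = exp` bounds the area
from below. -/
theorem lintegral_poleDensity_annulus_ge {a : ℂ} (ha : a ≠ 0) {T T' : ℝ} (hT : ‖a‖ ≤ T)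
    (hTT' : T < T') :
    ENNReal.ofReal (2 * Real.pi * Real.log (T' / T))
      ≤ ∫⁻ z in {z : ℂ | T < ‖z‖ ∧ ‖z‖ < T'}, ENNReal.ofReal (poleDensity a z) := by
  have hap : 0 < ‖a‖ := norm_pos_iff.2 ha
  have hT0 : 0 < T := hap.trans_le hT
  have hT0' : 0 < T' := hT0.trans hTT'
  have hlt : ∀ η ∈ strip (Real.log T) (Real.log T'), ‖a * exp (-η)‖ < 1 := fun η hη =>
    norm_mul_exp_neg_lt_one hT hT0 hη.1
  have hmain := lengthArea (x₁ := Real.log T) (x₂ := Real.log T') (Y := outerLog a) (u := exp)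
    (W := {z : ℂ | T < ‖z‖ ∧ ‖z‖ < T'}) (ρ := poleDensity a)
    (fun η hη => (hasDerivAt_outerLog (hlt η hη)).differentiableAt.differentiableWithinAt)
    (fun η _ => by
      have : outerLog a (η + 2 * Real.pi * I) - outerLog a η = ((2 * Real.pi : ℝ) : ℂ) * I := by
        rw [outerLog_periodic]; push_cast; ring
      rw [this, norm_mul, Complex.norm_I, mul_one, Complex.norm_real,
        Real.norm_of_nonneg Real.two_pi_pos.le])
    differentiable_exp.differentiableOn (exp_injOn_stripCell _ _)
    (by
      intro ζ hζ
      have h := hζ.1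
      simp only [mem_ofPred_eq, Complex.norm_exp]
      exact ⟨(Real.log_lt_iff_lt_exp hT0).1 h.1, (Real.lt_log_iff_exp_lt hT0').1 h.2⟩)
    (fun η hη => by
      rw [(hasDerivAt_outerLog (hlt η hη)).deriv, Complex.deriv_exp, poleDensity]
      have e1 : exp η - a = exp η * outerRoot a η ^ 2 := by
        rw [outerRoot_sq (hlt η hη), mul_sub, mul_one, mul_left_comm, ← Complex.exp_add,
          add_neg_cancel, Complex.exp_zero, mul_one]
      rw [e1, norm_mul, norm_pow, norm_div, norm_one]
      have n1 := norm_pos_iff.2 (exp_ne_zero η)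
      have n2 : 0 < ‖outerRoot a η‖ := norm_pos_iff.2 (outerRoot_ne_zero a η)
      apply le_of_eq
      field_simp)
  rwa [← Real.log_div hT0'.ne' hT0.ne'] at hmain

/-- The crude bound is taken on a larger disk of radius `T'` and the lower bound for `T < |z| < T'`
subtracted. What remains is `2π log (4T / |a| + 3T / T')`, whose error disappears as `T' → ∞`. -/
theorem lintegral_poleDensity_le {a : ℂ} (ha : a ≠ 0) {T : ℝ} (hT : ‖a‖ ≤ T) :
    ∫⁻ z in ball 0 T, ENNReal.ofReal (poleDensity a z)
      ≤ ENNReal.ofReal (2 * Real.pi * Real.log (4 * T / ‖a‖)) := by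
  have hap : 0 < ‖a‖ := norm_pos_iff.2 ha
  have hT0 : 0 < T := hap.trans_le hT
  set X := ∫⁻ z in ball 0 T, ENNReal.ofReal (poleDensity a z) with hX
  have hXfin : X ≠ ⊤ := ne_top_of_le_ne_top ENNReal.ofReal_ne_top (lintegral_poleDensity_le_aux ha hT0)
  have hpi := Real.two_pi_pos
  have key : ∀ T' : ℝ, T < T' →
      X.toReal ≤ 2 * Real.pi * Real.log (4 * T / ‖a‖ + 3 * (T / T')) := by
    intro T' hTT'
    have hT0' : 0 < T' := hT0.trans hTT'
    have h1 : X + ENNReal.ofReal (2 * Real.pi * Real.log (T' / T))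
        ≤ ENNReal.ofReal (2 * Real.pi * Real.log (4 * T' / ‖a‖ + 3)) := by
      refine le_trans ?_ (lintegral_poleDensity_le_aux ha hT0')
      refine (add_le_add_right (lintegral_poleDensity_annulus_ge ha hT hTT') X).trans ?_
      have hm : MeasurableSet {z : ℂ | T < ‖z‖ ∧ ‖z‖ < T'} :=
        ((isOpen_lt continuous_const continuous_norm).inter
          (isOpen_lt continuous_norm continuous_const)).measurableSet
      rw [hX, ← lintegral_union hm]
      · refine lintegral_mono_set (union_subset (ball_subset_ball hTT'.le) ?_)
        intro z hz
        exact mem_ball_zero_iff.2 hz.2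
      · rw [Set.disjoint_left]
        intro z hz hz'
        exact absurd (mem_ball_zero_iff.1 hz) (not_lt.2 hz'.1.le)
    have hl1 : 0 ≤ Real.log (T' / T) := Real.log_nonneg (by rw [le_div_iff₀ hT0]; linarith)
    have hl2 : 0 ≤ Real.log (4 * T' / ‖a‖ + 3) := Real.log_nonneg (by
      have : 0 < 4 * T' / ‖a‖ := by positivity
      linarith)
    have h2 := ENNReal.toReal_mono ENNReal.ofReal_ne_top h1
    rw [ENNReal.toReal_add hXfin ENNReal.ofReal_ne_top, ENNReal.toReal_ofReal (by positivity),
      ENNReal.toReal_ofReal (by positivity)] at h2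
    have h3 : Real.log (4 * T / ‖a‖ + 3 * (T / T'))
        = Real.log (4 * T' / ‖a‖ + 3) - Real.log (T' / T) := by
      rw [← Real.log_div (by positivity) (by positivity)]
      congr 1
      field_simp
    rw [h3]
    linarith
  have hlim : Tendsto (fun T' : ℝ => 2 * Real.pi * Real.log (4 * T / ‖a‖ + 3 * (T / T'))) atTop
      (𝓝 (2 * Real.pi * Real.log (4 * T / ‖a‖))) := by
    refine Tendsto.const_mul _ (Tendsto.log ?_ (by positivity))
    have : Tendsto (fun T' : ℝ => 3 * (T / T')) atTop (𝓝 0) := by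
      simpa using (tendsto_const_nhds.div_atTop tendsto_id (a := T)).const_mul 3
    simpa using this.const_add (4 * T / ‖a‖)
  have hfinal : X.toReal ≤ 2 * Real.pi * Real.log (4 * T / ‖a‖) :=
    ge_of_tendsto hlim ((eventually_gt_atTop T).mono key)
  rw [← ENNReal.ofReal_toReal hXfin]
  exact ENNReal.ofReal_le_ofReal hfinal

/-- The length–area estimate behind the Grötzsch and Koebe distortion theorems. -/
theorem width_le_log {x₁ x₂ : ℝ} {Y u : ℂ → ℂ} (hY : DifferentiableOn ℂ Y (strip x₁ x₂))
    (hper : ∀ ζ ∈ strip x₁ x₂, 2 * Real.pi ≤ ‖Y (ζ + 2 * Real.pi * I) - Y ζ‖)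
    (hu : DifferentiableOn ℂ u (strip x₁ x₂)) (hi : InjOn u (stripCell x₁ x₂)) {a : ℂ}
    (ha : a ≠ 0) {T : ℝ} (hT : ‖a‖ ≤ T) (hW : MapsTo u (stripCell x₁ x₂) (ball 0 T))
    (hρ : ∀ ζ ∈ strip x₁ x₂, ‖deriv Y ζ‖ ^ 2 ≤ ‖deriv u ζ‖ ^ 2 * poleDensity a (u ζ)) :
    x₂ - x₁ ≤ Real.log (4 * T / ‖a‖) := by
  have h := (lengthArea hY hper hu hi hW hρ).trans (lintegral_poleDensity_le ha hT)
  have hap : 0 < ‖a‖ := norm_pos_iff.2 ha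
  have hl : 0 ≤ Real.log (4 * T / ‖a‖) := Real.log_nonneg (by
    rw [le_div_iff₀ hap]; linarith)
  rw [ENNReal.ofReal_le_ofReal_iff (by positivity)] at h
  exact le_of_mul_le_mul_left h Real.two_pi_pos

/-! ### Periods of logarithms -/

theorem eq_of_exp_eq_const {S : Set ℂ} (hS : IsOpen S) (hc : IsPreconnected S) {f : ℂ → ℂ}
    (hf : ContinuousOn f S) {c : ℂ} (h : ∀ z ∈ S, exp (f z) = c) {z w : ℂ} (hz : z ∈ S)
    (hw : w ∈ S) : f z = f w := by
  have hd := differentiableOn_of_exp_comp hS hf (differentiableOn_const c) h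
  refine hS.is_const_of_deriv_eq_zero hc hd (fun y hy => ?_) hz hw
  have h1 := (hd.differentiableAt (hS.mem_nhds hy)).hasDerivAt.cexp
  have h2 : HasDerivAt (fun x => exp (f x)) 0 y := by
    refine (hasDerivAt_const y c).congr_of_eventuallyEq ?_
    filter_upwards [hS.mem_nhds hy] with x hx using h x hx
  simpa [exp_ne_zero] using h1.unique h2

/-- Invariance of a set under translation by `2πi`. -/
def PeriodicSet (S : Set ℂ) : Prop := ∀ ζ ∈ S, ∀ n : ℤ, ζ + n * (2 * Real.pi * I) ∈ S

theorem PeriodicSet.add_mem {S : Set ℂ} (hS : PeriodicSet S) {ζ : ℂ} (hζ : ζ ∈ S) :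
    ζ + 2 * Real.pi * I ∈ S := by simpa using hS ζ hζ 1

theorem periodicSet_preimage_exp (A : Set ℂ) : PeriodicSet (exp ⁻¹' A) := by
  intro ζ hζ n
  rwa [mem_preimage, Complex.exp_periodic.int_mul n ζ]

theorem periodicSet_strip (x₁ x₂ : ℝ) : PeriodicSet (strip x₁ x₂) := by
  intro ζ hζ n
  simpa [strip] using hζ

theorem add_int_mul_period {S : Set ℂ} (hS : PeriodicSet S) {f : ℂ → ℂ} {c : ℂ}
    (h : ∀ ζ ∈ S, f (ζ + 2 * Real.pi * I) = f ζ + c) (n : ℤ) {ζ : ℂ} (hζ : ζ ∈ S) :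
    f (ζ + n * (2 * Real.pi * I)) = f ζ + n * c := by
  induction n using Int.induction_on with
  | zero => simp
  | succ n ih =>
    have h1 := h _ (hS ζ hζ n)
    rw [ih] at h1
    have : ζ + ((n : ℤ) + 1 : ℤ) * (2 * Real.pi * I)
        = ζ + (n : ℤ) * (2 * Real.pi * I) + 2 * Real.pi * I := by push_cast; ring
    rw [this, h1]
    push_cast; ring
  | pred n ih =>
    have h1 := h _ (hS ζ hζ (-(n : ℤ) - 1))
    have : ζ + (-(n : ℤ) - 1 : ℤ) * (2 * Real.pi * I) + 2 * Real.pi * I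
        = ζ + (-(n : ℤ) : ℤ) * (2 * Real.pi * I) := by push_cast; ring
    rw [this, ih] at h1
    push_cast at h1 ⊢
    linear_combination -h1

theorem exists_int_period {S : Set ℂ} (hS : IsOpen S) (hc : IsPreconnected S)
    (hp : PeriodicSet S) {L : ℂ → ℂ} (hL : ContinuousOn L S)
    (h : ∀ ζ ∈ S, exp (L (ζ + 2 * Real.pi * I)) = exp (L ζ)) :
    ∃ n : ℤ, ∀ ζ ∈ S, L (ζ + 2 * Real.pi * I) = L ζ + n * (2 * Real.pi * I) := by
  rcases S.eq_empty_or_nonempty with rfl | ⟨ζ₀, hζ₀⟩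
  · exact ⟨0, by simp⟩
  obtain ⟨n, hn⟩ := Complex.exp_eq_exp_iff_exists_int.1 (h ζ₀ hζ₀)
  refine ⟨n, fun ζ hζ => ?_⟩
  have := eq_of_exp_eq_const hS hc (f := fun ζ => L (ζ + 2 * Real.pi * I) - L ζ) (c := 1)
    ((hL.comp (by fun_prop) fun ζ hζ => hp.add_mem hζ).sub hL)
    (fun z hz => by rw [Complex.exp_sub, h z hz, div_self (exp_ne_zero _)]) hζ hζ₀
  rw [hn] at this
  linear_combination this

/-- A period map composed with its inverse has period one. -/
theorem int_period_mul_eq_one {P S : Set ℂ} (hP : P.Nonempty) (hS : PeriodicSet S)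
    {Λ Y : ℂ → ℂ} (hΛ : MapsTo Λ P S) {n l : ℤ}
    (hn : ∀ η ∈ P, Λ (η + 2 * Real.pi * I) = Λ η + n * (2 * Real.pi * I))
    (hl : ∀ ζ ∈ S, Y (ζ + 2 * Real.pi * I) = Y ζ + l * (2 * Real.pi * I))
    (h : ∀ η ∈ P, Y (Λ (η + 2 * Real.pi * I)) = Y (Λ η) + 2 * Real.pi * I) : n * l = 1 := by
  obtain ⟨η, hη⟩ := hP
  have h1 := h η hη
  rw [hn η hη, add_int_mul_period hS hl n (hΛ hη)] at h1
  have h2 : ((n * l : ℤ) : ℂ) * (2 * Real.pi * I) = 1 * (2 * Real.pi * I) := by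
    push_cast; linear_combination h1
  have h3 : (2 * Real.pi * I : ℂ) ≠ 0 := by simp [Real.pi_ne_zero]
  exact_mod_cast mul_right_cancel₀ h3 h2

theorem two_pi_le_norm_int_mul {l : ℤ} (hl : l ≠ 0) :
    2 * Real.pi ≤ ‖(l : ℂ) * (2 * Real.pi * I)‖ := by
  have h1 : (1 : ℝ) ≤ |(l : ℝ)| := by exact_mod_cast Int.one_le_abs hl
  have h2 : ‖(l : ℂ) * (2 * Real.pi * I)‖ = |(l : ℝ)| * (2 * Real.pi) := by
    simp [abs_of_pos Real.pi_pos]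
  rw [h2]
  nlinarith [Real.pi_pos]

/-! ### Winding numbers about a connected set -/

/-- The winding number about `b`, read as the period of `log (g - b)`, is locally constant in `b`.
If `b'` is closer to `b` than `g` comes along the period segment `σ`, the two logarithms differ
there by a constant plus the principal `log (1 - (b' - b) / (g - b))`, which is periodic. -/
theorem int_period_eq_of_near {S : Set ℂ} (hS : IsOpen S) (hc : Convex ℝ S)
    (hp : PeriodicSet S) {g : ℂ → ℂ} (hg : DifferentiableOn ℂ g S)
    (hgp : ∀ ζ, g (ζ + 2 * Real.pi * I) = g ζ) (hne : S.Nonempty) {b : ℂ}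
    (hb : ∀ ζ ∈ S, g ζ ≠ b) : ∃ ε > 0, ∀ b', dist b' b < ε → ∀ M M' : ℂ → ℂ,
      DifferentiableOn ℂ M S → DifferentiableOn ℂ M' S → (∀ ζ ∈ S, exp (M ζ) = g ζ - b) →
      (∀ ζ ∈ S, exp (M' ζ) = g ζ - b') → ∀ ζ ∈ S,
      M' (ζ + 2 * Real.pi * I) - M' ζ = M (ζ + 2 * Real.pi * I) - M ζ := by
  obtain ⟨ζ₀, hζ₀⟩ := hne
  set σ := segment ℝ ζ₀ (ζ₀ + 2 * Real.pi * I) with hσ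
  have hσS : σ ⊆ S := hc.segment_subset hζ₀ (hp.add_mem hζ₀)
  have hσc : IsCompact σ := by
    rw [hσ, segment_eq_image]
    exact isCompact_Icc.image (by fun_prop)
  obtain ⟨w, hw, hmin⟩ := hσc.exists_isMinOn ⟨ζ₀, left_mem_segment ℝ _ _⟩
    (f := fun ζ => ‖g ζ - b‖) ((hg.continuousOn.mono hσS).sub continuousOn_const).norm
  refine ⟨‖g w - b‖, norm_pos_iff.2 (sub_ne_zero.2 (hb w (hσS hw))), ?_⟩
  intro b' hb' M M' hM hM' hMe hMe' ζ hζ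
  set V : Set ℂ := {z ∈ S | dist b' b < ‖g z - b‖} with hV
  have hVo : IsOpen V := (hg.continuousOn.sub continuousOn_const).norm.isOpen_inter_preimage hS
    isOpen_Ioi
  have hσV : σ ⊆ V := fun z hz => ⟨hσS hz, hb'.trans_le (hmin hz)⟩
  set V₀ := connectedComponentIn V ζ₀ with hV₀
  have hσV₀ : σ ⊆ V₀ := (convex_segment _ _).isPreconnected.subset_connectedComponentIn
    (left_mem_segment ℝ _ _) hσV
  have hV₀V : V₀ ⊆ V := connectedComponentIn_subset _ _
  have hslit : ∀ z ∈ V, ‖(b' - b) / (g z - b)‖ < 1 := by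
    intro z hz
    rw [norm_div, div_lt_one (dist_nonneg.trans_lt hz.2), ← dist_eq_norm]
    exact hz.2
  have hconst := eq_of_exp_eq_const hVo.connectedComponentIn isPreconnected_connectedComponentIn
    (f := fun z => M' z - M z - log (1 - (b' - b) / (g z - b))) (c := 1)
    (by
      refine ContinuousOn.mono ?_ hV₀V
      refine ((hM'.continuousOn.mono fun z hz => hz.1).sub
        (hM.continuousOn.mono fun z hz => hz.1)).sub (ContinuousOn.clog ?_ fun z hz =>
          one_sub_mem_slitPlane (hslit z hz))
      refine continuousOn_const.sub (continuousOn_const.div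
        ((hg.continuousOn.mono fun z hz => hz.1).sub continuousOn_const) fun z hz => ?_)
      exact norm_pos_iff.1 (dist_nonneg.trans_lt hz.2))
    (fun z hz => by
      have hz' := hV₀V hz
      have h1 : g z - b ≠ 0 := norm_pos_iff.1 (dist_nonneg.trans_lt hz'.2)
      have h2 := slitPlane_ne_zero (one_sub_mem_slitPlane (hslit z hz'))
      rw [Complex.exp_sub, Complex.exp_sub, hMe z hz'.1, hMe' z hz'.1, exp_log h2]
      have h3 : 1 - (b' - b) / (g z - b) = (g z - b') / (g z - b) := by field_simp; ring
      rw [h3] at h2 ⊢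
      exact div_self h2)
    (hσV₀ (left_mem_segment ℝ _ _)) (hσV₀ (right_mem_segment ℝ _ _))
  simp only [hgp] at hconst
  have hper : ∀ {N : ℂ → ℂ} {c : ℂ}, DifferentiableOn ℂ N S → (∀ ζ ∈ S, exp (N ζ) = g ζ - c) →
      ∃ n : ℤ, ∀ ζ ∈ S, N (ζ + 2 * Real.pi * I) = N ζ + n * (2 * Real.pi * I) :=
    fun hN he => exists_int_period hS hc.isPreconnected hp hN.continuousOn
      fun ζ hζ => by rw [he _ (hp.add_mem hζ), he ζ hζ, hgp]
  obtain ⟨n, hn⟩ := hper hM hMe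
  obtain ⟨n', hn'⟩ := hper hM' hMe'
  have e1 := hn ζ₀ hζ₀
  have e2 := hn' ζ₀ hζ₀
  rw [hn ζ hζ, hn' ζ hζ]
  linear_combination e1 - e2 - hconst

/-- A periodic holomorphic map avoiding a connected set that contains `0` and `a` admits a periodic
square root of `1 - a / g`. -/
theorem exists_periodic_sqrt {S K : Set ℂ} (hS : IsOpen S) (hc : Convex ℝ S)
    (hp : PeriodicSet S) {g : ℂ → ℂ} (hg : DifferentiableOn ℂ g S)
    (hgp : ∀ ζ, g (ζ + 2 * Real.pi * I) = g ζ) (hK : IsPreconnected K)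
    (hgK : ∀ ζ ∈ S, g ζ ∉ K) {a : ℂ} (h0 : (0 : ℂ) ∈ K) (ha : a ∈ K) :
    ∃ q : ℂ → ℂ, DifferentiableOn ℂ q S ∧ (∀ ζ ∈ S, q (ζ + 2 * Real.pi * I) = q ζ) ∧
      ∀ ζ ∈ S, q ζ ^ 2 = 1 - a / g ζ := by
  rcases S.eq_empty_or_nonempty with rfl | hne
  · exact ⟨0, differentiableOn_empty, by simp, by simp⟩
  have hlog : ∀ b : ℂ, ∃ M : ℂ → ℂ, b ∈ K → DifferentiableOn ℂ M S ∧
      ∀ ζ ∈ S, exp (M ζ) = g ζ - b := by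
    intro b
    by_cases hb : b ∈ K
    · obtain ⟨M, h1, h2⟩ := exists_log_of_convex hS hc (hg.sub_const b)
        fun ζ hζ h => hgK ζ hζ (by rwa [sub_eq_zero.1 h])
      exact ⟨M, fun _ => ⟨h1, h2⟩⟩
    · exact ⟨0, fun h => absurd h hb⟩
  choose M hM using hlog
  -- Having equal winding numbers is a locally constant relation on `K`, so connectedness carries it
  -- from `0` to `a`. Then `M a - M 0` is periodic, and half of it can be exponentiated.
  have hrel := hK.induction₂ (fun b b' => ∀ ζ ∈ S,
      M b' (ζ + 2 * Real.pi * I) - M b' ζ = M b (ζ + 2 * Real.pi * I) - M b ζ)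
    (fun b hb => by
      obtain ⟨ε, hε, h⟩ := int_period_eq_of_near hS hc hp hg hgp hne
        (fun ζ hζ h => hgK ζ hζ (by rwa [h]))
      filter_upwards [self_mem_nhdsWithin, nhdsWithin_le_nhds (ball_mem_nhds b hε)] with b' hb' hd
      exact h b' hd _ _ (hM b hb).1 (hM b' hb').1 (hM b hb).2 (hM b' hb').2)
    (fun x y z _ _ _ h1 h2 ζ hζ => (h2 ζ hζ).trans (h1 ζ hζ))
    (fun x y _ _ h1 ζ hζ => (h1 ζ hζ).symm) h0 ha
  refine ⟨fun ζ => exp ((M a ζ - M 0 ζ) / 2),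
    (((hM a ha).1.sub (hM 0 h0).1).div_const 2).cexp, ?_, ?_⟩
  · intro ζ hζ
    have := hrel ζ hζ
    have h : M a (ζ + 2 * Real.pi * I) - M 0 (ζ + 2 * Real.pi * I) = M a ζ - M 0 ζ := by
      linear_combination this
    simp only [h]
  · intro ζ hζ
    have hg0 : g ζ ≠ 0 := fun h => hgK ζ hζ (by rwa [h])
    have h1 := (hM 0 h0).2 ζ hζ
    rw [sub_zero] at h1
    rw [← Complex.exp_nat_mul]
    have : ((2 : ℕ) : ℂ) * ((M a ζ - M 0 ζ) / 2) = M a ζ - M 0 ζ := by push_cast; ring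
    rw [this, Complex.exp_sub, (hM a ha).2 ζ hζ, h1, sub_div, div_self hg0]

/-- From `a = (1 - q²) g` follow `g - a = g q²` and `Y' = g' / (q g)`. Thus `Y` is the natural
coordinate of the quadratic differential with poles `0` and `a`, pulled back by `g`. -/
theorem norm_deriv_sq_eq_poleDensity {S : Set ℂ} (hS : IsOpen S) {a : ℂ} (ha : a ≠ 0)
    {g q Y : ℂ → ℂ} (hg : DifferentiableOn ℂ g S) (hg0 : ∀ ζ ∈ S, g ζ ≠ 0)
    (hga : ∀ ζ ∈ S, g ζ ≠ a) (hq : DifferentiableOn ℂ q S) (hq2 : ∀ ζ ∈ S, q ζ ^ 2 = 1 - a / g ζ)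
    (hY : DifferentiableOn ℂ Y S) (hYe : ∀ ζ ∈ S, exp (Y ζ) = (1 + q ζ) / (1 - q ζ)) {ζ : ℂ}
    (hζ : ζ ∈ S) : ‖deriv Y ζ‖ ^ 2 = ‖deriv g ζ‖ ^ 2 * poleDensity a (g ζ) := by
  have hn := hS.mem_nhds hζ
  have hgζ := hg0 ζ hζ
  have hq2ζ := hq2 ζ hζ
  have hag : a / g ζ ≠ 0 := div_ne_zero ha hgζ
  have h1 : 1 - q ζ ≠ 0 := by
    intro h; apply hag; linear_combination hq2ζ + (1 + q ζ) * h
  have h2 : 1 + q ζ ≠ 0 := by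
    intro h; apply hag; linear_combination hq2ζ + (1 - q ζ) * h
  have hq0 : q ζ ≠ 0 := by
    intro h
    rw [h] at hq2ζ
    apply hga ζ hζ
    have h3 : a / g ζ = 1 := by linear_combination hq2ζ
    rw [div_eq_one_iff_eq hgζ] at h3
    exact h3.symm
  have dg := (hg.differentiableAt hn).hasDerivAt
  have dq := (hq.differentiableAt hn).hasDerivAt
  have dY := (hY.differentiableAt hn).hasDerivAt
  have e1 : 2 * q ζ * deriv q ζ = a * deriv g ζ / g ζ ^ 2 := by
    have d1 : HasDerivAt (fun z => q z ^ 2) (2 * q ζ * deriv q ζ) ζ := by simpa using dq.fun_pow 2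
    have d2 : HasDerivAt (fun z => 1 - a / g z) (a * deriv g ζ / g ζ ^ 2) ζ := by
      have := ((hasDerivAt_const ζ a).fun_div dg hgζ).const_sub 1
      refine this.congr_deriv (by ring)
    refine d1.unique (d2.congr_of_eventuallyEq ?_)
    filter_upwards [hn] with z hz using hq2 z hz
  have e2 : (1 + q ζ) / (1 - q ζ) * deriv Y ζ = 2 * deriv q ζ / (1 - q ζ) ^ 2 := by
    have d1 := dY.cexp
    rw [hYe ζ hζ] at d1
    have d2 : HasDerivAt (fun z => (1 + q z) / (1 - q z)) (2 * deriv q ζ / (1 - q ζ) ^ 2) ζ := by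
      refine ((dq.const_add 1).fun_div (dq.const_sub 1) h1).congr_deriv ?_
      ring
    refine d1.unique (d2.congr_of_eventuallyEq ?_)
    filter_upwards [hn] with z hz using hYe z hz
  have e3 : a = (1 - q ζ ^ 2) * g ζ := by rw [hq2ζ]; field_simp; ring
  have e4 : deriv Y ζ = deriv g ζ / (q ζ * g ζ) := by
    have e5 : (1 - q ζ ^ 2) * deriv Y ζ = 2 * deriv q ζ := by
      field_simp at e2
      linear_combination e2
    have e6 : 2 * q ζ * deriv q ζ = (1 - q ζ ^ 2) * deriv g ζ / g ζ := by
      rw [e1, e3]; field_simp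
    have e7 : (1 - q ζ ^ 2) ≠ 0 := by
      have : (1 - q ζ ^ 2) = (1 - q ζ) * (1 + q ζ) := by ring
      rw [this]; exact mul_ne_zero h1 h2
    rw [eq_div_iff (mul_ne_zero hq0 hgζ)]
    apply mul_left_cancel₀ e7
    have e8 : (1 - q ζ ^ 2) * deriv g ζ = 2 * q ζ * deriv q ζ * g ζ := by
      rw [e6]; field_simp
    rw [e8]
    linear_combination (q ζ * g ζ) * e5
  have e9 : g ζ - a = g ζ * q ζ ^ 2 := by rw [e3]; ring
  rw [e4, poleDensity, e9, norm_div, norm_mul, norm_mul, norm_pow]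
  have n1 := norm_pos_iff.2 hgζ
  have n2 := norm_pos_iff.2 hq0
  field_simp

/-! ### Conformal maps of a disk minus a continuum onto an annulus -/

theorem isOpen_roundAnnulus (r : ℝ) : IsOpen (roundAnnulus r) :=
  (isOpen_lt continuous_const continuous_norm).inter (isOpen_lt continuous_norm continuous_const)

theorem convex_preimage_exp_annulus (r s : ℝ) : Convex ℝ (exp ⁻¹' {w : ℂ | r < ‖w‖ ∧ ‖w‖ < s}) := by
  have h : OrdConnected {x : ℝ | r < Real.exp x ∧ Real.exp x < s} := by
    refine ⟨fun x hx y hy z hz => ⟨?_, ?_⟩⟩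
    · exact hx.1.trans_le (Real.exp_le_exp.2 hz.1)
    · exact (Real.exp_le_exp.2 hz.2).trans_lt hy.2
  have := h.convex.linear_preimage (𝕜 := ℝ) reLm
  have he : exp ⁻¹' {w : ℂ | r < ‖w‖ ∧ ‖w‖ < s}
      = reLm ⁻¹' {x : ℝ | r < Real.exp x ∧ Real.exp x < s} := by
    ext z
    simp only [mem_preimage, mem_ofPred_eq, Complex.norm_exp]
    rfl
  rwa [he]

theorem strip_subset_preimage_roundAnnulus {r x : ℝ} (h : r ≤ Real.exp x) :
    strip x 0 ⊆ exp ⁻¹' roundAnnulus r := by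
  intro ζ hζ
  refine ⟨?_, ?_⟩
  · rw [Complex.norm_exp]
    exact h.trans_lt (Real.exp_lt_exp.2 hζ.1)
  · rw [Complex.norm_exp]
    exact Real.exp_zero ▸ Real.exp_lt_exp.2 hζ.2

theorem exp_mem_ball_diff {K : Set ℂ} {R : ℝ} (hR : 0 < R) (hKR : K ⊆ closedBall 0 R) {η : ℂ}
    (hη : η ∈ strip (Real.log R) 0) : exp η ∈ ball 0 1 \ K := by
  have h := strip_subset_preimage_roundAnnulus (r := R) (Real.exp_log hR).ge hη
  refine ⟨by simpa using h.2, fun h' => ?_⟩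
  have := hKR h'
  rw [mem_closedBall_zero_iff] at this
  exact absurd h.1 (not_lt.2 this)

/-- The lift of a map onto a round annulus to logarithmic coordinates near the unit circle. -/
theorem exists_annulus_lift {K : Set ℂ} {R : ℝ} (hR : 0 < R) (hKR : K ⊆ closedBall 0 R) {r : ℝ}
    (hr : 0 ≤ r) {φ : ℂ → ℂ} (hφ : IsConformalOnto φ (ball 0 1 \ K) (roundAnnulus r)) :
    ∃ (Λ : ℂ → ℂ) (n : ℤ), DifferentiableOn ℂ Λ (strip (Real.log R) 0) ∧
      (∀ η ∈ strip (Real.log R) 0, exp (Λ η) = φ (exp η)) ∧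
      MapsTo Λ (strip (Real.log R) 0) (exp ⁻¹' roundAnnulus r) ∧
      ∀ η ∈ strip (Real.log R) 0, Λ (η + 2 * Real.pi * I) = Λ η + n * (2 * Real.pi * I) := by
  have hm : MapsTo exp (strip (Real.log R) 0) (ball 0 1 \ K) :=
    fun η hη => exp_mem_ball_diff hR hKR hη
  have hφm : ∀ η ∈ strip (Real.log R) 0, φ (exp η) ∈ roundAnnulus r :=
    fun η hη => hφ.2.mapsTo (hm hη)
  obtain ⟨Λ, hΛ, hΛe⟩ := exists_log_of_convex (isOpen_strip (Real.log R) 0) (convex_strip _ _)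
    (hφ.1.comp differentiable_exp.differentiableOn hm)
    (fun η hη => norm_pos_iff.1 (hr.trans_lt (hφm η hη).1))
  obtain ⟨n, hn⟩ := exists_int_period (isOpen_strip (Real.log R) 0)
    (convex_strip _ _).isPreconnected (periodicSet_strip _ _) hΛ.continuousOn
    (fun η hη => by
      rw [hΛe _ ((periodicSet_strip _ _).add_mem hη), hΛe _ hη]
      simp only [Function.comp, Complex.exp_periodic η])
  refine ⟨Λ, n, hΛ, hΛe, fun η hη => ?_, hn⟩
  rw [mem_preimage, hΛe η hη]
  exact hφm η hη

/-- Length–area with `T = 1` on the strips `x < Re ζ < 0` for `r ≤ e^x` gives `-x ≤ log (4 / ‖a‖)`;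
then `e^x` decreases to `r`. Stopping at `x` instead of `log r` lets `r = 0` be included, which is
what rules out the degenerate annulus later. -/
theorem norm_le_four_mul {K : Set ℂ} (hK : IsPreconnected K) (hKc : IsClosed K)
    (h0 : (0 : ℂ) ∈ K) {a : ℂ} (ha : a ∈ K) (ha0 : a ≠ 0) (hKR : K ⊆ closedBall 0 ‖a‖)
    (ha1 : ‖a‖ < 1) {r : ℝ} (hr : 0 ≤ r) {φ : ℂ → ℂ}
    (hφ : IsConformalOnto φ (ball 0 1 \ K) (roundAnnulus r)) : ‖a‖ ≤ 4 * r := by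
  have hR : 0 < ‖a‖ := norm_pos_iff.2 ha0
  obtain ⟨Λ, n, hΛ, hΛe, hΛm, hn⟩ := exists_annulus_lift hR hKR hr hφ
  obtain ⟨ψ, hψ, hψφ, -⟩ := exists_holomorphic_inverse (isOpen_ball.sdiff hKc) hφ
  set P := strip (Real.log ‖a‖) 0 with hP
  set S := exp ⁻¹' roundAnnulus r with hS
  have hPo : IsOpen P := isOpen_strip _ _
  have hPp : PeriodicSet P := periodicSet_strip _ _
  have hSo : IsOpen S := (isOpen_roundAnnulus r).preimage continuous_exp
  have hSc : Convex ℝ S := convex_preimage_exp_annulus r 1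
  have hSp : PeriodicSet S := periodicSet_preimage_exp _
  set g : ℂ → ℂ := fun ζ => ψ (exp ζ) with hg
  have hgd : DifferentiableOn ℂ g S :=
    hψ.1.comp differentiable_exp.differentiableOn fun ζ hζ => hζ
  have hgp : ∀ ζ, g (ζ + 2 * Real.pi * I) = g ζ := fun ζ => by
    simp only [hg, Complex.exp_periodic ζ]
  have hgA : ∀ ζ ∈ S, g ζ ∈ ball 0 1 \ K := fun ζ hζ => hψ.2.mapsTo hζ
  have hg0 : ∀ ζ ∈ S, g ζ ≠ 0 := fun ζ hζ h => (hgA ζ hζ).2 (by rwa [h])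
  have hga : ∀ ζ ∈ S, g ζ ≠ a := fun ζ hζ h => (hgA ζ hζ).2 (by rwa [h])
  have hgΛ : ∀ η ∈ P, g (Λ η) = exp η := fun η hη => by
    simp only [hg, hΛe η hη, hψφ _ (exp_mem_ball_diff hR hKR hη)]
  have hsm : ∀ η ∈ P, ‖a * exp (-η)‖ < 1 := fun η hη => norm_mul_exp_neg_lt_one le_rfl hR hη.1
  obtain ⟨q, hqd, hqp, hq2, hqΛ⟩ : ∃ q : ℂ → ℂ, DifferentiableOn ℂ q S ∧
      (∀ ζ ∈ S, q (ζ + 2 * Real.pi * I) = q ζ) ∧ (∀ ζ ∈ S, q ζ ^ 2 = 1 - a / g ζ) ∧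
      ∀ η ∈ P, q (Λ η) = outerRoot a η := by
    obtain ⟨q, hqd, hqp, hq2⟩ := exists_periodic_sqrt hSo hSc hSp hgd hgp hK
      (fun ζ hζ => (hgA ζ hζ).2) h0 ha
    -- Two continuous roots of one nonvanishing function on a connected strip agree up to a global
    -- sign, which is absorbed into `q`.
    have key := (convex_strip (Real.log ‖a‖) 0).isPreconnected.eq_or_eq_neg_of_sq_eq
      (f := fun η => q (Λ η)) (g := outerRoot a)
      (hqd.continuousOn.comp hΛ.continuousOn hΛm)
      (fun η hη => (hasDerivAt_outerRoot (hsm η hη)).continuousAt.continuousWithinAt)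
      (fun η hη => by
        simp only [Pi.pow_apply]
        rw [outerRoot_sq (hsm η hη), hq2 _ (hΛm hη), hgΛ η hη, Complex.exp_neg, div_eq_mul_inv])
      (fun _ => outerRoot_ne_zero _ _)
    rcases key with h | h
    · exact ⟨q, hqd, hqp, hq2, h⟩
    · refine ⟨fun ζ => -q ζ, hqd.neg, fun ζ hζ => by simp only [hqp ζ hζ], fun ζ hζ => ?_,
        fun η hη => ?_⟩
      · rw [neg_sq, hq2 ζ hζ]
      · have := h hη
        simp only [Pi.neg_apply] at this
        simp only [this, neg_neg]
  have hag : ∀ ζ ∈ S, a / g ζ ≠ 0 := fun ζ hζ => div_ne_zero ha0 (hg0 ζ hζ)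
  have hq1 : ∀ ζ ∈ S, 1 - q ζ ≠ 0 := fun ζ hζ h =>
    hag ζ hζ (by linear_combination hq2 ζ hζ + (1 + q ζ) * h)
  have hq1' : ∀ ζ ∈ S, 1 + q ζ ≠ 0 := fun ζ hζ h =>
    hag ζ hζ (by linear_combination hq2 ζ hζ + (1 - q ζ) * h)
  obtain ⟨Y, hY, hYe⟩ := exists_log_of_convex hSo hSc
    (f := fun ζ => (1 + q ζ) / (1 - q ζ))
    ((hqd.const_add 1).div (hqd.const_sub 1) hq1)
    (fun ζ hζ => div_ne_zero (hq1' ζ hζ) (hq1 ζ hζ))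
  obtain ⟨l, hl⟩ := exists_int_period hSo hSc.isPreconnected hSp hY.continuousOn
    (fun ζ hζ => by rw [hYe _ (hSp.add_mem hζ), hYe ζ hζ, hqp ζ hζ])
  have hPne : P.Nonempty := by
    refine ⟨((Real.log ‖a‖ / 2 : ℝ) : ℂ), ?_⟩
    have := Real.log_neg hR ha1
    constructor <;> rw [ofReal_re] <;> linarith
  -- Near the unit circle `Y ∘ Λ` is `outerLog a` plus a constant, because the exponentials have
  -- quotient `1 / a`. Its period is therefore exactly `2πi`, which forces the period `l` of `Y` to
  -- be nonzero.
  have hYΛ : ∀ η ∈ P, Y (Λ (η + 2 * Real.pi * I)) = Y (Λ η) + 2 * Real.pi * I := by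
    intro η hη
    have := eq_of_exp_eq_const hPo (convex_strip (Real.log ‖a‖) 0).isPreconnected
      (f := fun η => Y (Λ η) - outerLog a η) (c := 1 / a)
      ((hY.continuousOn.comp hΛ.continuousOn hΛm).sub fun η hη =>
        (hasDerivAt_outerLog (hsm η hη)).continuousAt.continuousWithinAt)
      (fun η hη => by
        have h1 := slitPlane_ne_zero (one_add_outerRoot_mem_slitPlane (hsm η hη))
        have h2 := hq1 _ (hΛm hη)
        have h3 := outerRoot_sq (hsm η hη)
        rw [hqΛ η hη] at h2
        rw [Complex.exp_sub, hYe _ (hΛm hη), hqΛ η hη, outerLog, Complex.exp_add,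
          two_mul (log _), Complex.exp_add, exp_log h1]
        rw [Complex.exp_neg] at h3
        have h4 := exp_ne_zero η
        field_simp at h3 ⊢
        linear_combination h3)
      (hPp.add_mem hη) hη
    rw [outerLog_periodic] at this
    linear_combination this
  have hnl := int_period_mul_eq_one hPne hSp hΛm hn hl hYΛ
  have hl0 : l ≠ 0 := by rintro rfl; simp at hnl
  have key : ∀ x : ℝ, r ≤ Real.exp x → ‖a‖ ≤ 4 * Real.exp x := by
    intro x hx
    have hsub := strip_subset_preimage_roundAnnulus hx
    have hw := width_le_log (x₁ := x) (x₂ := 0) (hY.mono hsub)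
      (fun ζ hζ => by
        rw [hl ζ (hsub hζ), add_sub_cancel_left]
        exact two_pi_le_norm_int_mul hl0)
      (hgd.mono hsub)
      (fun ζ hζ ζ' hζ' h => exp_injOn_stripCell x 0 hζ hζ'
        (hψ.2.injOn (hsub (stripCell_subset _ _ hζ)) (hsub (stripCell_subset _ _ hζ')) h))
      ha0 ha1.le (fun ζ hζ => (hgA ζ (hsub (stripCell_subset _ _ hζ))).1)
      (fun ζ hζ => (norm_deriv_sq_eq_poleDensity hSo ha0 hgd hg0 hga hqd hq2 hY hYe
        (hsub hζ)).le)
    rw [Real.le_log_iff_exp_le (by positivity), zero_sub, Real.exp_neg, le_div_iff₀ hR] at hw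
    have hx0 := Real.exp_pos x
    rwa [inv_mul_le_iff₀ hx0, mul_one, mul_comm] at hw
  refine le_of_forall_gt_imp_ge_of_dense fun c hc => ?_
  have hc0 : 0 < c / 4 := by linarith
  have := key (Real.log (c / 4)) (by rw [Real.exp_log hc0]; linarith)
  rw [Real.exp_log hc0] at this
  linarith

/-- Length–area in the other direction: `φ` embeds the collar `R < |z| < 1` in an annulus of
logarithmic area `2π log (1 / r)`. The coordinate is the logarithm `Λ` of `φ`; its period is nonzero
because a logarithm of `φ⁻¹` undoes it. -/
theorem le_of_conformal_roundAnnulus {K : Set ℂ} (hKc : IsClosed K)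
    (h0 : (0 : ℂ) ∈ K) {R : ℝ} (hR : 0 < R) (hKR : K ⊆ closedBall 0 R)
    (hR1 : R < 1) {r : ℝ} (hr : 0 < r) {φ : ℂ → ℂ}
    (hφ : IsConformalOnto φ (ball 0 1 \ K) (roundAnnulus r)) : r ≤ R := by
  obtain ⟨Λ, n, hΛ, hΛe, hΛm, hn⟩ := exists_annulus_lift hR hKR hr.le hφ
  obtain ⟨ψ, hψ, hψφ, -⟩ := exists_holomorphic_inverse (isOpen_ball.sdiff hKc) hφ
  set P := strip (Real.log R) 0 with hP
  set S := exp ⁻¹' roundAnnulus r with hS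
  have hPo : IsOpen P := isOpen_strip _ _
  have hPp : PeriodicSet P := periodicSet_strip _ _
  have hSo : IsOpen S := (isOpen_roundAnnulus r).preimage continuous_exp
  have hSc : Convex ℝ S := convex_preimage_exp_annulus r 1
  have hSp : PeriodicSet S := periodicSet_preimage_exp _
  have hm : MapsTo exp P (ball 0 1 \ K) := fun η hη => exp_mem_ball_diff hR hKR hη
  have hg0 : ∀ ζ ∈ S, ψ (exp ζ) ≠ 0 := fun ζ hζ h => (hψ.2.mapsTo hζ).2 (by rwa [h])
  obtain ⟨Y, hY, hYe⟩ := exists_log_of_convex hSo hSc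
    (hψ.1.comp differentiable_exp.differentiableOn fun ζ hζ => hζ) hg0
  obtain ⟨l, hl⟩ := exists_int_period hSo hSc.isPreconnected hSp hY.continuousOn
    (fun ζ hζ => by
      rw [hYe _ (hSp.add_mem hζ), hYe ζ hζ]
      simp only [Function.comp, Complex.exp_periodic ζ])
  have hlog : Real.log R < 0 := Real.log_neg hR hR1
  have hPne : P.Nonempty := by
    refine ⟨((Real.log R / 2 : ℝ) : ℂ), ?_⟩
    constructor <;> rw [ofReal_re] <;> linarith
  have hYΛ : ∀ η ∈ P, Y (Λ (η + 2 * Real.pi * I)) = Y (Λ η) + 2 * Real.pi * I := by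
    intro η hη
    have := eq_of_exp_eq_const hPo (convex_strip (Real.log R) 0).isPreconnected
      (f := fun η => Y (Λ η) - η) (c := 1)
      ((hY.continuousOn.comp hΛ.continuousOn hΛm).sub continuousOn_id)
      (fun η hη => by
        rw [Complex.exp_sub, hYe _ (hΛm hη), Function.comp, hΛe η hη, hψφ _ (hm hη),
          div_self (exp_ne_zero _)])
      (hPp.add_mem hη) hη
    linear_combination this
  have hnl := int_period_mul_eq_one hPne hSp hΛm hn hl hYΛ
  have hn0 : n ≠ 0 := by rintro rfl; simp at hnl
  have hud : DifferentiableOn ℂ (fun η => φ (exp η)) P :=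
    hφ.1.comp differentiable_exp.differentiableOn hm
  have h := lengthArea hΛ
      (fun ζ hζ => by
        rw [hn ζ hζ, add_sub_cancel_left]
        exact two_pi_le_norm_int_mul hn0)
      hud
      (fun ζ hζ ζ' hζ' h => exp_injOn_stripCell _ 0 hζ hζ'
        (hφ.2.injOn (hm (stripCell_subset _ _ hζ)) (hm (stripCell_subset _ _ hζ')) h))
      (W := roundAnnulus r) (fun ζ hζ => hφ.2.mapsTo (hm (stripCell_subset _ _ hζ)))
      (ρ := fun w => (‖w‖ ^ 2)⁻¹)
      (fun ζ hζ => by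
        have hz := hPo.mem_nhds hζ
        have d1 := (hΛ.differentiableAt hz).hasDerivAt.cexp
        have d2 := (hud.differentiableAt hz).hasDerivAt
        have d3 := d1.unique (d2.congr_of_eventuallyEq (by
          filter_upwards [hz] with z hz using hΛe z hz))
        rw [← d3, ← hΛe ζ hζ, norm_mul, mul_pow]
        have := norm_pos_iff.2 (exp_ne_zero (Λ ζ))
        field_simp
        exact le_rfl)
  rw [roundAnnulus, lintegral_annulus_inv_sq hr one_pos,
    ENNReal.ofReal_le_ofReal_iff' ] at h
  have hpi := Real.pi_pos
  rw [one_div, Real.log_inv] at h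
  rcases h with h | h
  · have h1 : Real.log r ≤ Real.log R := by nlinarith
    exact (Real.log_le_log_iff hr hR).1 h1
  · nlinarith

/-! ### Distortion at the centre of a simply connected domain -/

/-- Koebe's quarter theorem. With `f = φ⁻¹`, `f w = w g w` and `q² = 1 - f / p`, one has `(1 + q) /
(1 - q) = (1 + q)² p / (w g w)`, so in the coordinate `w = e^ζ` its logarithm is `-ζ` plus a
periodic function. For `c' < c⁻¹` and small `ε`, `1 / f` maps `ε < |w| < 1` into the disk of radius
`1 / (ε c')`. The width bound reads `1 / ε ≤ 4‖p‖ / (ε c')`, and `ε` cancels. -/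
theorem inv_deriv_le_four_mul {D : Set ℂ} (hD : IsOpen D) {φ : ℂ → ℂ}
    (hφ : IsConformalOnto φ D (ball 0 1)) (h0 : (0 : ℂ) ∈ D) (hφ0 : φ 0 = 0) {c : ℝ} (hc : 0 < c)
    (hφc : HasDerivAt φ (c : ℂ) 0) {p : ℂ} (hp : p ∉ D) : c⁻¹ ≤ 4 * ‖p‖ := by
  obtain ⟨f, hf, hfφ, hφf⟩ := exists_holomorphic_inverse hD hφ
  have hp0 : p ≠ 0 := fun h => hp (by rwa [h])
  have hf0 : f 0 = 0 := by simpa [hφ0] using hfφ 0 h0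
  have hz0 : (0 : ℂ) ∈ ball (0 : ℂ) 1 := mem_ball_self one_pos
  have hfp : ∀ w ∈ ball (0 : ℂ) 1, f w ≠ p := fun w hw h => hp (h ▸ hf.2.mapsTo hw)
  have hfne : ∀ w ∈ ball (0 : ℂ) 1, w ≠ 0 → f w ≠ 0 := fun w hw hw0 h =>
    hw0 (hf.2.injOn hw hz0 (h.trans hf0.symm))
  obtain ⟨q, hqd, hq0, hq2⟩ : ∃ q : ℂ → ℂ, DifferentiableOn ℂ q (ball 0 1) ∧ q 0 = 1 ∧
      ∀ w ∈ ball (0 : ℂ) 1, q w ^ 2 = 1 - f w / p := by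
    obtain ⟨L, hL, hLe⟩ := exists_log_of_convex isOpen_ball (convex_ball (0 : ℂ) 1)
      ((hf.1.div_const p).const_sub 1)
      (fun w hw h => hfp w hw (by
        have : f w / p = 1 := by linear_combination -h
        rwa [div_eq_one_iff_eq hp0] at this))
    refine ⟨fun w => exp ((L w - L 0) / 2), ((hL.sub_const _).div_const 2).cexp, by simp,
      fun w hw => ?_⟩
    rw [← Complex.exp_nat_mul]
    have : ((2 : ℕ) : ℂ) * ((L w - L 0) / 2) = L w - L 0 := by push_cast; ring
    rw [this, Complex.exp_sub, hLe w hw, hLe 0 hz0]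
    simp [hf0]
  have hqm : ∀ w ∈ ball (0 : ℂ) 1, w ≠ 0 → f w / p ≠ 0 :=
    fun w hw hw0 => div_ne_zero (hfne w hw hw0) hp0
  have hq1 : ∀ w ∈ ball (0 : ℂ) 1, w ≠ 0 → 1 - q w ≠ 0 := fun w hw hw0 h =>
    hqm w hw hw0 (by linear_combination hq2 w hw + (1 + q w) * h)
  have hq1' : ∀ w ∈ ball (0 : ℂ) 1, 1 + q w ≠ 0 := by
    intro w hw h
    rcases eq_or_ne w 0 with rfl | hw0
    · rw [hq0] at h; norm_num at h
    · exact hqm w hw hw0 (by linear_combination hq2 w hw + (1 - q w) * h)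
  set g := dslope f 0 with hg
  have hgd : DifferentiableOn ℂ g (ball 0 1) :=
    (differentiableOn_dslope (ball_mem_nhds 0 one_pos)).2 hf.1
  have hgw : ∀ w, w * g w = f w := fun w => by
    have := sub_smul_dslope f 0 w
    simpa [hf0] using this
  have hg0 : ∀ w ∈ ball (0 : ℂ) 1, g w ≠ 0 := by
    intro w hw h
    rcases eq_or_ne w 0 with rfl | hw0
    · rw [hg, dslope_same] at h
      exact deriv_ne_zero_of_injOn isOpen_ball hf.1 hf.2.injOn hz0 h
    · exact hfne w hw hw0 (by rw [← hgw, h, mul_zero])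
  obtain ⟨l, hl, hle⟩ := exists_log_of_convex isOpen_ball (convex_ball (0 : ℂ) 1)
    (f := fun w => (1 + q w) ^ 2 * p / g w)
    ((((hqd.const_add 1).fun_pow 2).mul_const p).fun_div hgd hg0)
    (fun w hw => div_ne_zero (mul_ne_zero (pow_ne_zero 2 (hq1' w hw)) hp0) (hg0 w hw))
  refine le_of_forall_lt_imp_le_of_dense fun c' hc' => ?_
  rcases le_or_gt c' 0 with hc0 | hc0
  · exact hc0.trans (by positivity)
  have hcc : c < c'⁻¹ := (lt_inv_comm₀ hc hc0).2 hc'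
  obtain ⟨s, hs, hsφ⟩ : ∃ s > 0, ∀ z, ‖z‖ < s → ‖φ z‖ ≤ c'⁻¹ * ‖z‖ := by
    have h1 := (hasDerivAt_iff_tendsto_slope.1 hφc).norm.eventually_lt_const
      (u := c'⁻¹) (by rwa [Complex.norm_real, Real.norm_of_nonneg hc.le])
    obtain ⟨s, hs, h⟩ := Metric.mem_nhdsWithin_iff.1 h1
    refine ⟨s, hs, fun z hz => ?_⟩
    rcases eq_or_ne z 0 with rfl | hz0
    · simp [hφ0]
    · have h2 : ‖slope φ 0 z‖ < c'⁻¹ := h ⟨mem_ball_zero_iff.2 hz, hz0⟩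
      rw [slope_def_field, hφ0, sub_zero, sub_zero, norm_div,
        div_lt_iff₀ (norm_pos_iff.2 hz0)] at h2
      exact h2.le
  have hpn : 0 < ‖p‖ := norm_pos_iff.2 hp0
  -- `ε c' < s` keeps points inside the disk where the slope bound on `φ` holds; `ε c' ≤ ‖p‖` makes
  -- the pole `p⁻¹` satisfy `‖p⁻¹‖ ≤ T`.
  obtain ⟨ε, hε, hε'⟩ : ∃ ε : ℝ, 0 < ε ∧ (ε < 1 ∧ ε * c' < s ∧ ε * c' ≤ ‖p‖) := by
    refine ⟨min (1 / 2) (min (s / (2 * c')) (‖p‖ / c')), by positivity, ?_, ?_, ?_⟩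
    · exact (min_le_left _ _).trans_lt (by norm_num)
    · calc _ ≤ s / (2 * c') * c' := by
            gcongr; exact (min_le_right _ _).trans (min_le_left _ _)
        _ < s := by field_simp; norm_num
    · calc _ ≤ ‖p‖ / c' * c' := by
            gcongr; exact (min_le_right _ _).trans (min_le_right _ _)
        _ = ‖p‖ := by field_simp
  obtain ⟨hε1, hεs, hεp⟩ := hε'
  set P := strip (Real.log ε) 0 with hP
  have hPo : IsOpen P := isOpen_strip _ _
  have hPm : ∀ ζ ∈ P, ε < ‖exp ζ‖ ∧ ‖exp ζ‖ < 1 := fun ζ hζ =>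
    strip_subset_preimage_roundAnnulus (Real.exp_log hε).ge hζ
  have hPb : MapsTo exp P (ball 0 1) := fun ζ hζ => mem_ball_zero_iff.2 (hPm ζ hζ).2
  have hfe : ∀ ζ ∈ P, f (exp ζ) ≠ 0 := fun ζ hζ => hfne _ (hPb hζ) (exp_ne_zero ζ)
  have hfl : ∀ ζ ∈ P, ε * c' < ‖f (exp ζ)‖ := by
    intro ζ hζ
    by_contra! hcon
    have h1 := hsφ _ (hcon.trans_lt hεs)
    rw [hφf _ (hPb hζ)] at h1
    have h2 : c'⁻¹ * ‖f (exp ζ)‖ ≤ ε := by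
      rw [inv_mul_le_iff₀ hc0]; linarith
    linarith [(hPm ζ hζ).1]
  have hed : DifferentiableOn ℂ exp P := differentiable_exp.differentiableOn
  have hud : DifferentiableOn ℂ (fun ζ => (f (exp ζ))⁻¹) P :=
    (hf.1.comp hed hPb).fun_inv hfe
  have hYd : DifferentiableOn ℂ (fun ζ => -ζ + l (exp ζ)) P :=
    differentiableOn_id.neg.add (hl.comp hed hPb)
  have hw := width_le_log (x₁ := Real.log ε) (x₂ := 0) hYd
    (fun ζ hζ => by
      simp only [Complex.exp_periodic ζ]
      have : -(ζ + 2 * Real.pi * I) + l (exp ζ) - (-ζ + l (exp ζ))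
        = ((-1 : ℤ) : ℂ) * (2 * Real.pi * I) := by push_cast; ring
      rw [this]
      exact two_pi_le_norm_int_mul (by norm_num))
    hud
    (fun ζ hζ ζ' hζ' h => exp_injOn_stripCell _ 0 hζ hζ' (hf.2.injOn
      (hPb (stripCell_subset _ _ hζ)) (hPb (stripCell_subset _ _ hζ')) (inv_injective h)))
    (a := p⁻¹) (inv_ne_zero hp0) (T := (ε * c')⁻¹)
    (by rw [norm_inv]; exact inv_anti₀ (by positivity) hεp)
    (fun ζ hζ => by
      rw [mem_ball_zero_iff, norm_inv]
      exact inv_strictAnti₀ (by positivity) (hfl ζ (stripCell_subset _ _ hζ)))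
    (fun ζ hζ => (norm_deriv_sq_eq_poleDensity hPo (inv_ne_zero hp0) hud
      (fun ζ hζ => inv_ne_zero (hfe ζ hζ))
      (fun ζ hζ h => hfp _ (hPb hζ) (inv_injective h))
      (q := fun ζ => q (exp ζ)) (hqd.comp hed hPb)
      (fun ζ hζ => by rw [hq2 _ (hPb hζ), div_inv_eq_mul, inv_mul_eq_div]) hYd
      (fun ζ hζ => by
        have h1 := hq1 _ (hPb hζ) (exp_ne_zero ζ)
        have h2 := hfe ζ hζ
        have h3 := hg0 _ (hPb hζ)
        have h4 := hq2 _ (hPb hζ)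
        have h5 := hgw (exp ζ)
        have h6 := exp_ne_zero ζ
        rw [Complex.exp_add, hle _ (hPb hζ), Complex.exp_neg]
        rw [← h5] at h4
        field_simp at h4 ⊢
        linear_combination (-(1 + q (exp ζ))) * h4) hζ).le)
  rw [norm_inv, Real.le_log_iff_exp_le (by positivity), zero_sub, Real.exp_neg,
    Real.exp_log hε] at hw
  have h7 : 4 * (ε * c')⁻¹ / ‖p‖⁻¹ = 4 * ‖p‖ / c' * ε⁻¹ := by field_simp
  rw [h7, le_mul_iff_one_le_left (by positivity), one_le_div hc0] at hw
  exact hw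

theorem le_inv_deriv {D : Set ℂ} {φ : ℂ → ℂ}
    (hφ : IsConformalOnto φ D (ball 0 1)) (hφ0 : φ 0 = 0) {c : ℝ} (hc : 0 < c)
    (hφc : HasDerivAt φ (c : ℂ) 0) {s : ℝ} (hs : 0 < s) (hD : ball 0 s ⊆ D) : s ≤ c⁻¹ := by
  have := norm_deriv_le_div_of_mapsTo_ball (f := φ) (c := 0) (R₁ := s) (R₂ := 1) (hφ.1.mono hD)
    (fun z hz => by
      rw [hφ0]; exact ball_subset_closedBall (x := (0 : ℂ)) (hφ.2.mapsTo (hD hz))) hs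
  rw [hφc.deriv, Complex.norm_real, Real.norm_of_nonneg hc.le] at this
  rw [le_inv_comm₀ hs hc]
  simpa using this

/-! ### Complementary components of a plane continuum -/

theorem connectedComponentIn_subset_of_mem_closure {U : Set ℂ} (hU : IsOpen U) {w x : ℂ}
    (hx : x ∈ U) (hxw : x ∈ closure (connectedComponentIn U w)) :
    x ∈ connectedComponentIn U w := by
  have ho : IsOpen (connectedComponentIn U x) := hU.connectedComponentIn
  obtain ⟨y, hy1, hy2⟩ := mem_closure_iff.1 hxw _ ho (mem_connectedComponentIn hx)
  rw [connectedComponentIn_eq hy2, ← connectedComponentIn_eq hy1]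
  exact mem_connectedComponentIn hx

/-- A nonempty continuum together with some of its complementary components is connected. -/
theorem isPreconnected_of_union_components {C X : Set ℂ} (hCc : IsClosed C)
    (hC : IsPreconnected C) (hne : C.Nonempty) (hCX : C ⊆ X)
    (hX : ∀ w ∈ X, w ∉ C → connectedComponentIn Cᶜ w ⊆ X) : IsPreconnected X := by
  obtain ⟨c, hc⟩ := hne
  refine isPreconnected_of_forall c fun w hw => ?_
  by_cases hwC : w ∈ C
  · exact ⟨C, hCX, hc, hwC, hC⟩
  set V := connectedComponentIn Cᶜ w with hV
  have hwV : w ∈ V := mem_connectedComponentIn hwC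
  have hVo : IsOpen V := hCc.isOpen_compl.connectedComponentIn
  have hVc : closure V ⊆ C ∪ V := fun x hx => by
    by_cases hxC : x ∈ C
    · exact Or.inl hxC
    · exact Or.inr (connectedComponentIn_subset_of_mem_closure hCc.isOpen_compl hxC hx)
  -- A component whose closure missed `C` would be clopen, hence the whole plane.
  have hmeet : (closure V ∩ C).Nonempty := by
    by_contra hcon
    rw [not_nonempty_iff_eq_empty] at hcon
    have hcl : IsClosed V := by
      refine isClosed_of_closure_subset fun x hx => (hVc hx).resolve_left fun hxC => ?_
      exact (hcon ▸ (⟨hx, hxC⟩ : x ∈ closure V ∩ C) : x ∈ (∅ : Set ℂ))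
    have huniv := IsClopen.eq_univ ⟨hcl, hVo⟩ ⟨w, hwV⟩
    exact connectedComponentIn_subset Cᶜ w (huniv ▸ mem_univ c : c ∈ V) hc
  obtain ⟨x, hxV, hxC⟩ := hmeet
  refine ⟨C ∪ closure V, ?_, Or.inl hc, Or.inr (subset_closure hwV),
    hC.union x hxC hxV isPreconnected_connectedComponentIn.closure⟩
  exact union_subset hCX (hVc.trans (union_subset hCX (hX w hw hwC)))

theorem isPreconnected_annulus (r s : ℝ) (hr : 0 ≤ r) :
    IsPreconnected {w : ℂ | r < ‖w‖ ∧ ‖w‖ < s} := by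
  have h := (convex_preimage_exp_annulus r s).isPreconnected.image exp
    Complex.continuous_exp.continuousOn
  rwa [image_preimage_eq_of_subset] at h
  intro w hw
  exact ⟨log w, exp_log (norm_pos_iff.1 (hr.trans_lt hw.1))⟩

theorem isPreconnected_norm_gt {r : ℝ} (hr : 0 ≤ r) : IsPreconnected {w : ℂ | r < ‖w‖} := by
  refine isPreconnected_of_forall_pair fun x hx y hy => ?_
  refine ⟨{w | r < ‖w‖ ∧ ‖w‖ < max ‖x‖ ‖y‖ + 1}, fun w hw => hw.1, ⟨hx, ?_⟩, ⟨hy, ?_⟩,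
    isPreconnected_annulus _ _ hr⟩
  · linarith [le_max_left ‖x‖ ‖y‖]
  · linarith [le_max_right ‖x‖ ‖y‖]

section Exterior

variable {C : Set ℂ}

theorem exists_norm_gt_of_not_isBounded {X : Set ℂ} (h : ¬ Bornology.IsBounded X) (R : ℝ) :
    ∃ z ∈ X, R < ‖z‖ := by
  by_contra! hcon
  exact h (isBounded_iff_forall_norm_le.2 ⟨R, hcon⟩)

theorem mem_loopExterior_iff {z : ℂ} :
    z ∈ loopExterior C ↔ z ∉ C ∧ ¬ Bornology.IsBounded (connectedComponentIn Cᶜ z) := by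
  simp only [loopExterior, Surrounds, mem_ofPred_eq]
  tauto

theorem not_isBounded_norm_gt (R : ℝ) : ¬ Bornology.IsBounded {w : ℂ | R < ‖w‖} := by
  intro h
  obtain ⟨M, hM⟩ := isBounded_iff_forall_norm_le.1 h
  have h1 : |R| + |M| + 1 ≤ M := by
    have := hM ((|R| + |M| + 1 : ℝ) : ℂ) (by
      rw [mem_ofPred_eq, Complex.norm_real, Real.norm_of_nonneg (by positivity)]
      linarith [le_abs_self R, abs_nonneg M])
    rwa [Complex.norm_real, Real.norm_of_nonneg (by positivity)] at this
  linarith [le_abs_self M, abs_nonneg R]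

theorem norm_gt_subset_component {R : ℝ} (hR : 0 ≤ R) (hCR : C ⊆ closedBall 0 R) {z : ℂ}
    (hz : R < ‖z‖) : {w : ℂ | R < ‖w‖} ⊆ connectedComponentIn Cᶜ z := by
  refine (isPreconnected_norm_gt hR).subset_connectedComponentIn hz fun w hw hwC => ?_
  exact absurd (mem_closedBall_zero_iff.1 (hCR hwC)) (not_le.2 hw)

theorem loopExterior_eq {R : ℝ} (hR : 0 ≤ R) (hCR : C ⊆ closedBall 0 R) {z : ℂ}
    (hz : R < ‖z‖) : loopExterior C = connectedComponentIn Cᶜ z := by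
  have hsub := norm_gt_subset_component hR hCR hz
  have hub : ¬ Bornology.IsBounded (connectedComponentIn Cᶜ z) :=
    fun h => not_isBounded_norm_gt R (h.subset hsub)
  ext w
  rw [mem_loopExterior_iff]
  constructor
  · rintro ⟨hwC, hw⟩
    obtain ⟨y, hy, hyR⟩ := exists_norm_gt_of_not_isBounded hw R
    rw [connectedComponentIn_eq (hsub hyR), ← connectedComponentIn_eq hy]
    exact mem_connectedComponentIn hwC
  · intro hw
    exact ⟨connectedComponentIn_subset _ _ hw, by rwa [← connectedComponentIn_eq hw]⟩

theorem isOpen_loopExterior (hC : IsClosed C) {R : ℝ} (hR : 0 ≤ R) (hCR : C ⊆ closedBall 0 R) :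
    IsOpen (loopExterior C) := by
  rw [loopExterior_eq hR hCR (z := ((R + 1 : ℝ) : ℂ))
    (by rw [Complex.norm_real, Real.norm_of_nonneg (by linarith)]; linarith)]
  exact hC.isOpen_compl.connectedComponentIn

theorem isPreconnected_loopExterior {R : ℝ} (hR : 0 ≤ R) (hCR : C ⊆ closedBall 0 R) :
    IsPreconnected (loopExterior C) := by
  rw [loopExterior_eq hR hCR (z := ((R + 1 : ℝ) : ℂ))
    (by rw [Complex.norm_real, Real.norm_of_nonneg (by linarith)]; linarith)]
  exact isPreconnected_connectedComponentIn

theorem norm_gt_subset_loopExterior {R : ℝ} (hR : 0 ≤ R) (hCR : C ⊆ closedBall 0 R) :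
    {w : ℂ | R < ‖w‖} ⊆ loopExterior C := fun z hz => by
  rw [loopExterior_eq hR hCR hz]
  exact norm_gt_subset_component hR hCR hz hz

theorem compl_loopExterior_subset {R : ℝ} (hR : 0 ≤ R) (hCR : C ⊆ closedBall 0 R) :
    (loopExterior C)ᶜ ⊆ closedBall 0 R := by
  intro z hz
  rw [mem_closedBall_zero_iff]
  by_contra! h
  exact hz (norm_gt_subset_loopExterior hR hCR h)

theorem subset_compl_loopExterior : C ⊆ (loopExterior C)ᶜ := fun _ hz h => h.1 hz

theorem isPreconnected_compl_loopExterior (hCc : IsClosed C) (hC : IsPreconnected C)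
    (hne : C.Nonempty) : IsPreconnected (loopExterior C)ᶜ := by
  refine isPreconnected_of_union_components hCc hC hne subset_compl_loopExterior ?_
  intro w hw hwC y hy hyE
  rw [mem_loopExterior_iff, ← connectedComponentIn_eq hy] at hyE
  exact hw (mem_loopExterior_iff.2 ⟨hwC, hyE.2⟩)

/-- The annular domain between a continuum in the disk and the unit circle is connected. -/
theorem isPreconnected_ball_inter_loopExterior (hC : IsClosed C) {R : ℝ} (hR : 0 ≤ R)
    (hR1 : R < 1) (hCR : C ⊆ closedBall 0 R) : IsPreconnected (ball 0 1 ∩ loopExterior C) := by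
  set A := ball (0 : ℂ) 1 ∩ loopExterior C with hA
  have hAo : IsOpen A := isOpen_ball.inter (isOpen_loopExterior hC hR hCR)
  set O := {w : ℂ | R < ‖w‖ ∧ ‖w‖ < 1} with hO
  have hOA : O ⊆ A := fun w hw =>
    ⟨mem_ball_zero_iff.2 hw.2, norm_gt_subset_loopExterior hR hCR hw.1⟩
  set z₀ : ℂ := (((R + 1) / 2 : ℝ) : ℂ) with hz₀
  have hz₀O : z₀ ∈ O := by
    have : ‖z₀‖ = (R + 1) / 2 := by
      rw [hz₀, Complex.norm_real, Real.norm_of_nonneg (by linarith)]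
    constructor <;> rw [this] <;> linarith
  refine isPreconnected_of_forall z₀ fun w hw => ?_
  set W := connectedComponentIn A w with hW
  have hwW : w ∈ W := mem_connectedComponentIn hw
  have hWA : W ⊆ A := connectedComponentIn_subset _ _
  -- A component of `A` missing the collar could not accumulate at the unit circle, so it would be
  -- closed in the exterior and swallow it all, including the point `2`.
  have hmeet : (W ∩ O).Nonempty := by
    by_contra hcon
    have hsub : loopExterior C ⊆ W := by
      refine (isPreconnected_loopExterior hR hCR).subset_of_closure_inter_subset
        hAo.connectedComponentIn ⟨w, hw.2, hwW⟩ ?_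
      rintro x ⟨hx, hxE⟩
      refine connectedComponentIn_subset_of_mem_closure hAo ⟨?_, hxE⟩ hx
      rw [mem_ball_zero_iff]
      by_contra! hx1
      obtain ⟨y, hyR, hyW⟩ := mem_closure_iff.1 hx {w : ℂ | R < ‖w‖}
        (isOpen_lt continuous_const continuous_norm) (hR1.trans_le hx1)
      exact hcon ⟨y, hyW, hyR, mem_ball_zero_iff.1 (hWA hyW).1⟩
    have h2 := (hWA (hsub (norm_gt_subset_loopExterior hR hCR
      (show (2 : ℂ) ∈ {w : ℂ | R < ‖w‖} by simp; linarith)))).1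
    simp at h2
  obtain ⟨y, hyW, hyO⟩ := hmeet
  exact ⟨W, hWA, ((isPreconnected_annulus R 1 hR).subset_connectedComponentIn hyO hOA).trans
    (connectedComponentIn_eq hyW).symm.subset hz₀O, hwW, isPreconnected_connectedComponentIn⟩

end Exterior

/-! ### The domain surrounded by a continuum -/

theorem chainsToInfinity_of_isPreconnected {X : Set ℂ} (hX : IsPreconnected X)
    (hb : ¬ Bornology.IsBounded X) : ChainsToInfinity X := by
  intro δ hδ ζ hζ M
  obtain ⟨p, hp, hM⟩ := exists_norm_gt_of_not_isBounded hb M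
  exact ⟨p, chain_of_isPreconnected hX hζ hp hδ, hM⟩

theorem not_isBounded_compl {X : Set ℂ} (hX : Bornology.IsBounded X) :
    ¬ Bornology.IsBounded Xᶜ := fun h => by
  have := hX.union h
  rw [union_compl_self] at this
  exact not_isBounded_norm_gt 0 (this.subset (subset_univ _))

theorem connectedComponentIn_ball_diff {C : Set ℂ} {R : ℝ} (hR : 0 ≤ R) (hR1 : R < 1)
    (hCR : C ⊆ closedBall 0 R) (h0 : Surrounds C 0) :
    connectedComponentIn (ball 0 1 \ C) 0 = connectedComponentIn Cᶜ 0 := by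
  refine Subset.antisymm (connectedComponentIn_mono 0 fun z hz => hz.2) ?_
  refine isPreconnected_connectedComponentIn.subset_connectedComponentIn
    (mem_connectedComponentIn h0.1) fun z hz => ⟨?_, connectedComponentIn_subset _ _ hz⟩
  refine closedBall_subset_ball hR1 (compl_loopExterior_subset hR hCR fun hzE => ?_)
  exact (mem_loopExterior_iff.1 hzE).2 (by rw [← connectedComponentIn_eq hz]; exact h0.2)

/-- The complement of the component is the loop with its other complementary components: connected
and unbounded, so square roots exist. The unimodular `e` turns the derivative positive. -/
theorem exists_conformal_component {C : Set ℂ} (hCc : IsClosed C) (hC : IsPreconnected C)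
    (hne : C.Nonempty) (h0 : Surrounds C 0) (hD : connectedComponentIn Cᶜ 0 ⊆ ball 0 1) :
    ∃ c : ℝ, 0 < c ∧ ∃ φ : ℂ → ℂ,
      IsConformalOnto φ (connectedComponentIn Cᶜ 0) (ball 0 1) ∧ φ 0 = 0 ∧
        HasDerivAt φ (c : ℂ) 0 := by
  set D := connectedComponentIn Cᶜ 0 with hDdef
  have hDo : IsOpen D := hCc.isOpen_compl.connectedComponentIn
  have h0D : (0 : ℂ) ∈ D := mem_connectedComponentIn h0.1
  have hDC : D ⊆ Cᶜ := connectedComponentIn_subset _ _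
  have hX : IsPreconnected Dᶜ := by
    refine isPreconnected_of_union_components hCc hC hne (fun z hz h => hDC h hz) ?_
    intro w hw hwC y hy hyD
    apply hw
    rw [hDdef, connectedComponentIn_eq hyD, ← connectedComponentIn_eq hy]
    exact mem_connectedComponentIn hwC
  obtain ⟨f, hf, hf0⟩ := riemann_mapping hDo isPreconnected_connectedComponentIn
    (fun f hf h => exists_sqrt hDo isPreconnected_connectedComponentIn
      (hne.mono fun z hz h => hDC h hz)
      (chainsToInfinity_of_isPreconnected hX (not_isBounded_compl h0.2)) hf h)
    h0D differentiableOn_id (injOn_id _) hD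
  have hd := (hf.1.differentiableAt (hDo.mem_nhds h0D)).hasDerivAt
  have hd0 : deriv f 0 ≠ 0 := deriv_ne_zero_of_injOn hDo hf.1 hf.2.injOn h0D
  have hn := norm_pos_iff.2 hd0
  set e : ℂ := starRingEnd ℂ (deriv f 0) / ‖deriv f 0‖ with he
  have hne : ‖e‖ = 1 := by
    rw [he, norm_div, RCLike.norm_conj, Complex.norm_real, norm_norm, div_self hn.ne']
  have he0 : e ≠ 0 := norm_pos_iff.1 (by rw [hne]; exact one_pos)
  refine ⟨‖deriv f 0‖, hn, fun z => e * f z, ⟨hf.1.const_mul e, ?_, ?_, ?_⟩, by simp [hf0], ?_⟩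
  · intro z hz
    have := hf.2.mapsTo hz
    simpa [hne] using this
  · exact fun z hz w hw h => hf.2.injOn hz hw (mul_left_cancel₀ he0 h)
  · intro w hw
    obtain ⟨z, hz, h⟩ := hf.2.surjOn (show e⁻¹ * w ∈ ball (0 : ℂ) 1 by simpa [hne] using hw)
    exact ⟨z, hz, by simp only [h]; field_simp⟩
  · refine (hd.const_mul e).congr_deriv ?_
    rw [he, div_mul_eq_mul_div, mul_comm, Complex.mul_conj, Complex.normSq_eq_norm_sq]
    have : (‖deriv f 0‖ : ℂ) ≠ 0 := by exact_mod_cast hn.ne'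
    push_cast
    field_simp

/-! ### Automorphisms of the disk without fixed points -/

theorem _root_.IsConformalOnto.comp {f g : ℂ → ℂ} {U V W : Set ℂ} (hg : IsConformalOnto g V W)
    (hf : IsConformalOnto f U V) : IsConformalOnto (fun z => g (f z)) U W :=
  ⟨hg.1.comp hf.1 hf.2.mapsTo, hg.2.comp hf.2⟩

theorem _root_.IsConformalOnto.of_inverse {f g : ℂ → ℂ} {U V : Set ℂ} (hf : DifferentiableOn ℂ f U)
    (hfm : MapsTo f U V) (hgm : MapsTo g V U) (hgf : ∀ z ∈ U, g (f z) = z)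
    (hfg : ∀ w ∈ V, f (g w) = w) : IsConformalOnto f U V :=
  ⟨hf, InvOn.bijOn ⟨hgf, hfg⟩ hfm hgm⟩

theorem isConformalOnto_blaschke {b : ℂ} (hb : ‖b‖ < 1) :
    IsConformalOnto (blaschke b) (ball 0 1) (ball 0 1) := by
  have hm : ∀ {b : ℂ}, ‖b‖ < 1 → MapsTo (blaschke b) (ball 0 1) (ball 0 1) := fun hb w hw =>
    mem_ball_zero_iff.2 (norm_blaschke_lt_one hb (mem_ball_zero_iff.1 hw))
  have hb' : ‖-b‖ < 1 := by rwa [norm_neg]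
  refine IsConformalOnto.of_inverse (g := blaschke (-b)) (differentiableOn_blaschke hb) (hm hb)
    (hm hb') (fun z hz => blaschke_neg_blaschke hb (mem_ball_zero_iff.1 hz)) fun w hw => ?_
  simpa using blaschke_neg_blaschke hb' (mem_ball_zero_iff.1 hw)

/-- After recentring at the zero `b` of `T`, the Schwarz lemma for the map and its inverse forces a
rotation; `1 / 2` is an arbitrary point at which equality is read off. -/
theorem exists_eq_mul_blaschke {T : ℂ → ℂ} (hT : IsConformalOnto T (ball 0 1) (ball 0 1)) :
    ∃ c b : ℂ, ‖c‖ = 1 ∧ ‖b‖ < 1 ∧ ∀ w ∈ ball (0 : ℂ) 1, T w = c * blaschke b w := by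
  have hz : (0 : ℂ) ∈ ball (0 : ℂ) 1 := mem_ball_self one_pos
  obtain ⟨b, hb, hTb⟩ := hT.2.surjOn hz
  rw [mem_ball_zero_iff] at hb
  have hb' : ‖-b‖ < 1 := by rwa [norm_neg]
  have hS := hT.comp (isConformalOnto_blaschke hb')
  set S : ℂ → ℂ := fun z => T (blaschke (-b) z) with hSdef
  have hS0 : S 0 = 0 := by simp [hSdef, blaschke, hTb]
  obtain ⟨U, hU, hUS, -⟩ := exists_holomorphic_inverse isOpen_ball hS
  have hU0 : U 0 = 0 := by simpa [hS0] using hUS 0 hz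
  have hsch : ∀ {f : ℂ → ℂ}, IsConformalOnto f (ball 0 1) (ball 0 1) → f 0 = 0 →
      ∀ w ∈ ball (0 : ℂ) 1, ‖f w‖ ≤ ‖w‖ := fun hf hf0 w hw =>
    norm_le_norm_of_mapsTo_ball hf.1 (hf.2.mapsTo.mono_right ball_subset_closedBall) hf0
      (mem_ball_zero_iff.1 hw)
  have hw : (1 / 2 : ℂ) ∈ ball (0 : ℂ) 1 := by rw [mem_ball_zero_iff]; norm_num
  have h1 := hsch hS hS0 _ hw
  have h2 := hsch hU hU0 _ (hS.2.mapsTo hw)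
  rw [hUS _ hw] at h2
  have h3 : ‖S (1 / 2)‖ = ‖(1 / 2 : ℂ)‖ := le_antisymm h1 h2
  obtain ⟨c, hc, hSc⟩ := affine_of_mapsTo_ball_of_exists_norm_dslope_eq_div' (f := S) (c := 0)
    (R₁ := 1) (R₂ := 1) hS.1
    (by rw [hS0]; exact hS.2.mapsTo.mono_right ball_subset_closedBall)
    ⟨1 / 2, hw, by
      rw [dslope_of_ne _ (by norm_num), slope_def_field, hS0, sub_zero, sub_zero, norm_div, h3,
        div_self (by norm_num), div_self one_ne_zero]⟩
  refine ⟨c, b, by simpa using hc, hb, fun w hw => ?_⟩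
  have hw' := mem_ball_zero_iff.1 hw
  have := hSc ((isConformalOnto_blaschke hb).2.mapsTo hw)
  simp only [hSdef, blaschke_neg_blaschke hb hw', sub_zero, smul_eq_mul] at this
  rw [this]
  simp [blaschke, hTb, mul_comm]

/-- A disk automorphism without fixed points is affine in the half-plane coordinate at one of its
boundary fixed points. -/
theorem exists_affine_of_no_fixed_point {T : ℂ → ℂ}
    (hT : IsConformalOnto T (ball 0 1) (ball 0 1)) (hfix : ∀ w ∈ ball (0 : ℂ) 1, T w ≠ w) :
    ∃ p : ℂ, ‖p‖ = 1 ∧ ∃ k ν : ℂ, ∀ w ∈ ball (0 : ℂ) 1,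
      (p + T w) / (p - T w) = k * ((p + w) / (p - w)) + ν := by
  obtain ⟨c, b, hc, hb, hTe⟩ := exists_eq_mul_blaschke hT
  obtain ⟨b', hb'⟩ : ∃ b', b' = (starRingEnd ℂ) b := ⟨_, rfl⟩
  have hbn : ‖b'‖ = ‖b‖ := hb' ▸ RCLike.norm_conj b
  have hc0 : c ≠ 0 := norm_pos_iff.1 (by rw [hc]; exact one_pos)
  have hb0 : b ≠ 0 := by
    rintro rfl
    refine hfix 0 (mem_ball_self one_pos) ?_
    rw [hTe 0 (mem_ball_self one_pos)]; simp [blaschke]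
  have hb0' : b' ≠ 0 := by rw [← norm_pos_iff, hbn]; exact norm_pos_iff.2 hb0
  -- This quadratic is the fixed-point equation. Its roots have product of modulus `1` and neither
  -- is in the open disk, so both are on the circle; sending one of them, `p`, to infinity makes `T`
  -- affine.
  have hroot : ∀ w : ℂ, b' * w ^ 2 + (c - 1) * w - c * b = 0 → 1 ≤ ‖w‖ := by
    intro w hw
    by_contra! h
    refine hfix w (mem_ball_zero_iff.2 h) ?_
    rw [hTe w (mem_ball_zero_iff.2 h), blaschke]
    have := blaschke_denom_ne_zero hb h
    rw [← hb'] at this ⊢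
    rw [← mul_div_assoc, div_eq_iff this]
    linear_combination hw
  obtain ⟨s, hs⟩ := IsAlgClosed.exists_pow_nat_eq ((c - 1) ^ 2 + 4 * b' * (c * b)) two_pos
  set p := (-(c - 1) + s) / (2 * b') with hp
  set p' := (-(c - 1) - s) / (2 * b') with hp'
  have e1 : b' * p ^ 2 + (c - 1) * p - c * b = 0 := by
    rw [hp]; field_simp; linear_combination hs
  have e2 : b' * p' ^ 2 + (c - 1) * p' - c * b = 0 := by
    rw [hp']; field_simp; linear_combination hs
  have e3 : b' * (p * p') = -(c * b) := by
    rw [hp, hp']; field_simp; linear_combination -hs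
  have hpp : ‖p‖ * ‖p'‖ = 1 := by
    have := congrArg norm e3
    rw [norm_mul, norm_neg, norm_mul, norm_mul, hc, hbn, one_mul] at this
    have hbpos := norm_pos_iff.2 hb0
    nlinarith
  have hp1 : ‖p‖ = 1 := by nlinarith [hroot p e1, hroot p' e2]
  have hp0 : p ≠ 0 := norm_pos_iff.1 (by rw [hp1]; exact one_pos)
  have hne : ∀ w ∈ ball (0 : ℂ) 1, p - w ≠ 0 := fun w hw h => by
    rw [mem_ball_zero_iff, ← sub_eq_zero.1 h, hp1] at hw
    exact lt_irrefl _ hw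
  have he : p * b' + c ≠ 0 := by
    intro h
    have h1 : ‖p * b'‖ = 1 := by rw [show p * b' = -c by linear_combination h, norm_neg, hc]
    rw [norm_mul, hp1, hbn] at h1
    linarith
  refine ⟨p, hp1, ((p - c * b) / p + (c - p * b')) / 2 / (p * b' + c),
    ((p - c * b) / p - (c - p * b')) / 2 / (p * b' + c), fun w hw => ?_⟩
  have h1 := hne _ (hT.2.mapsTo hw)
  have h2 := hne w hw
  have h3 := blaschke_denom_ne_zero hb (mem_ball_zero_iff.1 hw)
  rw [hTe w hw, blaschke, ← hb'] at h1 ⊢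
  rw [← hb'] at h3
  clear_value p
  have h4 : p - c * ((w - b) / (1 - b' * w)) = (p * b' + c) * (p - w) / (1 - b' * w) := by
    rw [eq_div_iff h3, sub_mul, mul_assoc c, div_mul_cancel₀ _ h3]
    linear_combination -e1
  have h5 : p + c * ((w - b) / (1 - b' * w)) = (p - c * b + (c - p * b') * w) / (1 - b' * w) := by
    rw [eq_div_iff h3, add_mul, mul_assoc c, div_mul_cancel₀ _ h3]
    ring
  rw [h4, h5, div_div_div_cancel_right₀ h3]
  field_simp
  ring

theorem isConformalOnto_cayley {p : ℂ} (hp : ‖p‖ = 1) :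
    IsConformalOnto (fun z => (p + z) / (p - z)) (ball 0 1) {z | 0 < z.re} := by
  have hp0 : p ≠ 0 := norm_pos_iff.1 (by rw [hp]; exact one_pos)
  have hne : ∀ w ∈ ball (0 : ℂ) 1, p - w ≠ 0 := fun w hw h => by
    rw [mem_ball_zero_iff, ← sub_eq_zero.1 h, hp] at hw
    exact lt_irrefl _ hw
  have hne' : ∀ h : ℂ, 0 < h.re → h + 1 ≠ 0 := fun h hh h1 => by
    have := congrArg re h1
    simp at this
    linarith
  refine IsConformalOnto.of_inverse (g := fun h => p * (h - 1) / (h + 1)) ?_ ?_ ?_ ?_ ?_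
  · exact (differentiableOn_id.const_add p).fun_div (differentiableOn_id.const_sub p) hne
  · intro w hw
    have h1 := hne w hw
    have hn := Complex.normSq_pos.2 h1
    have hpn : normSq p = 1 := by rw [Complex.normSq_eq_norm_sq, hp, one_pow]
    have hwn : normSq w < 1 := by
      rw [Complex.normSq_eq_norm_sq]
      have := mem_ball_zero_iff.1 hw
      nlinarith [norm_nonneg w]
    rw [Complex.normSq_apply] at hpn hwn
    rw [mem_ofPred_eq, Complex.div_re, ← add_div]
    refine div_pos ?_ hn
    simp only [add_re, add_im, sub_re, sub_im]
    nlinarith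
  · intro h hh
    have h1 := hne' h hh
    rw [mem_ball_zero_iff, norm_div, norm_mul, hp, one_mul, div_lt_one (norm_pos_iff.2 h1)]
    refine lt_of_pow_lt_pow_left₀ 2 (norm_nonneg _) ?_
    rw [← Complex.normSq_eq_norm_sq, ← Complex.normSq_eq_norm_sq, Complex.normSq_apply,
      Complex.normSq_apply]
    rw [mem_ofPred_eq] at hh
    simp
    nlinarith
  · intro w hw
    have h1 := hne w hw
    have h2 : (p + w) / (p - w) + 1 ≠ 0 := by
      rw [div_add_one h1]
      exact div_ne_zero (by ring_nf; simpa using hp0) h1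
    rw [div_eq_iff h2]
    field_simp
    ring
  · intro h hh
    have h1 := hne' h hh
    have h2 : p - p * (h - 1) / (h + 1) = 2 * p / (h + 1) := by field_simp; ring
    rw [h2]
    field_simp
    ring

theorem affine_halfPlane {k ν : ℂ} (hm : ∀ h : ℂ, 0 < h.re → 0 < (k * h + ν).re)
    (hs : ∀ h : ℂ, 0 < h.re → ∃ h' : ℂ, 0 < h'.re ∧ k * h' + ν = h) :
    k.im = 0 ∧ 0 < k.re ∧ ν.re = 0 := by
  have hm' : ∀ x y : ℝ, 0 < x → 0 < k.re * x - k.im * y + ν.re := fun x y hx => by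
    simpa using hm ⟨x, y⟩ hx
  have h1 : k.im = 0 := by
    by_contra h
    have := hm' 1 ((k.re + ν.re) / k.im) one_pos
    field_simp at this
    linarith
  simp only [h1, zero_mul, sub_zero] at hm'
  have h2 : 0 ≤ k.re := by
    by_contra! h
    have := hm' ((|ν.re| + 1) / -k.re) 0 (div_pos (by positivity) (by linarith))
    have h3 : k.re * ((|ν.re| + 1) / -k.re) = -(|ν.re| + 1) := by
      have := h.ne
      field_simp
    linarith [le_abs_self ν.re]
  have h3 : 0 ≤ ν.re := by
    by_contra! h
    have hk : 0 < 2 * (k.re + 1) := by linarith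
    have := hm' (-ν.re / (2 * (k.re + 1))) 0 (div_pos (by linarith) hk)
    have h4 : k.re * (-ν.re / (2 * (k.re + 1))) ≤ -ν.re / 2 := by
      rw [← mul_div_assoc, div_le_div_iff₀ hk two_pos]
      nlinarith
    linarith
  have h4 : k.re ≠ 0 := fun h => by
    have hk : k = 0 := Complex.ext h h1
    obtain ⟨_, _, e1⟩ := hs 1 (by simp)
    obtain ⟨_, _, e2⟩ := hs 2 (by simp)
    rw [hk, zero_mul, zero_add] at e1 e2
    rw [e1] at e2
    norm_num at e2
  refine ⟨h1, lt_of_le_of_ne h2 h4.symm, le_antisymm ?_ h3⟩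
  by_contra! h
  obtain ⟨h', hh', e⟩ := hs ((ν.re / 2 : ℝ) : ℂ) (by rw [ofReal_re]; linarith)
  have := congrArg re e
  rw [add_re, mul_re, h1, zero_mul, sub_zero, ofReal_re] at this
  nlinarith

/-! ### Periodic simply connected domains -/

theorem mem_preimage_exp_roundAnnulus {r : ℝ} (hr : 0 < r) {ζ : ℂ} :
    ζ ∈ exp ⁻¹' roundAnnulus r ↔ Real.log r < ζ.re ∧ ζ.re < 0 := by
  rw [mem_preimage, roundAnnulus, mem_ofPred_eq, Complex.norm_exp, Real.log_lt_iff_lt_exp hr,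
    Real.exp_lt_one_iff]

theorem isConformalOnto_left_halfPlane {m : ℝ} (hm : 0 < m) :
    IsConformalOnto (fun h => -(m : ℂ) * h) {h | 0 < h.re} (exp ⁻¹' roundAnnulus 0) := by
  have hm0 : (m : ℂ) ≠ 0 := by exact_mod_cast hm.ne'
  have hmem : ∀ ζ : ℂ, ζ ∈ exp ⁻¹' roundAnnulus 0 ↔ ζ.re < 0 := fun ζ => by
    rw [mem_preimage, roundAnnulus, mem_ofPred_eq, Complex.norm_exp, Real.exp_lt_one_iff]
    exact and_iff_right (Real.exp_pos _)
  refine IsConformalOnto.of_inverse (g := fun ζ => -(m : ℂ)⁻¹ * ζ)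
    (differentiable_id.const_mul _).differentiableOn ?_ ?_ ?_ ?_
  · intro h hh
    rw [mem_ofPred_eq] at hh
    rw [hmem]
    simp
    positivity
  · intro ζ hζ
    rw [hmem] at hζ
    have : 0 < m⁻¹ * -ζ.re := mul_pos (inv_pos.2 hm) (by linarith)
    rw [mem_ofPred_eq, ← ofReal_inv, ← ofReal_neg, re_ofReal_mul]
    linarith
  · intro h _
    field_simp
  · intro ζ _
    field_simp

/-- The values of `log h` fill `|Im| < π / 2`. The factor `2πi / l` turns the dilation by `e^l` into
translation by `2πi` and makes real parts fill an interval of half-width `π² / |l|`; the shift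
brings its right end to `0`. -/
theorem isConformalOnto_strip {l : ℝ} (hl : l ≠ 0) :
    IsConformalOnto (fun h => 2 * Real.pi * I * log h / l - (Real.pi ^ 2 / |l| : ℝ))
      {h | 0 < h.re} (exp ⁻¹' roundAnnulus (Real.exp (-(2 * Real.pi ^ 2 / |l|)))) := by
  have hpi := Real.pi_pos
  have hl0 : (l : ℂ) ≠ 0 := by exact_mod_cast hl
  have hla : 0 < |l| := abs_pos.2 hl
  have hpi0 : (Real.pi : ℂ) ≠ 0 := by exact_mod_cast hpi.ne'
  set d := Real.pi ^ 2 / |l| with hd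
  have hd2 : 2 * Real.pi ^ 2 / |l| = 2 * d := by rw [hd]; ring
  have hmem : ∀ ζ : ℂ, ζ ∈ exp ⁻¹' roundAnnulus (Real.exp (-(2 * Real.pi ^ 2 / |l|))) ↔
      |ζ.re + d| < d := fun ζ => by
    rw [mem_preimage_exp_roundAnnulus (Real.exp_pos _), Real.log_exp, hd2, abs_lt]
    constructor <;> rintro ⟨h1, h2⟩ <;> constructor <;> linarith
  have hre : ∀ ζ : ℂ, (2 * Real.pi * I * ζ / l).re = -(2 * Real.pi * ζ.im / l) := fun ζ => by
    have : 2 * Real.pi * I * ζ / l = ((2 * Real.pi / l : ℝ) : ℂ) * (I * ζ) := by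
      push_cast; ring
    rw [this, re_ofReal_mul, I_mul_re]
    ring
  have him : ∀ ζ : ℂ, ((ζ + d) * l / (2 * Real.pi * I)).im = -((ζ.re + d) * l / (2 * Real.pi)) :=
      fun ζ => by
    have : (ζ + d) * l / (2 * Real.pi * I) = ((l / (2 * Real.pi) : ℝ) : ℂ) * -(I * (ζ + d)) := by
      push_cast
      field_simp
      linear_combination (ζ + d) * I_sq
    rw [this, im_ofReal_mul, neg_im, I_mul_im, add_re, ofReal_re]
    ring
  have himl : ∀ ζ ∈ exp ⁻¹' roundAnnulus (Real.exp (-(2 * Real.pi ^ 2 / |l|))),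
      |((ζ + d) * l / (2 * Real.pi * I)).im| < Real.pi / 2 := fun ζ hζ => by
    rw [hmem] at hζ
    rw [him, abs_neg, abs_div, abs_mul, abs_of_pos (show 0 < 2 * Real.pi by positivity),
      div_lt_iff₀ (by positivity)]
    have : d * |l| = Real.pi ^ 2 := by rw [hd]; field_simp
    nlinarith
  refine IsConformalOnto.of_inverse
    (g := fun ζ => exp ((ζ + d) * l / (2 * Real.pi * I))) ?_ ?_ ?_ ?_ ?_
  · refine ((DifferentiableOn.const_mul ?_ _).div_const _).sub_const _
    exact differentiableOn_id.clog fun h hh => Or.inl hh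
  · intro h hh
    rw [hmem, sub_re, hre, ofReal_re, sub_add_cancel, abs_neg, abs_div, abs_mul,
      abs_of_pos (show 0 < 2 * Real.pi by positivity), log_im, hd]
    have := abs_arg_lt_pi_div_two_iff.2 (Or.inl hh)
    gcongr
    nlinarith
  · intro ζ hζ
    rw [mem_ofPred_eq, Complex.exp_re]
    have := abs_lt.1 (himl ζ hζ)
    exact mul_pos (Real.exp_pos _) (Real.cos_pos_of_mem_Ioo ⟨this.1, this.2⟩)
  · intro h hh
    have h0 : h ≠ 0 := fun h0 => by simp [h0] at hh
    have : (2 * Real.pi * I * log h / l - (d : ℂ) + d) * l / (2 * Real.pi * I) = log h := by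
      field_simp
      ring
    simp only [this, exp_log h0]
  · intro ζ hζ
    have := abs_lt.1 (himl ζ hζ)
    rw [log_exp (by linarith) (by linarith)]
    field_simp
    ring

/-- The Riemann map conjugates translation by `2πi` to an automorphism without fixed points, which
in a half-plane is `h ↦ κ h + iμ`. If `κ = 1`, scaling by `-2π / |μ|` gives the left half-plane, the
case `r = 0`, with `s` recording the sign of the translation. Otherwise one recentres at the fixed
point `t` on the imaginary axis and takes logarithms to reach a strip. -/
theorem exists_periodic_uniformization {Ω : Set ℂ} (hΩ : IsOpen Ω) (hc : IsPreconnected Ω)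
    (hne : Ω.Nonempty) (hp : PeriodicSet Ω) (hneg : ∀ ζ ∈ Ω, ζ.re < 0)
    (hch : ChainsToInfinity Ωᶜ) : ∃ r : ℝ, 0 ≤ r ∧ r < 1 ∧ ∃ (Ψ : ℂ → ℂ) (s : ℤ),
      s * s = 1 ∧ IsConformalOnto Ψ Ω (exp ⁻¹' roundAnnulus r) ∧
      ∀ ζ ∈ Ω, Ψ (ζ + 2 * Real.pi * I) = Ψ ζ + s * (2 * Real.pi * I) := by
  have hpi := Real.pi_pos
  have hτ : (2 * Real.pi * I : ℂ) ≠ 0 := by simp [hpi.ne']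
  obtain ⟨ζ₀, hζ₀⟩ := hne
  have hne1 : ∀ ζ ∈ Ω, ζ - 1 ≠ 0 := fun ζ hζ h => by
    have h1 := hneg ζ hζ
    rw [sub_eq_zero.1 h, one_re] at h1
    linarith
  obtain ⟨F, hF, -⟩ := riemann_mapping hΩ hc
    (fun f hf h => exists_sqrt hΩ hc ⟨0, fun h => lt_irrefl _ (hneg 0 h)⟩ hch hf h) hζ₀
    (j := fun ζ => (ζ + 1) / (ζ - 1))
    ((differentiableOn_id.add_const 1).fun_div (differentiableOn_id.sub_const 1) hne1)
    (fun ζ hζ ζ' hζ' h => by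
      have h1 := hne1 ζ hζ
      have h2 := hne1 ζ' hζ'
      simp only at h
      rw [div_eq_div_iff h1 h2] at h
      linear_combination -h / 2)
    (fun ζ hζ => by
      have h1 := hneg ζ hζ
      rw [mem_ball_zero_iff, norm_div, div_lt_one (norm_pos_iff.2 (hne1 ζ hζ))]
      refine lt_of_pow_lt_pow_left₀ 2 (norm_nonneg _) ?_
      rw [← Complex.normSq_eq_norm_sq, ← Complex.normSq_eq_norm_sq, Complex.normSq_apply,
        Complex.normSq_apply]
      simp
      nlinarith)
  obtain ⟨G, hG, hGF, hFG⟩ := exists_holomorphic_inverse hΩ hF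
  have hshift : IsConformalOnto (fun ζ => ζ + 2 * Real.pi * I) Ω Ω :=
    IsConformalOnto.of_inverse (g := fun ζ => ζ - 2 * Real.pi * I)
      (differentiableOn_id.add_const _) (fun ζ hζ => hp.add_mem hζ)
      (fun ζ hζ => by simpa [sub_eq_add_neg] using hp ζ hζ (-1))
      (fun ζ _ => by ring) (fun ζ _ => by ring)
  obtain ⟨p, hp1, k, ν, hk⟩ := exists_affine_of_no_fixed_point ((hF.comp hshift).comp hG)
    (fun w hw h => by
      have h1 := hG.2.mapsTo hw
      have h2 := congrArg G h
      rw [hGF _ (hp.add_mem h1)] at h2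
      exact hτ (by linear_combination h2))
  have hH := (isConformalOnto_cayley hp1).comp hF
  set H : ℂ → ℂ := fun ζ => (p + F ζ) / (p - F ζ) with hHdef
  have hHp : ∀ ζ ∈ Ω, H (ζ + 2 * Real.pi * I) = k * H ζ + ν := fun ζ hζ => by
    have := hk (F ζ) (hF.2.mapsTo hζ)
    rw [hGF ζ hζ] at this
    exact this
  obtain ⟨hki, hkr, hνr⟩ := affine_halfPlane (k := k) (ν := ν)
    (fun h hh => by
      obtain ⟨ζ, hζ, rfl⟩ := hH.2.surjOn hh
      have := hH.2.mapsTo (hp.add_mem hζ)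
      rw [mem_ofPred_eq] at this
      rw [← hHp ζ hζ]; exact this)
    (fun h hh => by
      obtain ⟨ζ, hζ, rfl⟩ := hH.2.surjOn hh
      obtain ⟨ζ', hζ', rfl⟩ := hshift.2.surjOn hζ
      exact ⟨H ζ', hH.2.mapsTo hζ', (hHp ζ' hζ').symm⟩)
  have hk' : k = (k.re : ℂ) := Complex.ext (by simp) (by simpa using hki)
  have hν' : ν = (ν.im : ℂ) * I := Complex.ext (by simp [hνr]) (by simp)
  set κ := k.re with hκ
  set μ := ν.im with hμ
  by_cases hk1 : κ = 1
  · have hμ0 : μ ≠ 0 := fun h => by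
      have h1 := hHp ζ₀ hζ₀
      rw [hk', hν', hk1, h] at h1
      simp only [ofReal_one, one_mul, ofReal_zero, zero_mul, add_zero] at h1
      have h2 := hH.2.injOn (hp.add_mem hζ₀) hζ₀ h1
      exact hτ (by linear_combination h2)
    have hm : 0 < 2 * Real.pi / |μ| := by positivity
    have hper : ∀ s : ℤ, (s : ℝ) * |μ| = -μ → ∀ ζ ∈ Ω,
        -((2 * Real.pi / |μ| : ℝ) : ℂ) * H (ζ + 2 * Real.pi * I)
          = -((2 * Real.pi / |μ| : ℝ) : ℂ) * H ζ + s * (2 * Real.pi * I) := by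
      intro s hs ζ hζ
      have h0 : ((|μ| : ℝ) : ℂ) ≠ 0 := by exact_mod_cast (abs_pos.2 hμ0).ne'
      have hs' : (s : ℂ) * ((|μ| : ℝ) : ℂ) = -(μ : ℂ) := by exact_mod_cast congrArg ofReal hs
      rw [hHp ζ hζ, hk', hν', hk1]
      push_cast
      field_simp
      linear_combination -I * hs'
    refine ⟨0, le_rfl, one_pos, fun ζ => -((2 * Real.pi / |μ| : ℝ) : ℂ) * H ζ, ?_⟩
    rcases abs_cases μ with ⟨h, -⟩ | ⟨h, -⟩
    · exact ⟨-1, by norm_num, (isConformalOnto_left_halfPlane hm).comp hH,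
        hper (-1) (by push_cast; linarith)⟩
    · exact ⟨1, by norm_num, (isConformalOnto_left_halfPlane hm).comp hH,
        hper 1 (by push_cast; linarith)⟩
  · set l := Real.log κ with hl
    have hl0 : l ≠ 0 := Real.log_ne_zero_of_pos_of_ne_one hkr hk1
    have hlc : (l : ℂ) ≠ 0 := by exact_mod_cast hl0
    have hκ1 : ((1 - κ : ℝ) : ℂ) ≠ 0 := by exact_mod_cast sub_ne_zero.2 (Ne.symm hk1)
    set t : ℂ := ((μ / (1 - κ) : ℝ) : ℂ) * I with ht
    have htr : t.re = 0 := by rw [ht, re_ofReal_mul, I_re, mul_zero]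
    have htk : κ * t + ν = t := by
      rw [ht, hν']
      push_cast at hκ1 ⊢
      field_simp
      ring
    have htrans : IsConformalOnto (fun h => h - t) {h | 0 < h.re} {h | 0 < h.re} :=
      IsConformalOnto.of_inverse (g := fun h => h + t) (differentiableOn_id.sub_const _)
        (fun h hh => by simpa [htr] using hh) (fun h hh => by simpa [htr] using hh)
        (fun h _ => by ring) (fun h _ => by ring)
    refine ⟨Real.exp (-(2 * Real.pi ^ 2 / |l|)), (Real.exp_pos _).le, ?_, _, 1, by norm_num,
      (isConformalOnto_strip hl0).comp (htrans.comp hH), ?_⟩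
    · rw [Real.exp_lt_one_iff]
      have := abs_pos.2 hl0
      have : 0 < 2 * Real.pi ^ 2 / |l| := by positivity
      linarith
    · intro ζ hζ
      have h1 : H ζ - t ≠ 0 := fun h => by
        have := htrans.2.mapsTo (hH.2.mapsTo hζ)
        simp [h] at this
      have h2 : H (ζ + 2 * Real.pi * I) - t = (κ : ℂ) * (H ζ - t) := by
        rw [hHp ζ hζ, ← hk']
        rw [← hk'] at htk
        linear_combination htk
      simp only [h2]
      rw [Complex.log_ofReal_mul hkr h1, ← hl]
      push_cast
      field_simp
      ring

/-! ### The logarithmic covering of an annular domain -/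

theorem exists_local_log {A : Set ℂ} (hA : IsOpen A) (h0 : (0 : ℂ) ∉ A) {z : ℂ} (hz : z ∈ A) :
    ∃ ε > 0, ball z ε ⊆ A ∧ ∃ L : ℂ → ℂ, DifferentiableOn ℂ L (ball z ε) ∧
      ∀ w ∈ ball z ε, exp (L w) = w := by
  obtain ⟨ε, hε, hb⟩ := Metric.isOpen_iff.1 hA z hz
  obtain ⟨L, hL, hLe⟩ := exists_log_of_convex isOpen_ball (convex_ball z ε) differentiableOn_id
    (fun w hw h => by
      rw [id] at h
      exact h0 (h ▸ hb hw))
  exact ⟨ε, hε, hb, L, hL, hLe⟩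

/-- The component containing `P` is invariant under the period because `P` is. Its image under `exp`
is open, and closed in `A` by local logarithms, hence is `A`; invariance then makes the component
the full preimage. -/
theorem isPreconnected_preimage_exp {A P : Set ℂ} (hA : IsOpen A) (hc : IsPreconnected A)
    (h0 : (0 : ℂ) ∉ A) (hP : IsPreconnected P) (hPp : PeriodicSet P) (hPA : P ⊆ exp ⁻¹' A)
    (hne : P.Nonempty) : IsPreconnected (exp ⁻¹' A) := by
  obtain ⟨ζ₀, hζ₀⟩ := hne
  set U := exp ⁻¹' A with hU
  have hUo : IsOpen U := hA.preimage Complex.continuous_exp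
  have hUp : PeriodicSet U := periodicSet_preimage_exp A
  set W := connectedComponentIn U ζ₀ with hW
  have hWU : W ⊆ U := connectedComponentIn_subset _ _
  have hWo : IsOpen W := hUo.connectedComponentIn
  have hPW : P ⊆ W := hP.subset_connectedComponentIn hζ₀ hPA
  have hWp : PeriodicSet W := by
    intro ζ hζ n
    have hmem : ζ₀ + n * (2 * Real.pi * I) ∈ W := hPW (hPp ζ₀ hζ₀ n)
    have himg : IsPreconnected ((fun ζ => ζ + n * (2 * Real.pi * I)) '' W) :=
      isPreconnected_connectedComponentIn.image _ (by fun_prop)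
    have hsub := himg.subset_connectedComponentIn (F := U)
      (mem_image_of_mem _ (hPW hζ₀)) (by rintro _ ⟨y, hy, rfl⟩; exact hUp y (hWU hy) n)
    rw [← connectedComponentIn_eq hmem] at hsub
    exact hsub (mem_image_of_mem _ hζ)
  have himgo : IsOpen (exp '' W) := by
    rw [isOpen_iff_mem_nhds]
    rintro _ ⟨w, hw, rfl⟩
    have : HasStrictDerivAt exp (exp w) w := Complex.hasStrictDerivAt_exp w
    rw [← this.map_nhds_eq (exp_ne_zero w)]
    exact image_mem_map (hWo.mem_nhds hw)
  have hcov : A ⊆ exp '' W := by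
    refine hc.subset_of_closure_inter_subset himgo
      ⟨exp ζ₀, hPA hζ₀, mem_image_of_mem _ (hPW hζ₀)⟩ ?_
    rintro z ⟨hz, hzA⟩
    obtain ⟨ε, hε, hb, L, hL, hLe⟩ := exists_local_log hA h0 hzA
    obtain ⟨_, hw', w, hw, rfl⟩ := mem_closure_iff.1 hz _ isOpen_ball (mem_ball_self hε)
    set c := w - L (exp w) with hcdef
    have hLc : ∀ x ∈ ball z ε, exp (L x + c) = x := fun x hx => by
      rw [Complex.exp_add, hLe x hx, hcdef, Complex.exp_sub, hLe _ hw', div_self (exp_ne_zero _),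
        mul_one]
    have hlift : IsPreconnected ((fun x => L x + c) '' ball z ε) :=
      (convex_ball z ε).isPreconnected.image _ (hL.continuousOn.add continuousOn_const)
    have hwm : w ∈ (fun x => L x + c) '' ball z ε := ⟨exp w, hw', by simp [hcdef]⟩
    have hsub := hlift.subset_connectedComponentIn (F := U) hwm (by
      rintro _ ⟨x, hx, rfl⟩
      rw [hU, mem_preimage, hLc x hx]
      exact hb hx)
    rw [← connectedComponentIn_eq hw] at hsub
    exact ⟨L z + c, hsub (mem_image_of_mem _ (mem_ball_self hε)), hLc z (mem_ball_self hε)⟩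
  have : U = W := by
    refine Subset.antisymm (fun ζ hζ => ?_) hWU
    obtain ⟨w, hw, hwe⟩ := hcov hζ
    obtain ⟨n, hn⟩ := Complex.exp_eq_exp_iff_exists_int.1 hwe.symm
    rw [hn]
    exact hWp w hw n
  rw [this]
  exact isPreconnected_connectedComponentIn

theorem chain_mono {X Y : Set ℂ} (h : X ⊆ Y) {δ : ℝ} {x y : ℂ}
    (hc : Relation.ReflTransGen (ChainStep X δ) x y) :
    Relation.ReflTransGen (ChainStep Y δ) x y := by
  have hle : ChainStep X δ ≤ ChainStep Y δ := fun _ _ s => ⟨h s.1, h s.2.1, s.2.2⟩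
  exact Relation.ReflTransGen.mono hle _ _ hc

/-- A chain in `K` from `e^ζ` to `0` lifts through `log (k' / k)` with small steps while `|k| ≥
e^{-M}`; once `|k| < e^{-M}`, the lift has real part below `-M`. Points not over `K` lie in the
half-plane `Re ≥ 0`. Chains are used because the preimage of `K` need not be connected. -/
theorem chainsToInfinity_compl_preimage_exp {K : Set ℂ} (hK : IsPreconnected K)
    (h0 : (0 : ℂ) ∈ K) : ChainsToInfinity (exp ⁻¹' (ball 0 1 \ K))ᶜ := by
  intro δ hδ ζ hζ M
  set X := (exp ⁻¹' (ball 0 1 \ K))ᶜ with hX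
  have hKX : exp ⁻¹' K ⊆ X := fun z hz h => h.2 hz
  by_cases hζK : exp ζ ∈ K
  · obtain ⟨δ₁, hδ₁, hlog⟩ : ∃ δ₁ > 0, ∀ t : ℂ, dist t 1 < δ₁ → t ≠ 0 ∧ ‖log t‖ < δ := by
      have h1 : ContinuousAt log 1 := continuousAt_clog (by simp)
      have h2 : ∀ᶠ t in 𝓝 (1 : ℂ), t ≠ 0 ∧ ‖log t‖ < δ := by
        refine (eventually_ne_nhds one_ne_zero).and (h1.norm.eventually_lt_const ?_)
        simpa using hδ
      exact Metric.eventually_nhds_iff.1 h2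
    set η := Real.exp (-M) with hη
    have hη0 : 0 < η := Real.exp_pos _
    have hch := chain_of_isPreconnected hK hζK h0 (mul_pos hδ₁ hη0)
    suffices h : ∀ k, Relation.ReflTransGen (ChainStep K (δ₁ * η)) k 0 → ∀ ζ, exp ζ = k → k ∈ K →
        ∃ p, Relation.ReflTransGen (ChainStep X δ) ζ p ∧ M < ‖p‖ from h _ hch ζ rfl hζK
    intro k hk
    induction hk using Relation.ReflTransGen.head_induction_on with
    | refl => exact fun ζ h => absurd h (exp_ne_zero ζ)
    | @head k k' hs _ ih =>
      intro ζ hζk hkK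
      by_cases hkη : ‖k‖ < η
      · refine ⟨ζ, .refl, ?_⟩
        rw [← hζk, Complex.norm_exp, hη, Real.exp_lt_exp] at hkη
        linarith [neg_abs_le ζ.re, abs_re_le_norm ζ]
      · rw [not_lt] at hkη
        have hk0 : k ≠ 0 := hζk ▸ exp_ne_zero ζ
        have hkn := norm_pos_iff.2 hk0
        obtain ⟨h1, h2⟩ := hlog (k' / k) (by
          rw [dist_eq_norm, div_sub_one hk0, norm_div, div_lt_iff₀ hkn, ← dist_eq_norm, dist_comm]
          exact hs.2.2.trans_le (by gcongr))
        have h3 : exp (ζ + log (k' / k)) = k' := by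
          rw [Complex.exp_add, exp_log h1, hζk, mul_div_cancel₀ _ hk0]
        obtain ⟨p, hp, hM⟩ := ih _ h3 hs.2.1
        refine ⟨p, .head ⟨hKX (by rwa [mem_preimage, hζk]), hKX ?_, ?_⟩ hp, hM⟩
        · rw [mem_preimage, h3]; exact hs.2.1
        · simpa [dist_eq_norm] using h2
  · have hre : 0 ≤ ζ.re := by
      by_contra! h
      exact hζ ⟨by rwa [mem_ball_zero_iff, Complex.norm_exp, Real.exp_lt_one_iff], hζK⟩
    have hsub : {z : ℂ | 0 ≤ z.re} ⊆ X := fun z hz h => by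
      have := h.1
      rw [mem_ball_zero_iff, Complex.norm_exp, Real.exp_lt_one_iff] at this
      exact not_lt.2 hz this
    have hp : ((|M| + 1 : ℝ) : ℂ) ∈ {z : ℂ | 0 ≤ z.re} := by
      rw [mem_ofPred_eq, ofReal_re]; positivity
    refine ⟨((|M| + 1 : ℝ) : ℂ), chain_mono hsub
      (chain_of_isPreconnected (convex_halfSpace_re_ge 0).isPreconnected hre hp hδ), ?_⟩
    rw [Complex.norm_real, Real.norm_of_nonneg (by positivity)]
    linarith [le_abs_self M]

/-- A disk minus a continuum is conformally equivalent to a possibly degenerate round annulus. -/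
theorem exists_conformal_roundAnnulus {K : Set ℂ} (hKc : IsClosed K) (hK : IsPreconnected K)
    (h0 : (0 : ℂ) ∈ K) {R : ℝ} (hR : 0 < R) (hR1 : R < 1) (hKR : K ⊆ closedBall 0 R)
    (hA : IsPreconnected (ball 0 1 \ K)) :
    ∃ r : ℝ, 0 ≤ r ∧ r < 1 ∧ ∃ φ : ℂ → ℂ, IsConformalOnto φ (ball 0 1 \ K) (roundAnnulus r) := by
  set A := ball (0 : ℂ) 1 \ K with hAdef
  have hAo : IsOpen A := isOpen_ball.sdiff hKc
  have h0A : (0 : ℂ) ∉ A := fun h => h.2 h0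
  have hlogR : Real.log R < 0 := Real.log_neg hR hR1
  have hPA : strip (Real.log R) 0 ⊆ exp ⁻¹' A := fun η hη => exp_mem_ball_diff hR hKR hη
  have hPne : (strip (Real.log R) 0).Nonempty := by
    refine ⟨((Real.log R / 2 : ℝ) : ℂ), ?_⟩
    constructor <;> rw [ofReal_re] <;> linarith
  obtain ⟨r, hr0, hr1, Ψ, s, hs, hΨ, hper⟩ := exists_periodic_uniformization
    (hAo.preimage Complex.continuous_exp)
    (isPreconnected_preimage_exp hAo hA h0A (convex_strip _ _).isPreconnected
      (periodicSet_strip _ _) hPA hPne)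
    (hPne.mono hPA) (periodicSet_preimage_exp A)
    (fun ζ hζ => by
      have := hζ.1
      rwa [mem_ball_zero_iff, Complex.norm_exp, Real.exp_lt_one_iff] at this)
    (chainsToInfinity_compl_preimage_exp hK h0)
  have hn : ∀ (n : ℤ), ∀ ζ ∈ exp ⁻¹' A,
      Ψ (ζ + n * (2 * Real.pi * I)) = Ψ ζ + n * (s * (2 * Real.pi * I)) := fun n ζ hζ =>
    add_int_mul_period (periodicSet_preimage_exp A) hper n hζ
  -- The period of `Ψ` is an integer multiple of `2πi`, so the branch of the logarithm does not
  -- matter. Injectivity of the quotient map later uses that this multiple is `±1`.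
  have hwell : ∀ ζ ∈ exp ⁻¹' A, exp (Ψ (log (exp ζ))) = exp (Ψ ζ) := by
    intro ζ hζ
    have h1 : exp (log (exp ζ)) = exp ζ := exp_log (exp_ne_zero ζ)
    obtain ⟨n, hn'⟩ := Complex.exp_eq_exp_iff_exists_int.1 h1
    rw [hn', hn n ζ hζ]
    exact Complex.exp_eq_exp_iff_exists_int.2 ⟨n * s, by push_cast; ring⟩
  have hne : ∀ z ∈ A, z ≠ 0 := fun z hz h => h0A (h ▸ hz)
  have hlog : ∀ z ∈ A, log z ∈ exp ⁻¹' A := fun z hz => by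
    rwa [mem_preimage, exp_log (hne z hz)]
  refine ⟨r, hr0, hr1, fun z => exp (Ψ (log z)), ?_, ?_, ?_, ?_⟩
  · intro z hz
    obtain ⟨ε, hε, hb, L, hL, hLe⟩ := exists_local_log hAo h0A hz
    have hLm : MapsTo L (ball z ε) (exp ⁻¹' A) := fun w hw => by
      rw [mem_preimage, hLe w hw]; exact hb hw
    have hd : DifferentiableOn ℂ (fun w => exp (Ψ (L w))) (ball z ε) := (hΨ.1.comp hL hLm).cexp
    have hd' : DifferentiableOn ℂ (fun w => exp (Ψ (log w))) (ball z ε) := hd.congr fun w hw => by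
      have := hwell (L w) (hLm hw)
      rwa [hLe w hw] at this
    exact (hd'.differentiableAt (ball_mem_nhds z hε)).differentiableWithinAt
  · exact fun z hz => hΨ.2.mapsTo (hlog z hz)
  · intro z hz w hw h
    obtain ⟨n, hn'⟩ := Complex.exp_eq_exp_iff_exists_int.1 h
    have hs' : (s : ℂ) * s = 1 := by exact_mod_cast hs
    have h1 : Ψ (log z) = Ψ (log w + ((n * s : ℤ) : ℂ) * (2 * Real.pi * I)) := by
      rw [hn _ _ (hlog w hw), hn']
      push_cast
      linear_combination (-(n : ℂ) * (2 * Real.pi * I)) * hs'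
    have h2 := hΨ.2.injOn (hlog z hz) (periodicSet_preimage_exp A _ (hlog w hw) _) h1
    rw [← exp_log (hne z hz), ← exp_log (hne w hw)]
    exact Complex.exp_eq_exp_iff_exists_int.2 ⟨_, h2⟩
  · intro w hw
    have hw0 : w ≠ 0 := norm_pos_iff.1 (hr0.trans_lt hw.1)
    obtain ⟨ζ, hζ, h⟩ := hΨ.2.surjOn (show log w ∈ exp ⁻¹' roundAnnulus r by
      rwa [mem_preimage, exp_log hw0])
    refine ⟨exp ζ, hζ, ?_⟩
    simp only
    rw [hwell ζ hζ, h, exp_log hw0]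

/-! ### Unfolding the definitions, and the main theorem -/

theorem exp_neg_annularED {D : Set ℂ}
    (h : ∃ r : ℝ, 0 < r ∧ r < 1 ∧ ∃ φ : ℂ → ℂ, IsConformalOnto φ D (roundAnnulus r)) :
    ∃ r : ℝ, 0 < r ∧ (∃ φ : ℂ → ℂ, IsConformalOnto φ D (roundAnnulus r)) ∧
      Real.exp (-(2 * Real.pi * annularED D)) = r := by
  refine ⟨h.choose, h.choose_spec.1, h.choose_spec.2.2, ?_⟩
  have hpi := Real.pi_ne_zero
  rw [annularED, dif_pos h, one_div, one_div, Real.log_inv]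
  have : -(2 * Real.pi * ((2 * Real.pi)⁻¹ * -Real.log h.choose)) = Real.log h.choose := by
    field_simp
  rw [this, Real.exp_log h.choose_spec.1]

theorem inv_confRadius {z : ℂ} {D : Set ℂ}
    (h : ∃ c : ℝ, 0 < c ∧ ∃ φ : ℂ → ℂ,
      IsConformalOnto φ D (ball 0 1) ∧ φ z = 0 ∧ HasDerivAt φ (c : ℂ) z) :
    ∃ c : ℝ, 0 < c ∧ (∃ φ : ℂ → ℂ,
      IsConformalOnto φ D (ball 0 1) ∧ φ z = 0 ∧ HasDerivAt φ (c : ℂ) z) ∧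
      (confRadius z D)⁻¹ = c := by
  refine ⟨h.choose, h.choose_spec.1, h.choose_spec.2, ?_⟩
  rw [confRadius, dif_pos h, inv_inv]

theorem exists_norm_eq_rPlus {C : Set ℂ} (hC : IsCompact C) (hne : C.Nonempty) :
    ∃ a ∈ C, ‖a‖ = rPlus C ∧ C ⊆ closedBall 0 ‖a‖ := by
  obtain ⟨a, ha, hmax⟩ := hC.exists_isMaxOn hne continuous_norm.continuousOn
  refine ⟨a, ha, ?_, fun z hz => mem_closedBall_zero_iff.2 (hmax hz)⟩
  have : IsGreatest ((fun z : ℂ => ‖z‖) '' C) ‖a‖ :=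
    ⟨mem_image_of_mem _ ha, by rintro _ ⟨z, hz, rfl⟩; exact hmax hz⟩
  exact this.csSup_eq.symm

end LoopED

open LoopED

theorem mainTheorem12 (C : Set ℂ) (hC : IsSimpleLoop C) (hsub : C ⊆ Metric.ball 0 1)
    (hpos : 0 < Metric.infDist 0 C) (h0 : Surrounds C 0) :
    (Real.exp (-(2 * Real.pi * diskED C)) ≤ rPlus C ∧
      rPlus C ≤ 4 * Real.exp (-(2 * Real.pi * diskED C))) ∧
    (Real.exp (-(2 * Real.pi * diskED C)) * (loopCR C)⁻¹ ≤ rPlus C / rMinus C ∧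
      rPlus C / rMinus C ≤ 16 * Real.exp (-(2 * Real.pi * diskED C)) * (loopCR C)⁻¹) := by
  obtain ⟨hCk, hCc, hne⟩ : IsCompact C ∧ IsPreconnected C ∧ C.Nonempty := by
    obtain ⟨γ, hγ, -, rfl⟩ := hC
    exact ⟨isCompact_range hγ, isPreconnected_range hγ, range_nonempty γ⟩
  obtain ⟨a, ha, har, hCa⟩ := exists_norm_eq_rPlus hCk hne
  obtain ⟨p, hp, hpm⟩ := hCk.exists_infDist_eq_dist hne 0
  rw [dist_zero_left] at hpm
  have ha0 : a ≠ 0 := fun h => h0.1 (h ▸ ha)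
  have ha1 : ‖a‖ < 1 := mem_ball_zero_iff.1 (hsub ha)
  have hR : 0 < ‖a‖ := norm_pos_iff.2 ha0
  set K := (loopExterior C)ᶜ with hK
  have hKc : IsClosed K := (isOpen_loopExterior hCk.isClosed hR.le hCa).isClosed_compl
  have hKp : IsPreconnected K := isPreconnected_compl_loopExterior hCk.isClosed hCc hne
  have hKR : K ⊆ closedBall 0 ‖a‖ := compl_loopExterior_subset hR.le hCa
  have h0K : (0 : ℂ) ∈ K := fun h => h.2 h0
  have haK : a ∈ K := subset_compl_loopExterior ha
  have hAK : ball (0 : ℂ) 1 ∩ loopExterior C = ball 0 1 \ K := by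
    rw [hK, sdiff_eq, compl_compl]
  have hA : IsPreconnected (ball 0 1 \ K) :=
    hAK ▸ isPreconnected_ball_inter_loopExterior hCk.isClosed hR.le ha1 hCa
  -- `r` is whichever radius the definition selects. The bounds hold for every admissible radius, so
  -- uniqueness is not needed; positivity in the existence claim comes from `0 < ‖a‖ ≤ 4r`.
  obtain ⟨r, hr, ⟨φ, hφ⟩, hED⟩ := exp_neg_annularED (D := ball 0 1 ∩ loopExterior C) (by
    rw [hAK]
    obtain ⟨r, hr0, hr1, φ, hφ⟩ := exists_conformal_roundAnnulus hKc hKp h0K hR ha1 hKR hA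
    have := norm_le_four_mul hKp hKc h0K haK ha0 hKR ha1 hr0 hφ
    exact ⟨r, by linarith, hr1, φ, hφ⟩)
  have hD := connectedComponentIn_ball_diff hR.le ha1 hCa h0
  obtain ⟨c, hc, ⟨f, hf, hf0, hfc⟩, hCR⟩ := inv_confRadius
    (exists_conformal_component hCk.isClosed hCc hne h0
      (hD ▸ (connectedComponentIn_subset _ _).trans sdiff_subset))
  rw [hAK] at hφ
  have h1 : r ≤ ‖a‖ := le_of_conformal_roundAnnulus hKc h0K hR hKR ha1 hr hφ
  have h2 : ‖a‖ ≤ 4 * r := norm_le_four_mul hKp hKc h0K haK ha0 hKR ha1 hr.le hφ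
  have hp0 : 0 < ‖p‖ := hpm ▸ hpos
  have h3 : c⁻¹ ≤ 4 * ‖p‖ := inv_deriv_le_four_mul hCk.isClosed.isOpen_compl.connectedComponentIn
    hf (mem_connectedComponentIn h0.1) hf0 hc hfc fun h => connectedComponentIn_subset _ _ h hp
  have h4 : ‖p‖ ≤ c⁻¹ := le_inv_deriv hf hf0 hc hfc hp0
    ((convex_ball 0 ‖p‖).isPreconnected.subset_connectedComponentIn (mem_ball_self hp0)
      fun z hz hzC => by
        have := infDist_le_dist_of_mem (x := (0 : ℂ)) hzC
        rw [dist_zero_left, hpm] at this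
        exact not_lt.2 this (mem_ball_zero_iff.1 hz))
  rw [← hD] at hCR
  rw [diskED, hED, loopCR, hCR, rMinus, hpm, ← har]
  refine ⟨⟨h1, h2⟩, ?_, ?_⟩
  · rw [le_div_iff₀ hp0]
    have : c * ‖p‖ ≤ 1 := by rwa [le_inv_comm₀ hp0 hc, ← one_div, le_div_iff₀ hp0] at h4
    nlinarith
  · rw [div_le_iff₀ hp0]
    have : 1 ≤ 4 * (c * ‖p‖) := by
      rw [inv_le_iff_one_le_mul₀ hc] at h3
      linarith
    nlinarith
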